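/- Let $B\ge 1$ be an integer and let $\tau_0,\tau_1,\dots$ be i.i.d. exponential random variables with parameter $1$ on a probability space. One unit of energy arrives at each of the times $t_n=\tau_0+\dots+\tau_n$, $n\ge 0$ (a Poisson process of rate $1$), and is stored in a battery of capacity $B$ that is empty at time $0$; energy that does not fit is lost. Each update consumes one unit of energy. An online feasible policy is a sequence of almost surely finite random times $0=s_0\le s_1\le s_2\le\cdots$ such that every $s_i$ is a stopping time of the filtration generated by the energy arrivals and such that, almost surely, the battery holds at least one unit of energy at every update: if $E_0=0$ and $E_i$ denotes the energy left immediately after the $i$-th update ($i\ge1$), then $$\min\{E_{i-1}+A(s_{i-1},s_i],\,B\}\ge 1,\qquad E_i=\min\{E_{i-1}+A(s_{i-1},s_i],\,B\}-1\qquad(i\ge1),$$ where $A(a,b]$ is the number of energy arrivals in $(a,b]$. Put $x_i=s_i-s_{i-1}$, let $n(T)$ be the number of updates $s_i\le T$ with $i\ge 1$, and let $$r(T)=\frac12\sum_{i=1}^{n(T)}x_i^2+\frac12\bigl(T-s_{n(T)}\bigr)^2$$ be the area up to time $T$ under the curve of the age of information. The long-term average age of the policy is $\limsup_{T\to\infty}\frac1T\mathbb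 E[r(T)]$. A policy is called uniformly bounded if $\sup_{i\ge 1}\mathbb E[x_i^2]<\infty$. **Theorem.** There is a uniformly bounded online feasible policy that minimizes the long-term average age among all uniformly bounded online feasible policies and that is a renewal policy: for every $k\in\{0,1,\dots,B-1\}$, the state $(k,0)$ (an update has just been made and $k$ units of energy are left, i.e. $E_i=k$; the start $i=0$ counts as a visit to $(0,0)$) is almost surely entered infinitely often, and the successive times $l_0\le l_1\le l_2\le\cdots$ at which it is entered form a (possibly delayed) renewal process; that is, $l_0$ and the epoch lengths $l_{n+1}-l_n$, $n\ge0$, are nonnegative and jointly independent, and the epoch lengths are identically distributed and not almost surely zero. -/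

import Mathlib

open MeasureTheory ProbabilityTheory Filter
open scoped NNReal ENNReal

namespace BatteryAge

variable {Ω : Type*}

/-- The time of the `n`-th energy arrival (counting from `n = 0`), for inter-arrival times `τ`. -/
noncomputable def arrivalTime (τ : ℕ → Ω → ℝ) (n : ℕ) (ω : Ω) : ℝ :=
  ∑ i ∈ Finset.range (n + 1), τ i ω

/-- Energy arrives, one unit at a time, according to a Poisson process of rate `1`:
the inter-arrival times are i.i.d. exponential with parameter `1`. -/
structure IsPoissonRecharge [MeasurableSpace Ω] (P : Measure Ω) (τ : ℕ → Ω → ℝ) : Prop where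
  measurable : ∀ n, Measurable (τ n)
  indep : iIndepFun τ P
  law : ∀ n, P.map (τ n) = expMeasure 1

lemma measurable_arrivalTime [MeasurableSpace Ω] {τ : ℕ → Ω → ℝ} (hτ : ∀ n, Measurable (τ n))
    (n : ℕ) : Measurable (arrivalTime τ n) :=
  Finset.measurable_sum _ fun i _ => hτ i

/-- The causal information on the energy arrivals: at time `t` one knows, for each `n` and each
`u ≤ t`, whether the `n`-th arrival has occurred by time `u`, and nothing else. -/
def arrivalFiltration [m : MeasurableSpace Ω] (τ : ℕ → Ω → ℝ) (hτ : ∀ n, Measurable (τ n)) :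
    Filtration ℝ≥0 m where
  seq t := MeasurableSpace.generateFrom
    {A | ∃ n : ℕ, ∃ u : ℝ≥0, u ≤ t ∧ A = {ω | arrivalTime τ n ω ≤ u}}
  mono' := by
    intro t t' h
    refine MeasurableSpace.generateFrom_mono ?_
    rintro A ⟨n, u, hu, rfl⟩
    exact ⟨n, u, hu.trans h, rfl⟩
  le' := by
    intro t
    refine MeasurableSpace.generateFrom_le ?_
    rintro A ⟨n, u, -, rfl⟩
    exact measurableSet_le (measurable_arrivalTime hτ n) measurable_const

/-- The number of energy units harvested in the time interval `(a, b]`. -/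
noncomputable def harvested (τ : ℕ → Ω → ℝ) (a b : ℝ≥0∞) (ω : Ω) : ℕ :=
  {n : ℕ | a < ENNReal.ofReal (arrivalTime τ n ω) ∧
    ENNReal.ofReal (arrivalTime τ n ω) ≤ b}.ncard

/-- The energy left in the battery of size `B` immediately after the `i`-th update, for the
update times `s 1, s 2, …`, with `s 0 = 0` the start of time, when the battery is empty.
Feasibility makes sure that the subtraction below does not truncate. -/
noncomputable def energyAfter (B : ℕ) (τ : ℕ → Ω → ℝ) (s : ℕ → Ω → ℝ≥0∞) : ℕ → Ω → ℕ
  | 0, _ => 0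
  | i + 1, ω =>
      min (energyAfter B τ s i ω + harvested τ (s i ω) (s (i + 1) ω) ω) B - 1

/-- The energy available in the battery of size `B` for the `(i + 1)`-st update. -/
noncomputable def energyBefore (B : ℕ) (τ : ℕ → Ω → ℝ) (s : ℕ → Ω → ℝ≥0∞) (i : ℕ) (ω : Ω) : ℕ :=
  min (energyAfter B τ s i ω + harvested τ (s i ω) (s (i + 1) ω) ω) B

/-- The inter-update time between the `i`-th and the `(i + 1)`-st update. -/
noncomputable def interUpdate (s : ℕ → Ω → ℝ≥0∞) (i : ℕ) (ω : Ω) : ℝ≥0∞ :=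
  s (i + 1) ω - s i ω

/-- `s` is an online feasible transmission policy: every update time is decided causally from the
energy arrivals, and almost surely the update times are finite and ordered, and each update
finds at least one unit of energy in the battery. -/
structure IsOnlinePolicy [MeasurableSpace Ω] (P : Measure Ω) (B : ℕ) (τ : ℕ → Ω → ℝ)
    (hτ : ∀ n, Measurable (τ n)) (s : ℕ → Ω → ℝ≥0∞) : Prop where
  start : ∀ ω, s 0 ω = 0
  causal : ∀ i, IsStoppingTime (arrivalFiltration τ hτ) (s i)
  finite : ∀ᵐ ω ∂P, ∀ i, s i ω < ∞
  ordered : ∀ᵐ ω ∂P, ∀ i, s i ω ≤ s (i + 1) ω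
  energy_causality : ∀ᵐ ω ∂P, ∀ i, 1 ≤ energyBefore B τ s i ω

/-- The inter-update times have a bounded second moment. -/
def IsUniformlyBounded [MeasurableSpace Ω] (P : Measure Ω) (s : ℕ → Ω → ℝ≥0∞) : Prop :=
  ∃ C : ℝ≥0, ∀ i, ∫⁻ ω, interUpdate s i ω ^ 2 ∂P ≤ C

/-- The number of updates sent by time `T`. -/
noncomputable def updateCount (s : ℕ → Ω → ℝ≥0∞) (T : ℝ≥0) (ω : Ω) : ℕ :=
  {i : ℕ | 1 ≤ i ∧ s i ω ≤ T}.ncard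

/-- The area under the age curve up to time `T`. -/
noncomputable def ageArea (s : ℕ → Ω → ℝ≥0∞) (T : ℝ≥0) (ω : Ω) : ℝ≥0∞ :=
  (∑ i ∈ Finset.range (updateCount s T ω), interUpdate s i ω ^ 2) / 2 +
    ((T : ℝ≥0∞) - s (updateCount s T ω) ω) ^ 2 / 2

/-- The long-term average age of information. -/
noncomputable def averageAge [MeasurableSpace Ω] (P : Measure Ω) (s : ℕ → Ω → ℝ≥0∞) : ℝ≥0∞ :=
  limsup (fun T : ℝ≥0 => (∫⁻ ω, ageArea s T ω ∂P) / T) atTop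

/-- `s` minimizes the long-term average age among all uniformly bounded online policies. -/
structure IsOptimalPolicy [MeasurableSpace Ω] (P : Measure Ω) (B : ℕ) (τ : ℕ → Ω → ℝ)
    (hτ : ∀ n, Measurable (τ n)) (s : ℕ → Ω → ℝ≥0∞) : Prop where
  online : IsOnlinePolicy P B τ hτ s
  bounded : IsUniformlyBounded P s
  optimal : ∀ s' : ℕ → Ω → ℝ≥0∞, IsOnlinePolicy P B τ hτ s' → IsUniformlyBounded P s' →
    averageAge P s ≤ averageAge P s'

/-- The set of the (indices of) updates at which the system enters the state `(k, 0)`. The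
system is in the state `(0, 0)` at time `0`, and this is counted as the update number `0`. -/
def visits (B : ℕ) (τ : ℕ → Ω → ℝ) (s : ℕ → Ω → ℝ≥0∞) (k : ℕ) (ω : Ω) : Set ℕ :=
  {i | energyAfter B τ s i ω = k}

/-- The time of the `n`-th visit (counting from `n = 0`) to the state `(k, 0)`; meaningful when
there are infinitely many visits. -/
noncomputable def visitTime (B : ℕ) (τ : ℕ → Ω → ℝ) (s : ℕ → Ω → ℝ≥0∞) (k n : ℕ) (ω : Ω) : ℝ :=
  (s (Nat.nth (fun i => i ∈ visits B τ s k ω) n) ω).toReal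

/-- The waiting time for the first event (`n = 0`), and then the times in between consecutive
events, of a sequence of random times `l`. -/
def gap (l : ℕ → Ω → ℝ) : ℕ → Ω → ℝ
  | 0, ω => l 0 ω
  | n + 1, ω => l (n + 1) ω - l n ω

/-- The times `l 0 ≤ l 1 ≤ …` form a (possibly delayed) renewal process: the waiting time `l 0`
and the times `l (n + 1) - l n` are nonnegative and jointly independent, and the latter are
identically distributed and not almost surely zero. -/
structure IsRenewalProcess [MeasurableSpace Ω] (P : Measure Ω) (l : ℕ → Ω → ℝ) : Prop where
  aemeasurable : ∀ n, AEMeasurable (l n) P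
  nonneg : ∀ n, ∀ᵐ ω ∂P, 0 ≤ gap l n ω
  indep : iIndepFun (gap l) P
  identDistrib : ∀ n, IdentDistrib (gap l (n + 1)) (gap l 1) P P
  nondegenerate : ¬ ∀ᵐ ω ∂P, gap l 1 ω = 0

end BatteryAge

/-!
The optimal policy is a threshold policy: with `k ≥ 1` units in the battery it updates as soon as
the age reaches `θ k`, where `θ` is antitone, and with an empty battery it waits.

Optimality. Penalize time at the rate `lam`, so that an epoch of length `x` costs
`x ^ 2 / 2 - lam * x`. For the right `lam`, the optimality equation of the resulting control problem
has a solution `H k a`, a function of the energy `k` and the age `a`, with thresholds `θ k`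
(`exists_isRelativeValue`). It is built by recursion on the number of missing units, starting from
the full battery, for which the threshold is `lam` itself; `lam` is found by the intermediate value
theorem, as the value for which an empty battery never leads to an update. The equation says that
the cost so far plus the relative value does not decrease: on average between two arrivals, and
surely at an update. It is constant, respectively, if the age stays below the thresholds and at an
update above the threshold. Between two arrivals a policy is a function of the past arrivals
(`exists_past_of_isStoppingTime`), so that Fubini's theorem turns this into a statement on expected
gains (`integral_policyGain`). Summing them, over the pairs of an epoch of the policy and an
interval between arrivals, bounds the mean area under the age curve up to `T` from below by about
`lam * T`, for every policy (`le_averageAge`), and from above, for the threshold policy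
(`averageAge_le`). Hence `lam` is the optimal average age.

Renewal. The arrivals after an update of an online policy are independent of the updates and the
energy levels so far, and have the law of the original ones (`IsOnlinePolicy.strong_markov`): given
their number, the last update falls between two arrivals, and the exponential distribution is
memoryless. For the threshold policy, the energy level and the arrivals after an update determine
all that follows, so the time until the next visit to a level is a functional of the arrivals after
the current visit; hence the successive times between visits are independent with a common law
(`isRenewalProcess_visitTime`). The level is visited infinitely often, since whatever the present
state, with a fixed positive probability the next arrivals fill the battery quickly and then pause
for so long that the updates empty it one unit at a time (`iterate_step_of_mem_refillPaths`,
`infinite_visits`).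
-/

namespace BatteryAge

/-! ### The exponential distribution -/

instance isProbabilityMeasure_expMeasure_one : IsProbabilityMeasure (expMeasure 1) :=
  isProbabilityMeasure_expMeasure one_pos

lemma expMeasure_one_eq_withDensity :
    expMeasure 1 =
      (volume.restrict (Set.Ioi (0 : ℝ))).withDensity fun u => ENNReal.ofReal (Real.exp (-u)) := by
  rw [← withDensity_indicator measurableSet_Ioi]
  change volume.withDensity (exponentialPDF 1) = _
  refine withDensity_congr_ae ?_
  have h0 : ∀ᵐ x : ℝ, x ≠ 0 := by simp [ae_iff, measure_singleton]
  filter_upwards [h0] with x hx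
  rw [exponentialPDF_eq]
  by_cases h : 0 < x
  · simp [Set.indicator, h, h.le]
  · have h' : ¬ 0 ≤ x := fun h' => h (lt_of_le_of_ne h' (Ne.symm hx))
    simp [Set.indicator, h, h']

lemma lintegral_expMeasure_one (f : ℝ → ℝ≥0∞) (hf : Measurable f) :
    ∫⁻ u, f u ∂expMeasure 1 = ∫⁻ u in Set.Ioi 0, ENNReal.ofReal (Real.exp (-u)) * f u := by
  rw [expMeasure_one_eq_withDensity, lintegral_withDensity_eq_lintegral_mul _ (by fun_prop) hf]
  rfl

lemma integral_expMeasure_one (f : ℝ → ℝ) :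
    ∫ u, f u ∂expMeasure 1 = ∫ u in Set.Ioi 0, Real.exp (-u) * f u := by
  rw [expMeasure_one_eq_withDensity, integral_withDensity_eq_integral_toReal_smul (by fun_prop)
    (by simp)]
  refine integral_congr_ae (Eventually.of_forall fun u => ?_)
  simp [ENNReal.toReal_ofReal (Real.exp_pos _).le]

lemma integrable_expMeasure_one_iff (f : ℝ → ℝ) :
    Integrable f (expMeasure 1) ↔ IntegrableOn (fun u => Real.exp (-u) * f u) (Set.Ioi 0) := by
  rw [expMeasure_one_eq_withDensity, integrable_withDensity_iff_integrable_smul' (by fun_prop)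
    (by simp)]
  refine integrable_congr (Eventually.of_forall fun u => ?_)
  simp [ENNReal.toReal_ofReal (Real.exp_pos _).le]

lemma ae_pos_expMeasure_one : ∀ᵐ u ∂expMeasure 1, 0 < u := by
  rw [expMeasure_one_eq_withDensity]
  exact (withDensity_absolutelyContinuous _ _).ae_le (ae_restrict_mem measurableSet_Ioi)

lemma integrable_rpow_expMeasure_one {s : ℝ} (hs : 0 ≤ s) :
    Integrable (fun u : ℝ => u ^ s) (expMeasure 1) := by
  rw [integrable_expMeasure_one_iff]
  have := Real.GammaIntegral_convergent (s := s + 1) (by linarith)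
  simpa using this

lemma integral_rpow_expMeasure_one {s : ℝ} (hs : 0 ≤ s) :
    ∫ u, u ^ s ∂expMeasure 1 = Real.Gamma (s + 1) := by
  rw [integral_expMeasure_one, Real.Gamma_eq_integral (by linarith)]
  simp

lemma integrable_id_expMeasure_one : Integrable (fun u : ℝ => u) (expMeasure 1) := by
  simpa using integrable_rpow_expMeasure_one zero_le_one

lemma integral_id_expMeasure_one : ∫ u, u ∂expMeasure 1 = 1 := by
  have := integral_rpow_expMeasure_one zero_le_one
  simpa [Real.Gamma_add_one] using this

lemma integrable_sq_expMeasure_one : Integrable (fun u : ℝ => u ^ 2) (expMeasure 1) := by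
  simpa using integrable_rpow_expMeasure_one zero_le_two

lemma integral_sq_expMeasure_one : ∫ u, u ^ 2 ∂expMeasure 1 = 2 := by
  have := integral_rpow_expMeasure_one zero_le_two
  rw [Real.Gamma_add_one two_ne_zero, Real.Gamma_two] at this
  simpa using this

/-- The exponential distribution is memoryless. -/
lemma map_sub_restrict_Ioi_expMeasure_one {c : ℝ} (hc : 0 ≤ c) :
    ((expMeasure 1).restrict (Set.Ioi c)).map (fun u => u - c) =
      ENNReal.ofReal (Real.exp (-c)) • expMeasure 1 := by
  ext A hA
  have hm : Measurable fun u : ℝ => u - c := by fun_prop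
  rw [Measure.map_apply hm hA, Measure.restrict_apply (hm hA), Measure.smul_apply, smul_eq_mul,
    ← lintegral_indicator_one ((hm hA).inter measurableSet_Ioi), ← lintegral_indicator_one hA,
    lintegral_expMeasure_one _ (measurable_one.indicator ((hm hA).inter measurableSet_Ioi)),
    lintegral_expMeasure_one _ (measurable_one.indicator hA),
    ← lintegral_indicator measurableSet_Ioi, ← lintegral_indicator measurableSet_Ioi,
    ← lintegral_const_mul _ (by
      refine Measurable.indicator ?_ measurableSet_Ioi
      exact Measurable.mul (by fun_prop) (measurable_one.indicator hA)),
    ← lintegral_sub_right_eq_self (μ := volume) (fun u : ℝ =>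
      ENNReal.ofReal (Real.exp (-c)) * (Set.Ioi 0).indicator (fun u =>
        ENNReal.ofReal (Real.exp (-u)) * A.indicator 1 u) u) c]
  refine lintegral_congr fun u => ?_
  by_cases h : c < u
  · have h0 : 0 < u := hc.trans_lt h
    by_cases hu : u - c ∈ A
    · simp only [Set.indicator, Set.mem_Ioi, h0, sub_pos, h, if_true, Set.mem_inter_iff,
        Set.mem_preimage, hu, and_self, Pi.one_apply, mul_one]
      rw [← ENNReal.ofReal_mul (Real.exp_pos _).le, ← Real.exp_add]
      congr 2; ring
    · simp [Set.indicator, hu]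
  · simp [Set.indicator, h]

lemma expMeasure_one_Ioi {c : ℝ} (hc : 0 ≤ c) :
    expMeasure 1 (Set.Ioi c) = ENNReal.ofReal (Real.exp (-c)) := by
  have h := congrArg (fun μ : Measure ℝ => μ Set.univ) (map_sub_restrict_Ioi_expMeasure_one hc)
  simpa [Measure.map_apply (show Measurable fun u : ℝ => u - c by fun_prop)] using h

lemma setIntegral_Ioi_expMeasure_one {c : ℝ} (hc : 0 ≤ c) (f : ℝ → ℝ) (hf : Measurable f) :
    ∫ u in Set.Ioi c, f u ∂expMeasure 1 = Real.exp (-c) * ∫ u, f (c + u) ∂expMeasure 1 := by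
  have hm : Measurable fun u : ℝ => u - c := by fun_prop
  have h : ∫ u, f (c + u) ∂(((expMeasure 1).restrict (Set.Ioi c)).map (fun u => u - c)) =
      ∫ u in Set.Ioi c, f u ∂expMeasure 1 := by
    have hf' : Measurable fun u => f (c + u) := hf.comp (by fun_prop)
    rw [integral_map hm.aemeasurable hf'.aestronglyMeasurable]
    simp
  rw [← h, map_sub_restrict_Ioi_expMeasure_one hc, integral_smul_measure,
    ENNReal.toReal_ofReal (Real.exp_pos _).le, smul_eq_mul]

lemma integral_expMeasure_one_split {c : ℝ} (hc : 0 ≤ c) (f : ℝ → ℝ) (hf : Measurable f)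
    (hi : Integrable f (expMeasure 1)) :
    ∫ u, f u ∂expMeasure 1 =
      ∫ u in Set.Iic c, f u ∂expMeasure 1 + Real.exp (-c) * ∫ u, f (c + u) ∂expMeasure 1 := by
  rw [← setIntegral_Ioi_expMeasure_one hc f hf, ← Set.compl_Iic,
    integral_add_compl measurableSet_Iic hi]

/-- Functions of at most quadratic growth are integrable along the exponential distribution. -/
lemma integrable_expMeasure_one_of_quadratic {f : ℝ → ℝ} (hf : Measurable f) (c₀ c₁ c₂ : ℝ)
    (hb : ∀ u, 0 ≤ u → |f u| ≤ c₀ + c₁ * u + c₂ * u ^ 2) : Integrable f (expMeasure 1) := by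
  have hg : Integrable (fun u : ℝ => c₀ + c₁ * u + c₂ * u ^ 2) (expMeasure 1) :=
    ((integrable_const _).add (integrable_id_expMeasure_one.const_mul _)).add
      (integrable_sq_expMeasure_one.const_mul _)
  refine hg.mono' hf.aestronglyMeasurable ?_
  filter_upwards [ae_pos_expMeasure_one] with u hu
  exact hb u hu.le

/-! ### The optimality equation -/

/-- The optimal expected cost of the wait for the next update, relative to an immediate update,
when the battery lacks `j` units and the age is `a`, under the running cost `age - lam`.
Truncations that are inactive for `0 ≤ lam ≤ 1` and `0 ≤ a`, and the floor `exp (-4)`, which is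
inactive at the optimal `lam`, make the function bounded and continuous for all arguments. -/
noncomputable def waitCost : ℕ → ℝ → ℝ → ℝ
  | 0, lam, a => -(max (min lam 1 - max a 0) 0) ^ 2 / 2
  | j + 1, lam, a => ∫ u, (waitCost j lam (a + u) -
      max (-Real.log (max (1 - lam + ∫ v, waitCost j lam v ∂expMeasure 1) (Real.exp (-4))) -
        max (a + u) 0) 0) ∂expMeasure 1

/-- When the battery lacks `j + 1` units, the fixed-point equation for the age threshold `θ` reads
`exp (-θ) = level lam j`; at the optimal `lam` for a battery of size `j + 1`, the level vanishes:
an empty battery has an infinite threshold. -/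
noncomputable def level (lam : ℝ) (j : ℕ) : ℝ := 1 - lam + ∫ v, waitCost j lam v ∂expMeasure 1

/-- The age at which a battery that lacks `j` units is used for an update. -/
noncomputable def threshold (lam : ℝ) : ℕ → ℝ
  | 0 => lam
  | j + 1 => -Real.log (max (level lam j) (Real.exp (-4)))

lemma waitCost_succ (j : ℕ) (lam a : ℝ) :
    waitCost (j + 1) lam a = ∫ u, (waitCost j lam (a + u) -
      max (threshold lam (j + 1) - max (a + u) 0) 0) ∂expMeasure 1 := rfl

lemma threshold_succ_le (lam : ℝ) (j : ℕ) : threshold lam (j + 1) ≤ 4 := by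
  have h := Real.log_le_log (Real.exp_pos _) (le_max_right (level lam j) (Real.exp (-4)))
  rw [Real.log_exp] at h
  simp only [threshold]
  linarith

lemma posPart_threshold_mem (lam : ℝ) (j : ℕ) (t : ℝ) :
    |max (threshold lam (j + 1) - max t 0) 0| ≤ 4 := by
  have := threshold_succ_le lam j
  have := le_max_right t 0
  rw [abs_of_nonneg (le_max_right _ _)]
  exact max_le (by linarith) (by norm_num)

lemma abs_waitCost_le (j : ℕ) (lam a : ℝ) : |waitCost j lam a| ≤ 4 * j + 1 := by
  induction j generalizing a with
  | zero =>
    have h0 : 0 ≤ max (min lam 1 - max a 0) 0 := le_max_right _ _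
    have h1 : max (min lam 1 - max a 0) 0 ≤ 1 :=
      max_le (by linarith [min_le_right lam 1, le_max_right a 0]) zero_le_one
    simp only [waitCost]
    rw [abs_le]
    constructor <;> push_cast <;> nlinarith
  | succ j ih =>
    rw [waitCost_succ, ← Real.norm_eq_abs]
    refine (norm_integral_le_of_norm_le_const (C := 4 * j + 1 + 4)
      (Eventually.of_forall fun u => ?_)).trans ?_
    · exact (norm_sub_le _ _).trans (add_le_add (ih _) (posPart_threshold_mem _ _ _))
    · simp; linarith

lemma waitCost_nonpos (j : ℕ) (lam a : ℝ) : waitCost j lam a ≤ 0 := by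
  induction j generalizing a with
  | zero =>
    simp only [waitCost]
    nlinarith [sq_nonneg (max (min lam 1 - max a 0) 0)]
  | succ j ih =>
    rw [waitCost_succ]
    exact integral_nonpos fun u => sub_nonpos.2 ((ih _).trans (le_max_right _ _))

lemma continuous_waitCost_level (j : ℕ) :
    Continuous (fun p : ℝ × ℝ => waitCost j p.1 p.2) ∧ Continuous (fun lam => level lam j) := by
  have key : ∀ j, Continuous (fun p : ℝ × ℝ => waitCost j p.1 p.2) →
      Continuous (fun lam => level lam j) := by
    intro j hj
    refine (continuous_const.sub continuous_id).add
      (continuous_of_dominated (bound := fun _ => 4 * j + 1) (fun lam => ?_) (fun lam => ?_)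
        (integrable_const _) ?_)
    · exact (hj.comp (by fun_prop : Continuous fun v : ℝ => (lam, v))).aestronglyMeasurable
    · exact Eventually.of_forall fun v => abs_waitCost_le _ _ _
    · exact Eventually.of_forall fun v => hj.comp (by fun_prop : Continuous fun l : ℝ => (l, v))
  induction j with
  | zero =>
    have h : Continuous (fun p : ℝ × ℝ => waitCost 0 p.1 p.2) := by
      simp only [waitCost]
      fun_prop
    exact ⟨h, key 0 h⟩
  | succ j ih =>
    obtain ⟨hw, hl⟩ := ih
    have ht : Continuous (fun lam => threshold lam (j + 1)) := by
      simp only [threshold]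
      refine (Continuous.log (hl.max continuous_const) fun lam => ?_).neg
      exact ((Real.exp_pos _).trans_le (le_max_right _ _)).ne'
    have h : Continuous (fun p : ℝ × ℝ => waitCost (j + 1) p.1 p.2) := by
      simp only [waitCost_succ]
      have hc : Continuous fun q : (ℝ × ℝ) × ℝ => waitCost j q.1.1 (q.1.2 + q.2) -
          max (threshold q.1.1 (j + 1) - max (q.1.2 + q.2) 0) 0 := by
        refine (hw.comp (by fun_prop :
          Continuous fun q : (ℝ × ℝ) × ℝ => (q.1.1, q.1.2 + q.2))).sub ?_
        have := ht.comp (by fun_prop : Continuous fun q : (ℝ × ℝ) × ℝ => q.1.1)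
        simp only [Function.comp_def] at this
        fun_prop
      refine continuous_of_dominated (bound := fun _ => 4 * j + 1 + 4) (fun p => ?_) (fun p => ?_)
        (integrable_const _) ?_
      · exact (hc.comp (by fun_prop : Continuous fun u : ℝ => (p, u))).aestronglyMeasurable
      · exact Eventually.of_forall fun u =>
          (norm_sub_le _ _).trans (add_le_add (abs_waitCost_le _ _ _) (posPart_threshold_mem _ _ _))
      · exact Eventually.of_forall fun u =>
          hc.comp (by fun_prop : Continuous fun p : ℝ × ℝ => (p, u))
    exact ⟨h, key _ h⟩

lemma continuous_waitCost (j : ℕ) (lam : ℝ) : Continuous (waitCost j lam) :=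
  (continuous_waitCost_level j).1.comp (by fun_prop : Continuous fun a : ℝ => (lam, a))

lemma continuous_level (j : ℕ) : Continuous (fun lam => level lam j) :=
  (continuous_waitCost_level j).2

lemma integrable_waitCost (j : ℕ) (lam a : ℝ) :
    Integrable (fun u => waitCost j lam (a + u)) (expMeasure 1) := by
  refine Integrable.of_bound ((continuous_waitCost j lam).comp
    (by fun_prop : Continuous fun u : ℝ => a + u)).aestronglyMeasurable (4 * j + 1) ?_
  exact Eventually.of_forall fun u => abs_waitCost_le _ _ _

lemma integrable_posPart_sub (c a : ℝ) :
    Integrable (fun u : ℝ => max (c - (a + u)) 0) (expMeasure 1) :=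
  integrable_expMeasure_one_of_quadratic (by fun_prop) (|c| + |a|) 1 0 fun u hu => by
    rw [abs_of_nonneg (le_max_right _ _)]
    refine max_le ?_ (by positivity)
    have := le_abs_self c
    have := neg_abs_le a
    linarith

lemma integrable_posPart_sub' (c a : ℝ) :
    Integrable (fun u : ℝ => max (a + u - c) 0) (expMeasure 1) :=
  integrable_expMeasure_one_of_quadratic (by fun_prop) (|c| + |a|) 1 0 fun u hu => by
    rw [abs_of_nonneg (le_max_right _ _)]
    refine max_le ?_ (by positivity)
    have := le_abs_self a
    have := neg_abs_le c
    linarith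

lemma waitCost_succ_of_nonneg (j : ℕ) (lam : ℝ) {a : ℝ} (ha : 0 ≤ a) :
    waitCost (j + 1) lam a = ∫ u, waitCost j lam (a + u) ∂expMeasure 1 -
      ∫ u, max (threshold lam (j + 1) - (a + u)) 0 ∂expMeasure 1 := by
  rw [waitCost_succ, ← integral_sub (integrable_waitCost j lam a) (integrable_posPart_sub _ _)]
  refine integral_congr_ae ?_
  filter_upwards [ae_pos_expMeasure_one] with u hu
  rw [max_eq_left (a := a + u) (by linarith)]

lemma waitCost_zero_of_nonneg {lam a : ℝ} (hlam : lam ≤ 1) (ha : 0 ≤ a) :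
    waitCost 0 lam a = -(max (lam - a) 0) ^ 2 / 2 := by
  simp [waitCost, min_eq_left hlam, max_eq_left ha]

lemma hasDerivAt_posPart_sq (x : ℝ) :
    HasDerivAt (fun x : ℝ => (max x 0) ^ 2 / 2) (max x 0) x := by
  rcases lt_trichotomy x 0 with h | h | h
  · rw [max_eq_right h.le]
    refine (hasDerivAt_const x (0 : ℝ)).congr_of_eventuallyEq ?_
    filter_upwards [gt_mem_nhds h] with y hy
    simp [max_eq_right (le_of_lt hy)]
  · subst h
    rw [hasDerivAt_iff_isLittleO_nhds_zero]
    have h2 : (fun h : ℝ => h ^ 2) =o[nhds 0] fun h => h := by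
      simpa using Asymptotics.isLittleO_pow_id (𝕜 := ℝ) one_lt_two
    refine Asymptotics.IsBigO.trans_isLittleO ?_ h2
    refine Asymptotics.IsBigO.of_bound 1 (Eventually.of_forall fun h => ?_)
    have h1 : (max h 0) ^ 2 ≤ h ^ 2 := by
      rcases le_total h 0 with h' | h'
      · simp [h', sq_nonneg]
      · simp [h']
    have h3 : 0 ≤ (max h 0) ^ 2 := sq_nonneg _
    simp only [zero_add, max_self, Real.norm_eq_abs, one_mul, smul_zero, sub_zero]
    rw [abs_of_nonneg (sq_nonneg h)]
    simp only [ne_eq, OfNat.ofNat_ne_zero, not_false_eq_true, zero_pow, zero_div, sub_zero]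
    rw [abs_of_nonneg (by positivity)]
    linarith
  · rw [max_eq_left h.le]
    have h2 : HasDerivAt (fun x : ℝ => x ^ 2 / 2) x x := by
      have := (hasDerivAt_pow 2 x).div_const 2
      simpa using this
    refine h2.congr_of_eventuallyEq ?_
    filter_upwards [lt_mem_nhds h] with y hy
    simp [max_eq_left (le_of_lt hy)]

/-- With a full battery further arrivals are lost, so the optimal cost of the wait solves the same
recursion with itself in the place of the cost for one unit more. -/
lemma waitCost_zero_eq {lam a : ℝ} (hlam : lam ≤ 1) (ha : 0 ≤ a) :
    waitCost 0 lam a = ∫ u, waitCost 0 lam (a + u) ∂expMeasure 1 -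
      ∫ u, max (lam - (a + u)) 0 ∂expMeasure 1 := by
  rw [← integral_sub (integrable_waitCost 0 lam a) (integrable_posPart_sub _ _)]
  have hI := (integrable_waitCost 0 lam a).sub (integrable_posPart_sub lam a)
  rw [integrable_expMeasure_one_iff] at hI
  rw [integral_expMeasure_one]
  have hF : ∀ u ∈ Set.Ioi (0 : ℝ), HasDerivAt
      (fun u => Real.exp (-u) * ((max (lam - (a + u)) 0) ^ 2 / 2))
      (Real.exp (-u) * (waitCost 0 lam (a + u) - max (lam - (a + u)) 0)) u := by
    intro u hu
    rw [waitCost_zero_of_nonneg hlam (by linarith [Set.mem_Ioi.1 hu])]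
    have h1 : HasDerivAt (fun u : ℝ => lam - (a + u)) (-1) u := by
      simpa using ((hasDerivAt_id u).const_add a).const_sub lam
    have h2 := (hasDerivAt_posPart_sq (lam - (a + u))).comp u h1
    have h3 : HasDerivAt (fun u : ℝ => Real.exp (-u)) (-Real.exp (-u)) u := by
      simpa using (hasDerivAt_neg u).exp
    convert! h3.mul h2 using 1
    simp only [Function.comp]
    ring
  have hlim : Tendsto (fun u => Real.exp (-u) * ((max (lam - (a + u)) 0) ^ 2 / 2)) atTop
      (nhds 0) := by
    refine tendsto_const_nhds.congr' ?_
    filter_upwards [eventually_ge_atTop (lam - a)] with u hu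
    rw [max_eq_right (by linarith)]
    simp
  have hcont : ContinuousWithinAt (fun u => Real.exp (-u) * ((max (lam - (a + u)) 0) ^ 2 / 2))
      (Set.Ici 0) 0 := by
    apply Continuous.continuousWithinAt
    fun_prop
  have := integral_Ioi_of_hasDerivAt_of_tendsto hcont hF hI hlim
  rw [this, waitCost_zero_of_nonneg hlam ha]
  simp
  ring

lemma integral_mono_of_nonneg_arg {f g : ℝ → ℝ} (hf : Integrable f (expMeasure 1))
    (hg : Integrable g (expMeasure 1)) (h : ∀ u, 0 ≤ u → f u ≤ g u) :
    ∫ u, f u ∂expMeasure 1 ≤ ∫ u, g u ∂expMeasure 1 := by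
  refine integral_mono_ae hf hg ?_
  filter_upwards [ae_pos_expMeasure_one] with u hu using h u hu.le

/-- With less energy the threshold is higher, and the wait is worth more. -/
lemma threshold_waitCost_mono {lam : ℝ} (h1 : lam ≤ 1) (j : ℕ) :
    threshold lam j ≤ threshold lam (j + 1) ∧
      ∀ a, 0 ≤ a → waitCost (j + 1) lam a ≤ waitCost j lam a := by
  induction j with
  | zero =>
    have ht : threshold lam 0 ≤ threshold lam 1 := by
      have hl : level lam 0 ≤ Real.exp (-lam) := by
        have := Real.add_one_le_exp (-lam)
        have h2 : ∫ v, waitCost 0 lam v ∂expMeasure 1 ≤ 0 :=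
          integral_nonpos fun v => waitCost_nonpos 0 lam v
        simp only [level]
        linarith
      have hm : max (level lam 0) (Real.exp (-4)) ≤ Real.exp (-lam) :=
        max_le hl (Real.exp_le_exp.2 (by linarith))
      have := Real.log_le_log ((Real.exp_pos _).trans_le (le_max_right _ _)) hm
      rw [Real.log_exp] at this
      simp only [threshold]
      linarith
    refine ⟨ht, fun a ha => ?_⟩
    rw [waitCost_succ_of_nonneg 0 lam ha, waitCost_zero_eq h1 ha]
    refine sub_le_sub_left (integral_mono (integrable_posPart_sub _ _)
      (integrable_posPart_sub _ _) fun u => ?_) _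
    exact max_le_max_right _ (sub_le_sub_right ht _)
  | succ j ih =>
    have hint : ∀ a, 0 ≤ a → ∫ u, waitCost (j + 1) lam (a + u) ∂expMeasure 1 ≤
        ∫ u, waitCost j lam (a + u) ∂expMeasure 1 := fun a ha =>
      integral_mono_of_nonneg_arg (integrable_waitCost _ _ _) (integrable_waitCost _ _ _)
        fun u hu => ih.2 _ (by linarith)
    have ht : threshold lam (j + 1) ≤ threshold lam (j + 2) := by
      have hl : level lam (j + 1) ≤ level lam j := by
        simpa [level] using hint 0 le_rfl
      simp only [threshold]
      exact neg_le_neg (Real.log_le_log ((Real.exp_pos _).trans_le (le_max_right _ _))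
        (max_le_max_right _ hl))
    refine ⟨ht, fun a ha => ?_⟩
    rw [waitCost_succ_of_nonneg (j + 1) lam ha, waitCost_succ_of_nonneg j lam ha]
    refine sub_le_sub (hint a ha) (integral_mono (integrable_posPart_sub _ _)
      (integrable_posPart_sub _ _) fun u => ?_)
    exact max_le_max_right _ (sub_le_sub_right ht _)

lemma threshold_monotone {lam : ℝ} (h1 : lam ≤ 1) : Monotone (threshold lam) :=
  monotone_nat_of_le_succ fun j => (threshold_waitCost_mono h1 j).1

/-- Above the threshold, an immediate update is optimal. -/
lemma waitCost_eq_zero {lam : ℝ} (h1 : lam ≤ 1) (j : ℕ) {a : ℝ} (ha : 0 ≤ a)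
    (hja : threshold lam j ≤ a) : waitCost j lam a = 0 := by
  induction j generalizing a with
  | zero =>
    rw [waitCost_zero_of_nonneg h1 ha, max_eq_right (by simpa [threshold] using hja)]
    simp
  | succ j ih =>
    rw [waitCost_succ_of_nonneg j lam ha]
    have e1 : ∫ u, waitCost j lam (a + u) ∂expMeasure 1 = 0 := by
      refine integral_eq_zero_of_ae ?_
      filter_upwards [ae_pos_expMeasure_one] with u hu
      exact ih (by linarith) (by linarith [threshold_monotone h1 (Nat.le_succ j)])
    have e2 : ∫ u, max (threshold lam (j + 1) - (a + u)) 0 ∂expMeasure 1 = 0 := by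
      refine integral_eq_zero_of_ae ?_
      filter_upwards [ae_pos_expMeasure_one] with u hu
      exact max_eq_right (by linarith)
    rw [e1, e2, sub_zero]

lemma threshold_zero_level_zero (j : ℕ) : threshold 0 j = 0 ∧ level 0 j = 1 := by
  have key : ∀ j, threshold 0 j = 0 → level 0 j = 1 := by
    intro j hj
    have : ∫ v, waitCost j 0 v ∂expMeasure 1 = 0 := by
      refine integral_eq_zero_of_ae ?_
      filter_upwards [ae_pos_expMeasure_one] with u hu
      exact waitCost_eq_zero zero_le_one j hu.le (by rw [hj]; exact hu.le)
    simp [level, this]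
  induction j with
  | zero => exact ⟨rfl, key 0 rfl⟩
  | succ j ih =>
    have h : threshold 0 (j + 1) = 0 := by
      simp [threshold, ih.2]
    exact ⟨h, key _ h⟩

/-- The optimal average age of a battery of size `j + 1` is a zero of `level · j`. -/
lemma exists_level_eq_zero (j : ℕ) : ∃ lam, 0 < lam ∧ lam ≤ 1 ∧ level lam j = 0 := by
  have hle : level 1 j ≤ 0 := by
    have h2 : ∫ v, waitCost j 1 v ∂expMeasure 1 ≤ 0 :=
      integral_nonpos fun v => waitCost_nonpos j 1 v
    simpa [level] using h2
  have hz := (threshold_zero_level_zero j).2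
  obtain ⟨lam, hlam, he⟩ := intermediate_value_Icc' zero_le_one
    (continuous_level j).continuousOn (show (0 : ℝ) ∈ Set.Icc (level 1 j) (level 0 j) by
      rw [hz]; exact ⟨hle, zero_le_one⟩)
  refine ⟨lam, lt_of_le_of_ne hlam.1 ?_, hlam.2, he⟩
  rintro rfl
  exact one_ne_zero (hz.symm.trans he)

lemma integral_posPart_sub' {c a : ℝ} :
    ∫ u, max (a + u - c) 0 ∂expMeasure 1 =
      a + 1 - c + ∫ u, max (c - (a + u)) 0 ∂expMeasure 1 := by
  have h : ∀ u : ℝ, max (a + u - c) 0 = (a - c) + u + max (c - (a + u)) 0 := by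
    intro u
    rcases le_total (a + u) c with h | h
    · rw [max_eq_right (by linarith), max_eq_left (by linarith)]; ring
    · rw [max_eq_left (by linarith), max_eq_right (by linarith)]; ring
  simp_rw [h]
  rw [integral_add (by exact (integrable_const _).add integrable_id_expMeasure_one)
    (integrable_posPart_sub _ _), integral_add (integrable_const _) integrable_id_expMeasure_one,
    integral_id_expMeasure_one]
  simp
  ring

lemma integral_posPart_const_sub {c : ℝ} (hc : 0 ≤ c) :
    ∫ u, max (c - u) 0 ∂expMeasure 1 = c - 1 + Real.exp (-c) := by
  have h := integral_posPart_sub' (c := c) (a := 0)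
  have h2 := integral_expMeasure_one_split hc (fun u => max (0 + u - c) 0) (by fun_prop)
    (integrable_posPart_sub' c 0)
  have e1 : ∫ u in Set.Iic c, max (0 + u - c) 0 ∂expMeasure 1 = 0 := by
    refine setIntegral_eq_zero_of_forall_eq_zero fun u hu => ?_
    exact max_eq_right (by linarith [Set.mem_Iic.1 hu])
  have e2 : ∫ u, max (0 + (c + u) - c) 0 ∂expMeasure 1 = 1 := by
    refine Eq.trans (integral_congr_ae ?_) integral_id_expMeasure_one
    filter_upwards [ae_pos_expMeasure_one] with u hu
    rw [max_eq_left (by linarith)]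
    ring
  rw [e1, e2] at h2
  simp only [zero_add] at h h2
  linarith

/-- A level below the floor `exp (-4)` makes all later levels negative. -/
lemma level_neg_of_lt {lam : ℝ} (h0 : 0 ≤ lam) {i j : ℕ} (hij : i < j)
    (hi : level lam i < Real.exp (-4)) : level lam j < 0 := by
  have step : ∀ i, level lam i < Real.exp (-4) → level lam (i + 1) < 0 := by
    intro i hi
    have ht : threshold lam (i + 1) = 4 := by
      simp [threshold, max_eq_right hi.le]
    have hw : ∀ u, 0 ≤ u → waitCost (i + 1) lam u ≤ u - 3 := by
      intro u hu
      rw [waitCost_succ_of_nonneg i lam hu, ht]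
      have e1 : ∫ v, waitCost i lam (u + v) ∂expMeasure 1 ≤ 0 :=
        integral_nonpos fun v => waitCost_nonpos _ _ _
      have e2 : 3 - u ≤ ∫ v, max (4 - (u + v)) 0 ∂expMeasure 1 := by
        have e3 : ∫ v, ((4 - u) - v) ∂expMeasure 1 = 3 - u := by
          rw [integral_sub (integrable_const _) integrable_id_expMeasure_one,
            integral_id_expMeasure_one]
          simp
          ring
        rw [← e3]
        refine integral_mono ((integrable_const _).sub integrable_id_expMeasure_one)
          (integrable_posPart_sub _ _) fun v => ?_
        exact le_trans (by simp only; linarith) (le_max_left _ _)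
      linarith
    have : ∫ v, waitCost (i + 1) lam v ∂expMeasure 1 ≤ -2 := by
      have e3 : ∫ v, (v - 3) ∂expMeasure 1 = -2 := by
        rw [integral_sub integrable_id_expMeasure_one (integrable_const _),
          integral_id_expMeasure_one]
        simp
        norm_num
      rw [← e3]
      refine integral_mono_of_nonneg_arg (by simpa using integrable_waitCost (i + 1) lam 0)
        (integrable_id_expMeasure_one.sub (integrable_const _)) hw
    simp only [level]
    linarith
  induction j, hij using Nat.le_induction with
  | base => exact step i hi
  | succ j _ ih => exact step j (ih.trans (Real.exp_pos _))

/-- Just after an update, the cost of the wait is determined by the fixed-point equation for the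
threshold; this is what makes `energyValue` consistent with `waitCost`. -/
lemma waitCost_at_zero {lam : ℝ} (h0 : 0 ≤ lam) (h1 : lam ≤ 1) {j : ℕ}
    (hj : Real.exp (-4) ≤ level lam j) :
    waitCost (j + 1) lam 0 = lam - threshold lam (j + 1) := by
  have ht : 0 ≤ threshold lam (j + 1) := by
    have := threshold_monotone h1 (Nat.zero_le (j + 1))
    simp only [threshold] at this ⊢
    linarith
  have he : Real.exp (-threshold lam (j + 1)) = level lam j := by
    simp only [threshold, neg_neg]
    rw [max_eq_left hj, Real.exp_log ((Real.exp_pos _).trans_le hj)]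
  rw [waitCost_succ_of_nonneg j lam le_rfl]
  simp only [zero_add]
  rw [integral_posPart_const_sub ht, he]
  simp only [level]
  ring

/-- The optimality equation of the update problem, in integrated form: `H k a` is the expected
total cost of the current epoch and of the future, relative to the running cost `lam`, at age `a`
with `k` units in the battery, the cost `a ^ 2 / 2 - lam * a` so far included; `θ k` is the age
from which on `k` units suffice for an update. According to `mean`, the cost of a wait for the next
arrival exceeds `H` by the mean time for which the age is above the threshold meanwhile; `update_le`
and `update_eq` compare `H` with an immediate update. -/
structure IsRelativeValue (B : ℕ) (lam : ℝ) (θ : ℕ → ℝ) (H : ℕ → ℝ → ℝ) : Prop where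
  lam_pos : 0 < lam
  lam_le : ∀ k, 1 ≤ k → k ≤ B → lam ≤ θ k
  anti : ∀ k l, 1 ≤ k → k ≤ l → l ≤ B → θ l ≤ θ k
  measurable : ∀ k, Measurable (H k)
  lower : ∃ C, ∀ k ≤ B, ∀ a, 0 ≤ a → a ^ 2 / 2 - lam * a - C ≤ H k a
  upper : ∃ C, ∀ k ≤ B, ∀ a, 0 ≤ a → H k a ≤ a ^ 2 / 2 - lam * a + C + a
  mean : ∀ k ≤ B, ∀ a, 0 ≤ a → ∫ u, H (min (k + 1) B) (a + u) ∂expMeasure 1 =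
    H k a + ∫ u, (if k = 0 then 0 else max (a + u - θ k) 0) ∂expMeasure 1
  update_le : ∀ k, k + 1 ≤ B → ∀ a, 0 ≤ a → H (k + 1) a ≤ H k 0 + (a ^ 2 / 2 - lam * a)
  update_eq : ∀ k, k + 1 ≤ B → ∀ a, 0 ≤ a → θ (k + 1) ≤ a →
    H (k + 1) a = H k 0 + (a ^ 2 / 2 - lam * a)

lemma integral_age_cost (lam a : ℝ) :
    ∫ u, ((a + u) ^ 2 / 2 - lam * (a + u)) ∂expMeasure 1 =
      a ^ 2 / 2 - lam * a + (a + 1 - lam) := by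
  have h : ∀ u : ℝ, (a + u) ^ 2 / 2 - lam * (a + u) =
      (a ^ 2 / 2 - lam * a) + (a - lam) * u + u ^ 2 / 2 := fun u => by ring
  simp_rw [h]
  have h1 := integrable_id_expMeasure_one.const_mul (a - lam)
  have h2 := (integrable_const (μ := expMeasure 1) (a ^ 2 / 2 - lam * a)).add h1
  have h3 := integrable_sq_expMeasure_one.div_const 2
  rw [integral_add (by exact h2) h3, integral_add (integrable_const _) h1,
    integral_const_mul, integral_div, integral_id_expMeasure_one, integral_sq_expMeasure_one]
  simp
  ring

lemma integrable_age_cost (lam a : ℝ) :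
    Integrable (fun u : ℝ => (a + u) ^ 2 / 2 - lam * (a + u)) (expMeasure 1) := by
  have h : ∀ u : ℝ, (a + u) ^ 2 / 2 - lam * (a + u) =
      (a ^ 2 / 2 - lam * a) + (a - lam) * u + u ^ 2 / 2 := fun u => by ring
  simp_rw [h]
  exact ((integrable_const _).add (integrable_id_expMeasure_one.const_mul _)).add
    (integrable_sq_expMeasure_one.div_const _)

/-- The value of `k` units of energy at an update. -/
noncomputable def energyValue (B : ℕ) (lam : ℝ) (k : ℕ) : ℝ :=
  -∑ j ∈ Finset.range k, (threshold lam (B - (j + 1)) - lam)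

/-- The solution of the optimality equation. -/
noncomputable def relativeValue (B : ℕ) (lam : ℝ) : ℕ → ℝ → ℝ
  | 0, a => ∫ u, (waitCost (B - 1) lam (a + u) + ((a + u) ^ 2 / 2 - lam * (a + u))) ∂expMeasure 1
  | k + 1, a => waitCost (B - (k + 1)) lam a + energyValue B lam k + (a ^ 2 / 2 - lam * a)

lemma relativeValue_zero (B : ℕ) (lam a : ℝ) : relativeValue B lam 0 a =
    ∫ u, waitCost (B - 1) lam (a + u) ∂expMeasure 1 + (a ^ 2 / 2 - lam * a + (a + 1 - lam)) := by
  rw [relativeValue, integral_add (integrable_waitCost _ _ _) (integrable_age_cost _ _),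
    integral_age_cost]

lemma integral_relativeValue_succ (B : ℕ) (lam : ℝ) (k : ℕ) (a : ℝ) :
    ∫ u, relativeValue B lam (k + 1) (a + u) ∂expMeasure 1 =
      ∫ u, waitCost (B - (k + 1)) lam (a + u) ∂expMeasure 1 + energyValue B lam k +
        (a ^ 2 / 2 - lam * a + (a + 1 - lam)) := by
  simp only [relativeValue]
  rw [integral_add (by exact (integrable_waitCost _ _ _).add (integrable_const _))
    (integrable_age_cost _ _), integral_age_cost,
    integral_add (integrable_waitCost _ _ _) (integrable_const _)]
  simp

/-- The optimality equation has a solution. -/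
theorem exists_isRelativeValue {B : ℕ} (hB : 1 ≤ B) :
    ∃ lam θ H, IsRelativeValue B lam θ H := by
  obtain ⟨lam, hpos, hle, hz⟩ := exists_level_eq_zero (B - 1)
  have hlev : ∀ j, j + 1 < B → Real.exp (-4) ≤ level lam j := by
    intro j hj
    by_contra! h
    have := level_neg_of_lt hpos.le (show j < B - 1 by omega) h
    linarith
  have hmono := threshold_monotone hle
  have hval0 : ∀ k, k + 1 ≤ B → relativeValue B lam k 0 = energyValue B lam k := by
    intro k hk
    cases k with
    | zero =>
      rw [relativeValue_zero]
      simp only [level] at hz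
      simp [energyValue]
      linarith
    | succ k =>
      have hB' : B - (k + 1) = (B - (k + 2)) + 1 := by omega
      have := waitCost_at_zero hpos.le hle (hlev (B - (k + 2)) (by omega))
      simp only [relativeValue, energyValue, Finset.sum_range_succ]
      rw [hB', this]
      ring
  have hev : ∀ k, k ≤ B → |energyValue B lam k| ≤ 4 * B := by
    intro k hk
    rw [energyValue, abs_neg]
    refine (Finset.abs_sum_le_sum_abs _ _).trans ((Finset.sum_le_card_nsmul _ _ 4 ?_).trans ?_)
    · intro j _
      have h1 : lam ≤ threshold lam (B - (j + 1)) := hmono (Nat.zero_le _)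
      have h2 : threshold lam (B - (j + 1)) ≤ 4 := by
        cases B - (j + 1) with
        | zero => simp only [threshold]; linarith
        | succ i => exact threshold_succ_le lam i
      rw [abs_of_nonneg (by linarith)]
      linarith
    · have : (k : ℝ) ≤ B := by exact_mod_cast hk
      simp
      linarith
  have hwc : ∀ j, j ≤ B → ∀ a, |waitCost j lam a| ≤ 4 * B + 1 := by
    intro j hj a
    have : (j : ℝ) ≤ B := by exact_mod_cast hj
    exact (abs_waitCost_le j lam a).trans (by linarith)
  have hwi : ∀ a, |∫ u, waitCost (B - 1) lam (a + u) ∂expMeasure 1| ≤ 4 * B + 1 := by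
    intro a
    rw [← Real.norm_eq_abs]
    refine (norm_integral_le_of_norm_le_const (C := 4 * B + 1)
      (Eventually.of_forall fun u => hwc _ (by omega) _)).trans ?_
    simp
  refine ⟨lam, fun k => threshold lam (B - k), relativeValue B lam, hpos, ?_, ?_, ?_, ?_, ?_, ?_,
    ?_, ?_⟩
  · intro k _ _
    exact hmono (Nat.zero_le (B - k))
  · intro k l _ hkl _
    exact hmono (by omega)
  · intro k
    cases k with
    | zero =>
      have hm : Measurable fun a => ∫ u, waitCost (B - 1) lam (a + u) ∂expMeasure 1 := by
        have : StronglyMeasurable (Function.uncurry fun a u : ℝ => waitCost (B - 1) lam (a + u)) :=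
          ((continuous_waitCost (B - 1) lam).comp
            (by fun_prop : Continuous fun p : ℝ × ℝ => p.1 + p.2)).stronglyMeasurable
        exact this.integral_prod_right.measurable
      simp_rw [funext fun a => relativeValue_zero B lam a]
      exact hm.add (by fun_prop)
    | succ k =>
      exact ((continuous_waitCost (B - (k + 1)) lam).measurable.add measurable_const).add
        (by fun_prop)
  · refine ⟨8 * B + 1 + lam, fun k hk a ha => ?_⟩
    cases k with
    | zero =>
      rw [relativeValue_zero]
      have := abs_le.1 (hwi a)
      have : (0 : ℝ) ≤ B := by positivity
      linarith
    | succ k =>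
      simp only [relativeValue]
      have h1 := abs_le.1 (hwc (B - (k + 1)) (by omega) a)
      have h2 := abs_le.1 (hev k (by omega))
      linarith
  · refine ⟨8 * B + 2, fun k hk a ha => ?_⟩
    cases k with
    | zero =>
      rw [relativeValue_zero]
      have := abs_le.1 (hwi a)
      have : (0 : ℝ) ≤ B := by positivity
      linarith
    | succ k =>
      simp only [relativeValue]
      have h1 := abs_le.1 (hwc (B - (k + 1)) (by omega) a)
      have h2 := abs_le.1 (hev k (by omega))
      linarith
  · intro k hk a ha
    cases k with
    | zero =>
      rw [show min (0 + 1) B = 0 + 1 by omega]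
      simp [relativeValue, energyValue]
    | succ k =>
      simp only [Nat.add_eq_zero_iff, one_ne_zero, and_false, if_false]
      rw [integral_posPart_sub']
      rcases Nat.lt_or_ge (k + 1) B with hlt | hge
      · rw [show min (k + 1 + 1) B = (k + 1) + 1 by omega, integral_relativeValue_succ]
        have hB' : B - (k + 1) = (B - (k + 1 + 1)) + 1 := by omega
        have hw := waitCost_succ_of_nonneg (B - (k + 1 + 1)) lam ha
        rw [← hB'] at hw
        simp only [relativeValue, energyValue, Finset.sum_range_succ]
        linarith
      · have hkB : B = k + 1 := by omega
        rw [show min (k + 1 + 1) B = k + 1 by omega, integral_relativeValue_succ]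
        have hw := waitCost_zero_eq hle ha
        have h0 : B - (k + 1) = 0 := by omega
        simp only [relativeValue]
        rw [h0]
        simp only [threshold]
        linarith
  · intro k hk a ha
    rw [hval0 k hk]
    simp only [relativeValue]
    have := waitCost_nonpos (B - (k + 1)) lam a
    linarith
  · intro k hk a ha hθ
    rw [hval0 k hk]
    simp only [relativeValue]
    rw [waitCost_eq_zero hle _ ha hθ]
    ring

/-! ### Arrival paths -/

/-- The time of the `n`-th arrival for the sequence `y` of inter-arrival times. -/
noncomputable def pathTime (y : ℕ → ℝ) (n : ℕ) : ℝ := ∑ i ∈ Finset.range (n + 1), y i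

/-- The number of arrivals up to time `c`; meaningful when there are finitely many. -/
noncomputable def pathCount (y : ℕ → ℝ) (c : ℝ) : ℕ := {n : ℕ | pathTime y n ≤ c}.ncard

/-- Arrivals are simple and do not accumulate. -/
structure IsRegularPath (y : ℕ → ℝ) : Prop where
  pos : ∀ n, 0 < y n
  tendsto : Tendsto (pathTime y) atTop atTop

lemma pathTime_succ (y : ℕ → ℝ) (n : ℕ) : pathTime y (n + 1) = pathTime y n + y (n + 1) :=
  Finset.sum_range_succ _ _

lemma pathTime_zero (y : ℕ → ℝ) : pathTime y 0 = y 0 := by simp [pathTime]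

lemma measurable_pathTime (n : ℕ) : Measurable fun y : ℕ → ℝ => pathTime y n := by
  unfold pathTime
  fun_prop

namespace IsRegularPath

variable {y : ℕ → ℝ}

lemma strictMono (hy : IsRegularPath y) : StrictMono (pathTime y) :=
  strictMono_nat_of_lt_succ fun n => by rw [pathTime_succ]; linarith [hy.pos (n + 1)]

lemma pathTime_pos (hy : IsRegularPath y) (n : ℕ) : 0 < pathTime y n :=
  Finset.sum_pos (fun i _ => hy.pos i) (by simp)

lemma lt_pathCount_iff (hy : IsRegularPath y) {n : ℕ} {c : ℝ} :
    n < pathCount y c ↔ pathTime y n ≤ c := by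
  classical
  have hex : ∃ N, c < pathTime y N := (hy.tendsto.eventually_gt_atTop c).exists
  have hset : {n : ℕ | pathTime y n ≤ c} = Set.Iio (Nat.find hex) := by
    ext m
    simp only [Set.mem_ofPred_eq, Set.mem_Iio, Nat.lt_find_iff]
    exact ⟨fun h k hk => not_lt.2 ((hy.strictMono.monotone hk).trans h),
      fun h => not_lt.1 (h m le_rfl)⟩
  have hN : pathCount y c = Nat.find hex := by
    rw [pathCount, hset, ← Finset.coe_Iio, Set.ncard_coe_finset]
    simp
  have h1 : n ∈ {n : ℕ | pathTime y n ≤ c} ↔ n ∈ Set.Iio (Nat.find hex) := by rw [hset]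
  rw [hN]
  exact h1.symm

lemma pathCount_le_iff (hy : IsRegularPath y) {n : ℕ} {c : ℝ} :
    pathCount y c ≤ n ↔ c < pathTime y n := by
  rw [← not_lt, hy.lt_pathCount_iff, not_le]

lemma pathCount_eq_iff (hy : IsRegularPath y) {n : ℕ} {c : ℝ} :
    pathCount y c = n ↔ (∀ m < n, pathTime y m ≤ c) ∧ c < pathTime y n := by
  rw [← hy.pathCount_le_iff, le_antisymm_iff, and_comm]
  refine and_congr_left fun _ => ?_
  constructor
  · intro h m hm
    exact hy.lt_pathCount_iff.1 (hm.trans_le h)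
  · intro h
    by_contra! hlt
    exact absurd (hy.lt_pathCount_iff.2 (h _ hlt)) (lt_irrefl _)

lemma pathCount_mono (hy : IsRegularPath y) : Monotone (pathCount y) := fun a b hab => by
  rw [hy.pathCount_le_iff]
  exact hab.trans_lt (hy.pathCount_le_iff.1 le_rfl)

lemma pathCount_zero (hy : IsRegularPath y) : pathCount y 0 = 0 :=
  Nat.le_zero.1 (hy.pathCount_le_iff.2 (hy.pathTime_pos 0))

lemma pathCount_pathTime (hy : IsRegularPath y) (n : ℕ) : pathCount y (pathTime y n) = n + 1 :=
  hy.pathCount_eq_iff.2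
    ⟨fun _ hm => hy.strictMono.monotone (Nat.lt_succ_iff.1 hm), hy.strictMono (Nat.lt_succ_self n)⟩

lemma ncard_between (hy : IsRegularPath y) (a b : ℝ) :
    {n : ℕ | a < pathTime y n ∧ pathTime y n ≤ b}.ncard = pathCount y b - pathCount y a := by
  have : {n : ℕ | a < pathTime y n ∧ pathTime y n ≤ b} =
      (Finset.Ico (pathCount y a) (pathCount y b) : Set ℕ) := by
    ext n
    simp [← hy.pathCount_le_iff, ← hy.lt_pathCount_iff]
  rw [this, Set.ncard_coe_finset, Nat.card_Ico]

end IsRegularPath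

variable {Ω : Type*}

lemma harvested_eq {τ : ℕ → Ω → ℝ} {ω : Ω} (hy : IsRegularPath fun n => τ n ω) {a b : ℝ≥0∞}
    (ha : a ≠ ∞) (hb : b ≠ ∞) :
    harvested τ a b ω =
      pathCount (fun n => τ n ω) b.toReal - pathCount (fun n => τ n ω) a.toReal := by
  rw [← hy.ncard_between, harvested]
  congr 1
  ext n
  have h0 : 0 < arrivalTime τ n ω := hy.pathTime_pos n
  change a < ENNReal.ofReal (arrivalTime τ n ω) ∧ ENNReal.ofReal (arrivalTime τ n ω) ≤ b ↔
    a.toReal < arrivalTime τ n ω ∧ arrivalTime τ n ω ≤ b.toReal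
  rw [ENNReal.lt_ofReal_iff_toReal_lt ha, ENNReal.ofReal_le_iff_le_toReal hb]

/-! ### The law of the arrivals -/

/-- The law of the sequence of inter-arrival times. -/
noncomputable abbrev arrivalLaw : Measure (ℕ → ℝ) := Measure.infinitePi fun _ => expMeasure 1

/-- The first `n` inter-arrival times. -/
def past (τ : ℕ → Ω → ℝ) (n : ℕ) (ω : Ω) : Fin n → ℝ := fun i => τ i ω

/-- The inter-arrival times from the `n`-th on. -/
def future (τ : ℕ → Ω → ℝ) (n : ℕ) (ω : Ω) : ℕ → ℝ := fun m => τ (n + m) ω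

namespace IsPoissonRecharge

variable [MeasurableSpace Ω] {P : Measure Ω} {τ : ℕ → Ω → ℝ}

lemma measurable_past (hτ : IsPoissonRecharge P τ) (n : ℕ) : Measurable (past τ n) :=
  measurable_pi_lambda _ fun i => hτ.measurable i

lemma measurable_future (hτ : IsPoissonRecharge P τ) (n : ℕ) : Measurable (future τ n) :=
  measurable_pi_lambda _ fun _ => hτ.measurable _

lemma map_future [IsProbabilityMeasure P] (hτ : IsPoissonRecharge P τ) (n : ℕ) :
    P.map (future τ n) = arrivalLaw := by
  have h := hτ.indep.precomp (g := fun m => n + m) (add_right_injective n)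
  have h2 := (iIndepFun_iff_map_fun_eq_infinitePi_map (fun m => hτ.measurable (n + m))).1 h
  simp_rw [hτ.law] at h2
  exact h2

lemma indepFun_past_future (hτ : IsPoissonRecharge P τ) (n : ℕ) :
    IndepFun (past τ n) (future τ n) P := by
  have h := indep_iSup_of_disjoint (fun k => (hτ.measurable k).comap_le) hτ.indep
    (S := {k | k < n}) (T := {k | n ≤ k})
    (Set.disjoint_left.2 fun k hk hk' => not_lt.2 (show n ≤ k from hk') hk)
  rw [IndepFun_iff_Indep]
  refine indep_of_indep_of_le_left (indep_of_indep_of_le_right h ?_) ?_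
  · rw [← measurable_iff_comap_le]
    refine @measurable_pi_lambda _ _ _ (_) _ _ fun m => ?_
    have : MeasurableSpace.comap (τ (n + m)) inferInstance ≤
        ⨆ i ∈ {k | n ≤ k}, MeasurableSpace.comap (τ i) inferInstance :=
      le_iSup₂ (f := fun i (_ : i ∈ {k | n ≤ k}) => MeasurableSpace.comap (τ i) inferInstance)
        (n + m) (Nat.le_add_right n m)
    exact (comap_measurable (τ (n + m))).mono this le_rfl
  · rw [← measurable_iff_comap_le]
    refine @measurable_pi_lambda _ _ _ (_) _ _ fun m => ?_
    have : MeasurableSpace.comap (τ m) inferInstance ≤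
        ⨆ i ∈ {k | k < n}, MeasurableSpace.comap (τ i) inferInstance :=
      le_iSup₂ (f := fun i (_ : i ∈ {k | k < n}) => MeasurableSpace.comap (τ i) inferInstance)
        (m : ℕ) m.2
    exact (comap_measurable (τ m)).mono this le_rfl

lemma map_past_future [IsProbabilityMeasure P] (hτ : IsPoissonRecharge P τ) (n : ℕ) :
    P.map (fun ω => (past τ n ω, future τ n ω)) = (P.map (past τ n)).prod arrivalLaw := by
  rw [(indepFun_iff_map_prod_eq_prod_map_map (hτ.measurable_past n).aemeasurable
    (hτ.measurable_future n).aemeasurable).1 (hτ.indepFun_past_future n), hτ.map_future]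

/-- By the strong law of large numbers, the arrivals do not accumulate. -/
lemma ae_regular (hτ : IsPoissonRecharge P τ) : ∀ᵐ ω ∂P, IsRegularPath fun n => τ n ω := by
  have hpos : ∀ n, ∀ᵐ ω ∂P, 0 < τ n ω := fun n => by
    refine ae_of_ae_map (f := τ n) (p := fun u => 0 < u) (hτ.measurable n).aemeasurable ?_
    rw [hτ.law]
    exact ae_pos_expMeasure_one
  have hid : ∀ n, IdentDistrib (τ n) (τ 0) P P := fun n =>
    ⟨(hτ.measurable n).aemeasurable, (hτ.measurable 0).aemeasurable, by rw [hτ.law, hτ.law]⟩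
  have hint : Integrable (τ 0) P := by
    have := integrable_id_expMeasure_one
    rw [← hτ.law 0, integrable_map_measure (by fun_prop) (hτ.measurable 0).aemeasurable] at this
    exact this
  have hmean : ∫ ω, τ 0 ω ∂P = 1 := by
    rw [← integral_id_expMeasure_one, ← hτ.law 0,
      integral_map (hτ.measurable 0).aemeasurable (by fun_prop)]
  have hlln := strong_law_ae τ hint (fun i j hij => hτ.indep.indepFun hij) hid
  filter_upwards [ae_all_iff.2 hpos, hlln] with ω h1 h2
  refine ⟨h1, ?_⟩
  rw [hmean] at h2
  have h3 : Tendsto (fun n : ℕ => (n : ℝ) * ((n : ℝ)⁻¹ • ∑ i ∈ Finset.range n, τ i ω))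
      atTop atTop := tendsto_natCast_atTop_atTop.atTop_mul_pos one_pos h2
  have h4 : Tendsto (fun n : ℕ => ∑ i ∈ Finset.range n, τ i ω) atTop atTop := by
    refine h3.congr' ?_
    filter_upwards [eventually_gt_atTop 0] with n hn
    have : (n : ℝ) ≠ 0 := by positivity
    rw [smul_eq_mul, mul_inv_cancel_left₀ this]
  exact h4.comp (tendsto_add_atTop_nat 1)

end IsPoissonRecharge

/-- Memorylessness of the arrivals: on the event that the first one occurs after the time `c`, the
arrivals from `c` on have the original law. -/
lemma map_update_restrict_arrivalLaw {c : ℝ} (hc : 0 ≤ c) :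
    (arrivalLaw.restrict {y | c < y 0}).map (fun y => Function.update y 0 (y 0 - c)) =
      ENNReal.ofReal (Real.exp (-c)) • arrivalLaw := by
  have hpos : ENNReal.ofReal (Real.exp (-c)) ≠ 0 := by simp [Real.exp_pos]
  have hfin : ENNReal.ofReal (Real.exp (-c)) ≠ ∞ := ENNReal.ofReal_ne_top
  have hm : Measurable fun y : ℕ → ℝ => Function.update y 0 (y 0 - c) := by
    refine measurable_pi_lambda _ fun i => ?_
    rcases eq_or_ne i 0 with rfl | hi
    · simp only [Function.update_self]; fun_prop
    · simp only [Function.update_of_ne hi]; fun_prop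
  have hmc : MeasurableSet {y : ℕ → ℝ | c < y 0} :=
    measurableSet_lt measurable_const (measurable_pi_apply 0)
  have key : (ENNReal.ofReal (Real.exp (-c)))⁻¹ •
      (arrivalLaw.restrict {y | c < y 0}).map (fun y => Function.update y 0 (y 0 - c)) =
        arrivalLaw := by
    refine Measure.eq_infinitePi _ fun s t ht => ?_
    classical
    set t' : ℕ → Set ℝ := fun i => if i = 0 then
      Set.Ioi c ∩ (fun u => u - c) ⁻¹' (if 0 ∈ s then t 0 else Set.univ) else t i with ht'
    have hset : (fun y : ℕ → ℝ => Function.update y 0 (y 0 - c)) ⁻¹' (Set.pi s t) ∩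
        {y | c < y 0} = Set.pi (insert 0 (s.erase 0) : Finset ℕ) t' := by
      ext y
      simp only [Set.mem_inter_iff, Set.mem_preimage, Set.mem_pi, Finset.mem_coe,
        Set.mem_ofPred_eq, Finset.mem_insert, Finset.mem_erase, ht']
      constructor
      · rintro ⟨h1, h2⟩ i hi
        by_cases h0 : i = 0
        · subst h0
          rw [if_pos rfl]
          refine ⟨h2, ?_⟩
          by_cases hs : 0 ∈ s
          · have := h1 0 hs
            simpa [hs] using this
          · simp [hs]
        · rw [if_neg h0]
          have := h1 i (by tauto)
          rwa [Function.update_of_ne h0] at this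
      · intro h
        have h0 := h 0 (Or.inl rfl)
        rw [if_pos rfl] at h0
        refine ⟨fun i hi => ?_, h0.1⟩
        by_cases hi0 : i = 0
        · subst hi0
          have := h0.2
          simpa [hi] using this
        · rw [Function.update_of_ne hi0]
          have := h i (Or.inr ⟨hi0, hi⟩)
          rwa [if_neg hi0] at this
    have hmt0 : MeasurableSet (if 0 ∈ s then t 0 else Set.univ) := by
      split_ifs
      · exact ht 0
      · exact MeasurableSet.univ
    have hmt : ∀ i ∈ insert 0 (s.erase 0), MeasurableSet (t' i) := by
      intro i _
      by_cases h0 : i = 0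
      · simp only [ht', h0, if_true]
        exact measurableSet_Ioi.inter ((by fun_prop : Measurable fun u : ℝ => u - c) hmt0)
      · simp only [ht', h0, if_false]
        exact ht i
    have hmp : MeasurableSet (Set.pi (s : Set ℕ) t) :=
      MeasurableSet.pi s.countable_toSet fun i _ => ht i
    rw [Measure.smul_apply, Measure.map_apply hm hmp, Measure.restrict_apply (hm hmp), hset,
      Measure.infinitePi_pi _ hmt, Finset.prod_insert (by simp), smul_eq_mul]
    have h0 : expMeasure 1 (t' 0) = ENNReal.ofReal (Real.exp (-c)) *
        expMeasure 1 (if 0 ∈ s then t 0 else Set.univ) := by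
      have h := congrArg (fun μ : Measure ℝ => μ (if 0 ∈ s then t 0 else Set.univ))
        (map_sub_restrict_Ioi_expMeasure_one hc)
      have hmsub : Measurable fun u : ℝ => u - c := by fun_prop
      simp only [Measure.map_apply hmsub hmt0, Measure.restrict_apply (hmsub hmt0),
        Measure.smul_apply, smul_eq_mul] at h
      simp only [ht', if_true]
      rw [Set.inter_comm]
      exact h
    have h1 : ∏ i ∈ s.erase 0, expMeasure 1 (t' i) = ∏ i ∈ s.erase 0, expMeasure 1 (t i) := by
      refine Finset.prod_congr rfl fun i hi => ?_
      simp [ht', Finset.ne_of_mem_erase hi]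
    rw [h0, h1, ← mul_assoc, ← mul_assoc, ENNReal.inv_mul_cancel hpos hfin, one_mul]
    by_cases hs : 0 ∈ s
    · rw [if_pos hs, Finset.mul_prod_erase s (fun i => expMeasure 1 (t i)) hs]
    · rw [if_neg hs, measure_univ, one_mul, Finset.erase_eq_of_notMem hs]
  rw [← key, smul_smul, ENNReal.mul_inv_cancel hpos hfin, one_smul, key]

/-! ### Stopping times between two arrivals -/

/-- A finite sequence of inter-arrival times, continued by zeros. -/
def extendPast {n : ℕ} (p : Fin n → ℝ) (k : ℕ) : ℝ := if h : k < n then p ⟨k, h⟩ else 0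

/-- The number of the first `n` arrivals that occur up to time `c`. -/
noncomputable def pastCount {n : ℕ} (p : Fin n → ℝ) (c : ℝ) : ℕ :=
  ((Finset.range n).filter fun m => pathTime (extendPast p) m ≤ c).card

lemma measurable_extendPast {n : ℕ} : Measurable (extendPast (n := n)) := by
  refine measurable_pi_lambda _ fun k => ?_
  unfold extendPast
  by_cases h : k < n
  · simp only [h, dif_pos]; fun_prop
  · simp only [h, dif_neg, not_false_eq_true]; fun_prop

lemma measurable_pastCount {n : ℕ} :
    Measurable fun q : (Fin n → ℝ) × ℝ => pastCount q.1 q.2 := by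
  simp only [pastCount, Finset.card_filter]
  refine Finset.measurable_sum _ fun m _ => ?_
  refine Measurable.ite (measurableSet_le ?_ measurable_snd) measurable_const measurable_const
  exact (measurable_pathTime m).comp (measurable_extendPast.comp measurable_fst)

lemma pathTime_extendPast (τ : ℕ → Ω → ℝ) {n m : ℕ} (h : m < n) (ω : Ω) :
    pathTime (extendPast (past τ n ω)) m = pathTime (fun i => τ i ω) m := by
  refine Finset.sum_congr rfl fun i hi => ?_
  have : i < n := by have := Finset.mem_range.1 hi; omega
  simp [extendPast, past, this]

lemma pastCount_past {τ : ℕ → Ω → ℝ} {ω : Ω} (hy : IsRegularPath fun n => τ n ω) {n : ℕ} {c : ℝ}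
    (hc : c < pathTime (fun n => τ n ω) n) :
    pastCount (past τ n ω) c = pathCount (fun n => τ n ω) c := by
  have hle := hy.pathCount_le_iff.2 hc
  have : ((Finset.range n).filter fun m => pathTime (extendPast (past τ n ω)) m ≤ c) =
      Finset.range (pathCount (fun n => τ n ω) c) := by
    ext m
    simp only [Finset.mem_filter, Finset.mem_range]
    constructor
    · rintro ⟨h1, h2⟩
      rw [pathTime_extendPast τ h1] at h2
      exact hy.lt_pathCount_iff.2 h2
    · intro h
      have h1 : m < n := h.trans_le hle
      refine ⟨h1, ?_⟩
      rw [pathTime_extendPast τ h1]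
      exact hy.lt_pathCount_iff.1 h
  rw [pastCount, this, Finset.card_range]

/-- Before the `n`-th arrival, the information on the arrivals is contained in the first `n`
inter-arrival times. -/
lemma exists_past_of_measurableSet [MeasurableSpace Ω] {τ : ℕ → Ω → ℝ}
    (hτ : ∀ n, Measurable (τ n)) (n : ℕ) {q : ℝ≥0} {A : Set Ω}
    (hA : MeasurableSet[arrivalFiltration τ hτ q] A) :
    ∃ A' : Set (Fin n → ℝ), MeasurableSet A' ∧ ∀ ω, IsRegularPath (fun n => τ n ω) →
      (q : ℝ) < pathTime (fun n => τ n ω) n → (ω ∈ A ↔ past τ n ω ∈ A') := by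
  refine MeasurableSpace.generateFrom_induction _
    (fun A _ => ∃ A' : Set (Fin n → ℝ), MeasurableSet A' ∧ ∀ ω, IsRegularPath (fun n => τ n ω) →
      (q : ℝ) < pathTime (fun n => τ n ω) n → (ω ∈ A ↔ past τ n ω ∈ A')) ?_ ?_ ?_ ?_ A hA
  · rintro A ⟨m, u, hu, rfl⟩ -
    by_cases hm : m < n
    · refine ⟨{p | pathTime (extendPast p) m ≤ u}, measurableSet_le
        ((measurable_pathTime m).comp measurable_extendPast) measurable_const, fun ω _ _ => ?_⟩
      simp only [Set.mem_ofPred_eq, pathTime_extendPast τ hm]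
      rfl
    · refine ⟨∅, MeasurableSet.empty, fun ω hy hq => ?_⟩
      simp only [Set.mem_ofPred_eq, Set.mem_empty_iff_false, iff_false, not_le]
      have h1 : pathTime (fun n => τ n ω) n ≤ pathTime (fun n => τ n ω) m :=
        hy.strictMono.monotone (not_lt.1 hm)
      have h2 : (u : ℝ) ≤ q := by exact_mod_cast hu
      exact (h2.trans_lt hq).trans_le h1
  · exact ⟨∅, MeasurableSet.empty, fun ω _ _ => by simp⟩
  · rintro A - ⟨A', hA', h⟩
    exact ⟨A'ᶜ, hA'.compl, fun ω hy hq => not_congr (h ω hy hq)⟩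
  · intro A _ h
    choose A' hA' h using h
    refine ⟨⋃ i, A' i, MeasurableSet.iUnion hA', fun ω hy hq => ?_⟩
    simp only [Set.mem_iUnion]
    exact exists_congr fun i => h i ω hy hq

/-- Before the `n`-th arrival, a stopping time is a function of the first `n` inter-arrival
times. -/
theorem exists_past_of_isStoppingTime [MeasurableSpace Ω] {τ : ℕ → Ω → ℝ}
    {hτ : ∀ n, Measurable (τ n)} {s : Ω → ℝ≥0∞} (hs : IsStoppingTime (arrivalFiltration τ hτ) s)
    (n : ℕ) :
    ∃ s' : (Fin n → ℝ) → ℝ≥0∞, Measurable s' ∧ ∀ ω, IsRegularPath (fun n => τ n ω) →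
      min (s ω) (ENNReal.ofReal (pathTime (fun n => τ n ω) n)) =
        min (s' (past τ n ω)) (ENNReal.ofReal (pathTime (fun n => τ n ω) n)) := by
  classical
  -- `s'` is reconstructed from the events `s ≤ q` for rational `q`
  choose A hA h using fun q : ℚ≥0 =>
    exists_past_of_measurableSet hτ n (hs.measurableSet_le (q : ℝ≥0))
  refine ⟨fun p => ⨅ q : ℚ≥0, if p ∈ A q then ((q : ℝ≥0) : ℝ≥0∞) else ∞,
    Measurable.iInf fun q => Measurable.ite (hA q) measurable_const measurable_const,
    fun ω hy => ?_⟩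
  have hlt : ∀ q : ℚ≥0, ((q : ℝ≥0) : ℝ≥0∞) < ENNReal.ofReal (pathTime (fun n => τ n ω) n) →
      (s ω ≤ ((q : ℝ≥0) : ℝ≥0∞) ↔ past τ n ω ∈ A q) := by
    intro q hq
    refine h q ω hy ?_
    rwa [ENNReal.lt_ofReal_iff_toReal_lt ENNReal.coe_ne_top, ENNReal.coe_toReal] at hq
  have hdense : ∀ a b : ℝ≥0∞, a < b → ∃ q : ℚ≥0, a < ((q : ℝ≥0) : ℝ≥0∞) ∧
      ((q : ℝ≥0) : ℝ≥0∞) < b := by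
    intro a b hab
    obtain ⟨q, hq0, h1, h2⟩ := ENNReal.lt_iff_exists_rat_btwn.1 hab
    lift q to ℚ≥0 using hq0
    have : Real.toNNReal ((q : ℚ) : ℝ) = (q : ℝ≥0) := by
      ext
      rw [Real.coe_toNNReal _ (by positivity)]
      norm_cast
    rw [this] at h1 h2
    exact ⟨q, h1, h2⟩
  refine eq_of_forall_lt_iff fun c => ?_
  simp only [lt_min_iff]
  refine and_congr_left fun hc => ?_
  constructor
  · intro hs
    obtain ⟨q, hq1, hq2⟩ := hdense c _ (lt_min hs hc)
    refine hq1.trans_le (le_iInf fun r => ?_)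
    split_ifs with hr
    · by_contra! hlt'
      have := (hlt r (hlt'.trans (hq2.trans_le (min_le_right _ _)))).2 hr
      exact absurd (hlt'.trans (hq2.trans_le (min_le_left _ _))) (not_lt.2 this)
    · exact le_top
  · intro hi
    by_contra! hsc
    obtain ⟨q, hq1, hq2⟩ := hdense c _ (lt_min hi hc)
    have hmem := (hlt q (hq2.trans_le (min_le_right _ _))).1 (hsc.trans hq1.le)
    have := hq2.trans_le ((min_le_left _ _).trans (iInf_le _ q))
    rw [if_pos hmem] at this
    exact lt_irrefl _ this

/-! ### Battery levels along a path -/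

/-- The energy after the `i`-th update, for arrivals `y` and updates `s`. -/
noncomputable def pathEnergy (B : ℕ) (y s : ℕ → ℝ) : ℕ → ℕ
  | 0 => 0
  | i + 1 => min (pathEnergy B y s i + (pathCount y (s (i + 1)) - pathCount y (s i))) B - 1

/-- The energy at a time `c` after the `i`-th update, if the `i + 1`-st update is not earlier. -/
noncomputable def pathLevel (B : ℕ) (y s : ℕ → ℝ) (i : ℕ) (c : ℝ) : ℕ :=
  min (pathEnergy B y s i + (pathCount y c - pathCount y (s i))) B

/-- A feasible sequence of updates along a regular path. -/
structure IsFeasiblePath (B : ℕ) (y s : ℕ → ℝ) : Prop where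
  regular : IsRegularPath y
  start : s 0 = 0
  mono : Monotone s
  feasible : ∀ i, 1 ≤ pathLevel B y s i (s (i + 1))

lemma pathEnergy_succ (B : ℕ) (y s : ℕ → ℝ) (i : ℕ) :
    pathEnergy B y s (i + 1) = pathLevel B y s i (s (i + 1)) - 1 := rfl

lemma pathEnergy_le (B : ℕ) (y s : ℕ → ℝ) (i : ℕ) : pathEnergy B y s i ≤ B - 1 := by
  cases i with
  | zero => exact Nat.zero_le _
  | succ i => exact Nat.sub_le_sub_right (min_le_right _ _) 1

lemma pathLevel_self (B : ℕ) (y s : ℕ → ℝ) (i : ℕ) :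
    pathLevel B y s i (s i) = pathEnergy B y s i := by
  have := pathEnergy_le B y s i
  simp only [pathLevel]
  omega

namespace IsFeasiblePath

variable {B : ℕ} {y s : ℕ → ℝ}

lemma nonneg (h : IsFeasiblePath B y s) (i : ℕ) : 0 ≤ s i := h.start ▸ h.mono (Nat.zero_le i)

lemma pathEnergy_add_le (h : IsFeasiblePath B y s) (i : ℕ) :
    pathEnergy B y s i + i ≤ pathCount y (s i) := by
  induction i with
  | zero => simp [pathEnergy]
  | succ i ih =>
    have h1 := h.feasible i
    have h2 := h.regular.pathCount_mono (h.mono (Nat.le_add_right i 1))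
    simp only [pathEnergy_succ, pathLevel] at h1 ⊢
    omega

/-- There are at most as many updates as arrivals. -/
lemma pathTime_le (h : IsFeasiblePath B y s) (i : ℕ) : pathTime y i ≤ s (i + 1) := by
  have := h.pathEnergy_add_le (i + 1)
  exact h.regular.lt_pathCount_iff.1 (by omega)

end IsFeasiblePath

lemma ae_isFeasiblePath [MeasurableSpace Ω] {P : Measure Ω} {B : ℕ} {τ : ℕ → Ω → ℝ}
    (hτ : IsPoissonRecharge P τ) {s : ℕ → Ω → ℝ≥0∞}
    (hs : IsOnlinePolicy P B τ hτ.measurable s) :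
    ∀ᵐ ω ∂P, (∀ i, s i ω ≠ ∞) ∧
      IsFeasiblePath B (fun n => τ n ω) (fun i => (s i ω).toReal) ∧
      ∀ i, energyAfter B τ s i ω =
        pathEnergy B (fun n => τ n ω) (fun i => (s i ω).toReal) i := by
  filter_upwards [hτ.ae_regular, hs.finite, hs.ordered, hs.energy_causality] with ω hy h1 h2 h3
  have hf : ∀ i, s i ω ≠ ∞ := fun i => (h1 i).ne
  have he : ∀ i, energyAfter B τ s i ω =
      pathEnergy B (fun n => τ n ω) (fun i => (s i ω).toReal) i := by
    intro i
    induction i with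
    | zero => rfl
    | succ i ih => simp only [energyAfter, pathEnergy, ih, harvested_eq hy (hf _) (hf _)]
  refine ⟨hf, ⟨hy, by simp [hs.start], monotone_nat_of_le_succ fun i =>
    ENNReal.toReal_mono (hf _) (h2 i), fun i => ?_⟩, he⟩
  have := h3 i
  simpa only [energyBefore, he, harvested_eq hy (hf _) (hf _), pathLevel] using this

/-- The energy after the `i`-th update, computed from the first `n` inter-arrival times. -/
noncomputable def pastEnergy (B : ℕ) {n : ℕ} (s : ℕ → (Fin n → ℝ) → ℝ) (p : Fin n → ℝ) : ℕ → ℕ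
  | 0 => 0
  | i + 1 => min (pastEnergy B s p i + (pastCount p (s (i + 1) p) - pastCount p (s i p))) B - 1

lemma measurable_pastEnergy (B : ℕ) {n : ℕ} {s : ℕ → (Fin n → ℝ) → ℝ} (hs : ∀ i, Measurable (s i))
    (i : ℕ) : Measurable fun p => pastEnergy B s p i := by
  induction i with
  | zero => exact measurable_const
  | succ i ih =>
    have hc : ∀ i, Measurable fun p => pastCount p (s i p) := fun i =>
      Measurable.comp (g := fun q : (Fin n → ℝ) × ℝ => pastCount q.1 q.2)
        (f := fun p => (p, s i p)) measurable_pastCount (measurable_id.prodMk (hs i))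
    have h3 : Measurable fun q : ℕ × ℕ × ℕ => min (q.1 + (q.2.1 - q.2.2)) B - 1 :=
      measurable_of_countable _
    have h4 := h3.comp (ih.prodMk ((hc (i + 1)).prodMk (hc i)))
    simp only [Function.comp_def] at h4
    simp only [pastEnergy]
    exact h4

lemma pastEnergy_past {B : ℕ} {τ : ℕ → Ω → ℝ} {ω : Ω} {s : ℕ → ℝ}
    (h : IsFeasiblePath B (fun n => τ n ω) s) {n : ℕ} {s' : ℕ → (Fin n → ℝ) → ℝ} {i : ℕ}
    (hi : s i < pathTime (fun n => τ n ω) n) (hs' : ∀ j ≤ i, s' j (past τ n ω) = s j) :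
    pastEnergy B s' (past τ n ω) i = pathEnergy B (fun n => τ n ω) s i := by
  induction i with
  | zero => rfl
  | succ i ih =>
    have hi' := (h.mono (Nat.le_add_right i 1)).trans_lt hi
    simp only [pastEnergy, pathEnergy]
    rw [ih hi' fun j hj => hs' j (by omega), hs' _ le_rfl, hs' _ (Nat.le_add_right i 1),
      pastCount_past h.regular hi, pastCount_past h.regular hi']

/-! ### The mean gain between two arrivals -/

namespace IsRelativeValue

variable {B : ℕ} {lam : ℝ} {θ : ℕ → ℝ} {H : ℕ → ℝ → ℝ}

lemma exists_abs_le (h : IsRelativeValue B lam θ H) (T : ℝ) :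
    ∃ C, 0 ≤ C ∧ ∀ k ≤ B, ∀ a, 0 ≤ a → a ≤ T → |H k a| ≤ C := by
  obtain ⟨C₁, h₁⟩ := h.lower
  obtain ⟨C₂, h₂⟩ := h.upper
  refine ⟨|T| ^ 2 + lam * |T| + |C₁| + |C₂| + |T|, ?_, fun k hk a ha haT => ?_⟩
  · have := h.lam_pos
    positivity
  · have hT : a ≤ |T| := haT.trans (le_abs_self T)
    have h3 := h₁ k hk a ha
    have h4 := h₂ k hk a ha
    have h5 : lam * a ≤ lam * |T| := mul_le_mul_of_nonneg_left hT h.lam_pos.le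
    have h6 : 0 ≤ lam * a := mul_nonneg h.lam_pos.le ha
    have h7 : a ^ 2 ≤ |T| ^ 2 := pow_le_pow_left₀ ha hT 2
    have := le_abs_self C₁
    have := le_abs_self C₂
    have := abs_nonneg C₁
    have := abs_nonneg C₂
    have := sq_nonneg a
    rw [_root_.abs_le]
    constructor <;> nlinarith

lemma integrable_add (h : IsRelativeValue B lam θ H) {k : ℕ} (hk : k ≤ B) {a : ℝ} (ha : 0 ≤ a) :
    Integrable (fun u => H k (a + u)) (expMeasure 1) := by
  obtain ⟨C₁, h₁⟩ := h.lower
  obtain ⟨C₂, h₂⟩ := h.upper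
  refine integrable_expMeasure_one_of_quadratic
    ((h.measurable k).comp (measurable_const.add measurable_id))
    (a ^ 2 + lam * a + |C₁| + |C₂| + a) (lam + 1) 1 fun u hu => ?_
  have h3 := h₁ k hk (a + u) (by linarith)
  have h4 := h₂ k hk (a + u) (by linarith)
  have h6 : 0 ≤ lam * a := mul_nonneg h.lam_pos.le ha
  have h7 : 0 ≤ lam * u := mul_nonneg h.lam_pos.le hu
  have := le_abs_self C₁
  have := le_abs_self C₂
  have := abs_nonneg C₁
  have := abs_nonneg C₂
  have := sq_nonneg (a - u)
  have := sq_nonneg (a + u)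
  rw [_root_.abs_le]
  constructor <;> nlinarith

/-- The optimality equation stopped at age `x + d`. -/
lemma stopped_mean (h : IsRelativeValue B lam θ H) {k : ℕ} (hk : k ≤ B) {x d : ℝ} (hx : 0 ≤ x)
    (hd : 0 ≤ d) :
    ∫ u, (if u ≤ d then H (min (k + 1) B) (x + u) else H k (x + d)) ∂expMeasure 1 - H k x =
      ∫ u in Set.Iic d, (if k = 0 then 0 else max (x + u - θ k) 0) ∂expMeasure 1 := by
  have hkB : min (k + 1) B ≤ B := min_le_right _ _
  have hm : Measurable fun u => H (min (k + 1) B) (x + u) :=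
    (h.measurable _).comp (measurable_const.add measurable_id)
  have hi := h.integrable_add hkB hx
  have hslm : Measurable fun u : ℝ => (if k = 0 then 0 else max (x + u - θ k) 0) := by
    split_ifs <;> fun_prop
  have hsli : Integrable (fun u : ℝ => (if k = 0 then 0 else max (x + u - θ k) 0))
      (expMeasure 1) := by
    split_ifs
    · exact integrable_zero _ _ _
    · exact integrable_posPart_sub' _ _
  have e1 := integral_expMeasure_one_split hd _ hm hi
  have e2 := integral_expMeasure_one_split hd _ hslm hsli
  have m1 := h.mean k hk x hx
  have m2 := h.mean k hk (x + d) (by linarith)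
  have e3 : ∫ u, (if u ≤ d then H (min (k + 1) B) (x + u) else H k (x + d)) ∂expMeasure 1 =
      ∫ u in Set.Iic d, H (min (k + 1) B) (x + u) ∂expMeasure 1 + Real.exp (-d) * H k (x + d) := by
    have hm' : Measurable fun u => if u ≤ d then H (min (k + 1) B) (x + u) else H k (x + d) :=
      Measurable.ite measurableSet_Iic hm measurable_const
    have hi' : Integrable (fun u => if u ≤ d then H (min (k + 1) B) (x + u) else H k (x + d))
        (expMeasure 1) := by
      refine (hi.abs.add (integrable_const |H k (x + d)|)).mono' hm'.aestronglyMeasurable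
        (Eventually.of_forall fun u => ?_)
      simp only [Pi.add_apply, Real.norm_eq_abs]
      split_ifs
      · linarith [abs_nonneg (H k (x + d))]
      · linarith [abs_nonneg (H (min (k + 1) B) (x + u))]
    rw [integral_expMeasure_one_split hd _ hm' hi']
    congr 1
    · exact setIntegral_congr_fun measurableSet_Iic fun u hu => if_pos hu
    · congr 1
      refine (integral_congr_ae (g := fun _ => H k (x + d)) ?_).trans (by simp)
      filter_upwards [ae_pos_expMeasure_one] with u hu
      rw [if_neg (by linarith)]
  rw [e3]
  simp only [← add_assoc] at e1 e2 m2 ⊢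
  rw [m1, m2] at e1
  have : Real.exp (-d) * (H k (x + d) +
      ∫ u, (if k = 0 then 0 else max (x + d + u - θ k) 0) ∂expMeasure 1) =
      Real.exp (-d) * H k (x + d) + Real.exp (-d) *
        ∫ u, (if k = 0 then 0 else max (x + d + u - θ k) 0) ∂expMeasure 1 := mul_add _ _ _
  linarith

end IsRelativeValue

/-- The gain of `H` between the arrival epochs `e` and `e + u`, for an update at time `a`, a
next update or horizon `b`, and an energy `k` before the second arrival. -/
noncomputable def stageGain (B : ℕ) (H : ℕ → ℝ → ℝ) (e a b : ℝ) (k : ℕ) (u : ℝ) : ℝ :=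
  if max a e < b ∧ max a e < e + u then
    (if e + u ≤ b then H (min (k + 1) B) (e + u - a) else H k (b - a)) - H k (max a e - a)
  else 0

lemma abs_stageGain_le {B : ℕ} {H : ℕ → ℝ → ℝ} {C T : ℝ} (hC : 0 ≤ C)
    (hH : ∀ k ≤ B, ∀ a, 0 ≤ a → a ≤ T → |H k a| ≤ C) {e a b : ℝ} (ha : 0 ≤ a) (hb : b ≤ T)
    {k : ℕ} (hk : k ≤ B) (u : ℝ) : |stageGain B H e a b k u| ≤ 2 * C := by
  unfold stageGain
  split_ifs with h1 h2
  · have := hH (min (k + 1) B) (min_le_right _ _) (e + u - a)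
      (by linarith [le_max_left a e]) (by linarith)
    have := hH k hk (max a e - a) (by linarith [le_max_left a e]) (by linarith)
    exact (abs_sub _ _).trans (by linarith)
  · have := hH k hk (b - a) (by linarith [le_max_left a e]) (by linarith)
    have := hH k hk (max a e - a) (by linarith [le_max_left a e]) (by linarith)
    exact (abs_sub _ _).trans (by linarith)
  · simp; linarith

lemma measurable_stageGain {X : Type*} [MeasurableSpace X] {B : ℕ} {H : ℕ → ℝ → ℝ}
    (hH : ∀ k, Measurable (H k)) {e a b u : X → ℝ} {k : X → ℕ} (he : Measurable e)
    (ha : Measurable a) (hb : Measurable b) (hu : Measurable u) (hk : Measurable k) :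
    Measurable fun x => stageGain B H (e x) (a x) (b x) (k x) (u x) := by
  have hH' : Measurable fun q : ℕ × ℝ => H q.1 q.2 := measurable_from_prod_countable_right hH
  have hk' : Measurable fun x => min (k x + 1) B :=
    (measurable_of_countable fun k : ℕ => min (k + 1) B).comp hk
  unfold stageGain
  refine Measurable.ite ?_ (Measurable.sub (Measurable.ite ?_ ?_ ?_) ?_) measurable_const
  · exact (measurableSet_lt (ha.max he) hb).inter (measurableSet_lt (ha.max he) (he.add hu))
  · exact measurableSet_le (he.add hu) hb
  · exact hH'.comp (hk'.prodMk ((he.add hu).sub ha))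
  · exact hH'.comp (hk.prodMk (hb.sub ha))
  · exact hH'.comp (hk.prodMk ((ha.max he).sub ha))

lemma IsRelativeValue.integral_stageGain {B : ℕ} {lam : ℝ} {θ : ℕ → ℝ} {H : ℕ → ℝ → ℝ}
    (h : IsRelativeValue B lam θ H) {e a b : ℝ} {k : ℕ} (hk : k ≤ B) (hab : max a e < b) :
    ∫ u, stageGain B H e a b k u ∂expMeasure 1 = Real.exp (-(max a e - e)) *
      ∫ u in Set.Iic (b - max a e),
        (if k = 0 then 0 else max (max a e - a + u - θ k) 0) ∂expMeasure 1 := by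
  set α := max a e with hα
  have hαe : 0 ≤ α - e := by linarith [le_max_right a e]
  have hαa : 0 ≤ α - a := by linarith [le_max_left a e]
  set f : ℝ → ℝ := fun u =>
    (if e + u ≤ b then H (min (k + 1) B) (e + u - a) else H k (b - a)) - H k (α - a) with hf
  have hfm : Measurable f := by
    refine Measurable.sub (Measurable.ite (measurableSet_le (by fun_prop) (by fun_prop)) ?_
      measurable_const) measurable_const
    exact (h.measurable _).comp (by fun_prop)
  have e1 : ∫ u, stageGain B H e a b k u ∂expMeasure 1 =
      ∫ u in Set.Ioi (α - e), f u ∂expMeasure 1 := by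
    rw [← integral_indicator measurableSet_Ioi]
    refine integral_congr_ae (Eventually.of_forall fun u => ?_)
    simp only [stageGain, Set.indicator, Set.mem_Ioi, hf, ← hα, hab, true_and, sub_lt_iff_lt_add']
  rw [e1, setIntegral_Ioi_expMeasure_one hαe f hfm, ← h.stopped_mean hk hαa (by linarith)]
  congr 1
  have e2 : ∀ u, f (α - e + u) = (if u ≤ b - α then H (min (k + 1) B) (α - a + u)
      else H k (α - a + (b - α))) - H k (α - a) := by
    intro u
    simp only [hf]
    rw [show e + (α - e + u) - a = α - a + u by ring, show α - a + (b - α) = b - a by ring]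
    have : e + (α - e + u) ≤ b ↔ u ≤ b - α := by constructor <;> intro <;> linarith
    simp only [this]
  simp_rw [e2]
  have hi : Integrable (fun u => if u ≤ b - α then H (min (k + 1) B) (α - a + u)
      else H k (α - a + (b - α))) (expMeasure 1) := by
    have hi := h.integrable_add (min_le_right (k + 1) B) hαa
    refine (hi.abs.add (integrable_const |H k (α - a + (b - α))|)).mono'
      (Measurable.ite measurableSet_Iic ?_ measurable_const).aestronglyMeasurable
      (Eventually.of_forall fun u => ?_)
    · exact (h.measurable _).comp (by fun_prop)
    · simp only [Pi.add_apply, Real.norm_eq_abs]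
      split_ifs
      · linarith [abs_nonneg (H k (α - a + (b - α)))]
      · linarith [abs_nonneg (H (min (k + 1) B) (α - a + u))]
  rw [integral_sub hi (integrable_const _)]
  simp

lemma integral_stageGain_of_not_lt {B : ℕ} {H : ℕ → ℝ → ℝ} {e a b : ℝ} {k : ℕ}
    (hab : ¬ max a e < b) : ∫ u, stageGain B H e a b k u ∂expMeasure 1 = 0 := by
  simp [stageGain, hab]

lemma IsRelativeValue.integral_stageGain_nonneg {B : ℕ} {lam : ℝ} {θ : ℕ → ℝ} {H : ℕ → ℝ → ℝ}
    (h : IsRelativeValue B lam θ H) {e a b : ℝ} {k : ℕ} (hk : k ≤ B) :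
    0 ≤ ∫ u, stageGain B H e a b k u ∂expMeasure 1 := by
  by_cases hab : max a e < b
  · rw [h.integral_stageGain hk hab]
    refine mul_nonneg (Real.exp_pos _).le (integral_nonneg fun u => ?_)
    split_ifs
    · exact le_rfl
    · exact le_max_right _ _
  · rw [integral_stageGain_of_not_lt hab]

lemma IsRelativeValue.integral_stageGain_eq_zero {B : ℕ} {lam : ℝ} {θ : ℕ → ℝ} {H : ℕ → ℝ → ℝ}
    (h : IsRelativeValue B lam θ H) {e a b : ℝ} {k : ℕ} (hk : k ≤ B)
    (hb : max a e < b → k ≠ 0 → b - a ≤ θ k) :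
    ∫ u, stageGain B H e a b k u ∂expMeasure 1 = 0 := by
  by_cases hab : max a e < b
  · rw [h.integral_stageGain hk hab]
    refine mul_eq_zero_of_right _ (setIntegral_eq_zero_of_forall_eq_zero fun u hu => ?_)
    split_ifs with hk0
    · rfl
    · have := hb hab hk0
      exact max_eq_right (by linarith [Set.mem_Iic.1 hu])
  · rw [integral_stageGain_of_not_lt hab]

/-! ### Decomposition into stages -/

/-- The start of the `n`-th stage: time `0`, and then the arrivals. -/
noncomputable def epoch (y : ℕ → ℝ) (n : ℕ) : ℝ := ∑ i ∈ Finset.range n, y i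

lemma epoch_succ (y : ℕ → ℝ) (n : ℕ) : epoch y (n + 1) = pathTime y n := rfl

lemma pathTime_eq_epoch_add (y : ℕ → ℝ) (n : ℕ) : pathTime y n = epoch y n + y n :=
  Finset.sum_range_succ _ _

/-- The time `c`, clamped to the part before `T` of the time between two updates. -/
noncomputable def clampTime (s : ℕ → ℝ) (T : ℝ) (i : ℕ) (c : ℝ) : ℝ :=
  max (s i) (min c (min (s (i + 1)) T))

/-- The relative value at a time between the `i`-th update and the next one. -/
noncomputable def pathValue (B : ℕ) (H : ℕ → ℝ → ℝ) (y s : ℕ → ℝ) (i : ℕ) (c : ℝ) : ℝ :=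
  H (pathLevel B y s i c) (c - s i)

namespace IsFeasiblePath

variable {B : ℕ} {y s : ℕ → ℝ}

lemma pathCount_epoch (h : IsFeasiblePath B y s) {n : ℕ} {c : ℝ} (h1 : epoch y n ≤ c)
    (h2 : c < pathTime y n) : pathCount y c = n := by
  refine h.regular.pathCount_eq_iff.2 ⟨fun m hm => ?_, h2⟩
  obtain ⟨n, rfl⟩ : ∃ k, n = k + 1 := ⟨n - 1, by omega⟩
  exact (h.regular.strictMono.monotone (Nat.lt_succ_iff.1 hm)).trans h1

lemma stage_level (h : IsFeasiblePath B y s) {n i : ℕ} {c : ℝ} (h1 : max (s i) (epoch y n) ≤ c)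
    (h2 : c < pathTime y n) :
    pathLevel B y s i c = min (pathEnergy B y s i + (n - pathCount y (s i))) B := by
  rw [pathLevel, h.pathCount_epoch ((le_max_right _ _).trans h1) h2]

/-- The gain of one stage depends only on the information before it and on its length. -/
lemma pathValue_sub_eq_stageGain (h : IsFeasiblePath B y s) (H : ℕ → ℝ → ℝ) {T a b : ℝ}
    {i n k : ℕ} (ha : min a (pathTime y n) = min (min (s i) T) (pathTime y n))
    (hb : min b (pathTime y n) = min (min (s (i + 1)) T) (pathTime y n))
    (hk : s i < pathTime y n → s i < T →
      k = min (pathEnergy B y s i + (n - pathCount y (s i))) B) (hbT : b ≤ T) :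
    pathValue B H y s i (clampTime s T i (epoch y (n + 1))) -
      pathValue B H y s i (clampTime s T i (epoch y n)) =
        stageGain B H (epoch y n) a b k (y n) := by
  have hyn := h.regular.pos n
  have hss := h.mono (Nat.le_add_right i 1)
  rw [epoch_succ]
  have htn := pathTime_eq_epoch_add y n
  set t := pathTime y n with ht
  set e := epoch y n with he
  set β := min (s (i + 1)) T with hβ
  have hc1 : clampTime s T i t = max (s i) (min b t) := by
    rw [clampTime, hb, min_comm]
  have hc0 : clampTime s T i e = max (s i) (min e b) := by
    rw [clampTime]
    have hmin : ∀ z, min e z = min e (min z t) := fun z => by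
      rw [min_comm z t, ← min_assoc, min_eq_left (show e ≤ t by linarith)]
    rw [hmin β, hmin b, hb]
  rw [hc1, hc0]
  rcases le_or_gt t (s i) with hst | hst
  · -- the update comes after the stage
    have hz : ¬ (max a e < b ∧ max a e < e + y n) := by
      rintro ⟨h1, h2⟩
      have h3 : a < t := (le_max_left a e).trans_lt (by rw [htn]; exact h2)
      rw [min_eq_left h3.le] at ha
      have h4 : min (s i) T < t := by
        by_contra! h4
        rw [min_eq_right h4] at ha
        linarith
      have h5 : a = T := by
        rw [min_eq_left h4.le] at ha
        rcases min_choice (s i) T with h6 | h6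
        · rw [h6] at ha h4; linarith
        · rw [h6] at ha; exact ha
      linarith [le_max_left a e]
    rw [stageGain, if_neg hz, max_eq_left ((min_le_right _ _).trans hst),
      max_eq_left ((min_le_left _ _).trans (by linarith)), sub_self]
  · rcases le_or_gt T (s i) with hsT | hsT
    · -- the update comes after the horizon
      have hz : ¬ (max a e < b ∧ max a e < e + y n) := by
        rintro ⟨h1, h2⟩
        have h3 : a < t := (le_max_left a e).trans_lt (by rw [htn]; exact h2)
        rw [min_eq_left h3.le, min_eq_right hsT] at ha
        have h5 : a = T := by rw [ha]; exact min_eq_left (hsT.trans hst.le)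
        linarith [le_max_left a e]
      rw [stageGain, if_neg hz, max_eq_left ((min_le_left _ _).trans (hbT.trans hsT)),
        max_eq_left ((min_le_right _ _).trans (hbT.trans hsT)), sub_self]
    · have haS : a = s i := by
        rw [min_eq_left hsT.le, min_eq_left hst.le] at ha
        rcases min_choice a t with h6 | h6
        · rw [h6] at ha; exact ha
        · rw [h6] at ha; linarith
      have hsb : s i ≤ b := by
        have : s i ≤ min b t := by rw [hb]; exact le_min (le_min hss hsT.le) hst.le
        exact this.trans (min_le_left _ _)
      have hk' := hk hst hsT
      have hNs : pathCount y (s i) ≤ n := h.regular.pathCount_le_iff.2 hst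
      have hα : max a e < t := by rw [haS]; exact max_lt hst (by linarith)
      by_cases hab : max a e < b
      · have hcond : max a e < b ∧ max a e < e + y n := ⟨hab, by rwa [← htn]⟩
        rw [stageGain, if_pos hcond]
        have he0 : max (s i) (min e b) = max a e := by
          rw [haS, min_eq_left ((le_max_right a e).trans hab.le)]
        have hL0 : pathLevel B y s i (max a e) = k := by
          rw [hk']
          exact h.stage_level (by rw [← haS]) hα
        rw [he0]
        congr 1
        · rw [← htn]
          by_cases htb : t ≤ b
          · rw [if_pos htb, min_eq_right htb, max_eq_right hst.le, pathValue, haS]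
            congr 1
            have := h.regular.pathCount_pathTime n
            rw [pathLevel, ht, this, hk']
            omega
          · push Not at htb
            rw [if_neg (not_le.2 htb), min_eq_left htb.le, max_eq_right hsb, pathValue, haS]
            congr 1
            rw [hk']
            refine h.stage_level ?_ htb
            rw [← haS]
            exact hab.le
        · rw [pathValue, hL0, haS]
      · rw [stageGain, if_neg (fun h => hab h.1)]
        push Not at hab
        have : max (s i) (min b t) = max (s i) (min e b) := by
          rcases le_max_iff.1 hab with h1 | h1
          · rw [max_eq_left ((min_le_left b t).trans (by linarith)),
              max_eq_left ((min_le_right e b).trans (by linarith))]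
          · rw [min_eq_left (by linarith : b ≤ t), min_eq_right h1]
        rw [this, sub_self]

end IsFeasiblePath

/-- Along a threshold policy, the age stays below the threshold of the energy level. -/
def IsThresholdPath (B : ℕ) (θ : ℕ → ℝ) (y s : ℕ → ℝ) : Prop :=
  ∀ i c, s i ≤ c → c < s (i + 1) → pathLevel B y s i c ≠ 0 → c - s i ≤ θ (pathLevel B y s i c)

/-- Within a stage, the age at the end of the stage or of the epoch is below the threshold of the
energy level that holds throughout the stage. -/
lemma IsThresholdPath.stage_le {B : ℕ} {θ : ℕ → ℝ} {y s : ℕ → ℝ} (hθ : IsThresholdPath B θ y s)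
    (h : IsFeasiblePath B y s) {T a b : ℝ}
    {i n k : ℕ} (ha : min a (pathTime y n) = min (min (s i) T) (pathTime y n))
    (hb : min b (pathTime y n) = min (min (s (i + 1)) T) (pathTime y n))
    (hk : s i < pathTime y n → s i < T →
      k = min (pathEnergy B y s i + (n - pathCount y (s i))) B) (hbT : b ≤ T)
    (hab : max a (epoch y n) < b) (hat : max a (epoch y n) < pathTime y n) (hk0 : k ≠ 0) :
    min b (pathTime y n) - a ≤ θ k := by
  have haT' : a < T := by linarith [le_max_left a (epoch y n)]
  have hat' : a < pathTime y n := (le_max_left _ _).trans_lt hat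
  have haS : a = s i := by
    rw [min_eq_left hat'.le] at ha
    rcases min_choice (min (s i) T) (pathTime y n) with h6 | h6 <;> rw [h6] at ha
    · rcases min_choice (s i) T with h7 | h7 <;> rw [h7] at ha
      · exact ha
      · linarith
    · linarith
  have hk' := hk (haS ▸ hat') (haS ▸ haT')
  have hlt : ∀ c, max a (epoch y n) ≤ c → c < min b (pathTime y n) → c - a ≤ θ k := by
    intro c hc1 hc2
    have hc3 : c < pathTime y n := hc2.trans_le (min_le_right _ _)
    have hc4 : c < s (i + 1) := by
      rw [hb] at hc2
      exact hc2.trans_le ((min_le_left _ _).trans (min_le_left _ _))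
    have hL : pathLevel B y s i c = k := by
      rw [hk']
      exact h.stage_level (by rwa [← haS]) hc3
    have := hθ i c (by rw [← haS]; exact (le_max_left _ _).trans hc1) hc4 (by rwa [hL])
    rwa [hL, ← haS] at this
  have h1 : max a (epoch y n) < min b (pathTime y n) := lt_min hab hat
  by_contra! hcon
  obtain ⟨c, hc1, hc2⟩ := exists_between (max_lt h1 (show θ k + a < _ by linarith))
  have := hlt c ((le_max_left _ _).trans hc1.le) hc2
  have := (le_max_right _ _).trans_lt hc1
  linarith

/-! ### The expected gain of a stage -/

section Expectation

variable {Ω : Type*} [MeasurableSpace Ω] {P : Measure Ω} [IsProbabilityMeasure P] {B : ℕ}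
  {τ : ℕ → Ω → ℝ} {lam : ℝ} {θ : ℕ → ℝ} {H : ℕ → ℝ → ℝ} {s : ℕ → Ω → ℝ≥0∞}

/-- The gain of `H` in the `n`-th stage, between the `i`-th update and the next one. -/
noncomputable def policyGain (B : ℕ) (H : ℕ → ℝ → ℝ) (τ : ℕ → Ω → ℝ) (s : ℕ → Ω → ℝ≥0∞) (T : ℝ)
    (i n : ℕ) (ω : Ω) : ℝ :=
  pathValue B H (fun m => τ m ω) (fun j => (s j ω).toReal) i
      (clampTime (fun j => (s j ω).toReal) T i (epoch (fun m => τ m ω) (n + 1))) -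
    pathValue B H (fun m => τ m ω) (fun j => (s j ω).toReal) i
      (clampTime (fun j => (s j ω).toReal) T i (epoch (fun m => τ m ω) n))

/-- The representation of a stopping time before an arrival is compatible with a horizon `T`. -/
lemma toReal_min_eq {x x' : ℝ≥0∞} {t T : ℝ} (ht : 0 ≤ t) (hT : 0 ≤ T) (hx : x ≠ ∞)
    (h : min x (ENNReal.ofReal t) = min x' (ENNReal.ofReal t)) :
    min (min x' (ENNReal.ofReal T)).toReal t = min (min x.toReal T) t := by
  have h1 : min (min x' (ENNReal.ofReal T)) (ENNReal.ofReal t) =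
      min (min x (ENNReal.ofReal T)) (ENNReal.ofReal t) := by
    rw [min_right_comm, ← h, min_right_comm]
  have h2 := congrArg ENNReal.toReal h1
  have hn : ∀ z, min z (ENNReal.ofReal T) ≠ ∞ := fun z =>
    ne_top_of_le_ne_top ENNReal.ofReal_ne_top (min_le_right _ _)
  rw [ENNReal.toReal_min (hn _) ENNReal.ofReal_ne_top,
    ENNReal.toReal_min (hn _) ENNReal.ofReal_ne_top, ENNReal.toReal_ofReal ht,
    ENNReal.toReal_min hx ENNReal.ofReal_ne_top, ENNReal.toReal_ofReal hT] at h2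
  exact h2

lemma IsPoissonRecharge.map_past_next (hτ : IsPoissonRecharge P τ) (n : ℕ) :
    P.map (fun ω => (past τ n ω, τ n ω)) = (P.map (past τ n)).prod (expMeasure 1) := by
  have h := (hτ.indepFun_past_future n).comp measurable_id (measurable_pi_apply 0)
  have h2 := (indepFun_iff_map_prod_eq_prod_map_map (hτ.measurable_past n).aemeasurable
    (hτ.measurable n).aemeasurable).1 h
  rw [h2, hτ.law]

/-- The expected gain of a stage is nonnegative, and zero for a threshold policy. -/
theorem integral_policyGain (hτ : IsPoissonRecharge P τ)
    (hs : IsOnlinePolicy P B τ hτ.measurable s) (hH : IsRelativeValue B lam θ H) {T : ℝ}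
    (hT : 0 ≤ T) (i n : ℕ) :
    Integrable (policyGain B H τ s T i n) P ∧ 0 ≤ ∫ ω, policyGain B H τ s T i n ω ∂P ∧
      ((∀ᵐ ω ∂P, IsThresholdPath B θ (fun m => τ m ω) fun j => (s j ω).toReal) →
        ∫ ω, policyGain B H τ s T i n ω ∂P = 0) := by
  choose s' hs'm hs' using fun j => exists_past_of_isStoppingTime (hs.causal j) n
  set e : (Fin n → ℝ) → ℝ := fun p => epoch (extendPast p) n with he
  set a : (Fin n → ℝ) → ℝ := fun p => (min (s' i p) (ENNReal.ofReal T)).toReal with ha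
  set b : (Fin n → ℝ) → ℝ := fun p => (min (s' (i + 1) p) (ENNReal.ofReal T)).toReal with hb
  set k : (Fin n → ℝ) → ℕ := fun p =>
    min (pastEnergy B (fun j p => (s' j p).toReal) p i + (n - pastCount p (a p))) B with hk
  have hem : Measurable e := by
    have : Measurable fun y : ℕ → ℝ => epoch y n := by unfold epoch; fun_prop
    exact this.comp measurable_extendPast
  have ham : Measurable a := ((hs'm i).min measurable_const).ennreal_toReal
  have hbm : Measurable b := ((hs'm (i + 1)).min measurable_const).ennreal_toReal
  have hkm : Measurable k := by
    have h1 := measurable_pastEnergy B (fun j => (hs'm j).ennreal_toReal) i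
    have h2 : Measurable fun p => pastCount p (a p) :=
      Measurable.comp (g := fun q : (Fin n → ℝ) × ℝ => pastCount q.1 q.2)
        (f := fun p => (p, a p)) measurable_pastCount (measurable_id.prodMk ham)
    have h3 : Measurable fun q : ℕ × ℕ => min (q.1 + (n - q.2)) B := measurable_of_countable _
    exact h3.comp (h1.prodMk h2)
  have hbT : ∀ p, b p ≤ T := fun p => by
    have := ENNReal.toReal_mono ENNReal.ofReal_ne_top
      (min_le_right (s' (i + 1) p) (ENNReal.ofReal T))
    rwa [ENNReal.toReal_ofReal hT] at this
  have hkB : ∀ p, k p ≤ B := fun p => min_le_right _ _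
  set g : (Fin n → ℝ) × ℝ → ℝ := fun q => stageGain B H (e q.1) (a q.1) (b q.1) (k q.1) q.2 with hg
  have hgm : Measurable g := measurable_stageGain hH.measurable (hem.comp measurable_fst)
    (ham.comp measurable_fst) (hbm.comp measurable_fst) measurable_snd (hkm.comp measurable_fst)
  have hpm : Measurable fun ω => (past τ n ω, τ n ω) :=
    (hτ.measurable_past n).prodMk (hτ.measurable n)
  -- the data computed from the past agree with the policy
  have hdata : ∀ᵐ ω ∂P, IsFeasiblePath B (fun m => τ m ω) (fun j => (s j ω).toReal) ∧
      e (past τ n ω) = epoch (fun m => τ m ω) n ∧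
      min (a (past τ n ω)) (pathTime (fun m => τ m ω) n) =
        min (min (s i ω).toReal T) (pathTime (fun m => τ m ω) n) ∧
      min (b (past τ n ω)) (pathTime (fun m => τ m ω) n) =
        min (min (s (i + 1) ω).toReal T) (pathTime (fun m => τ m ω) n) ∧
      ((s i ω).toReal < pathTime (fun m => τ m ω) n → (s i ω).toReal < T →
        k (past τ n ω) = min (pathEnergy B (fun m => τ m ω) (fun j => (s j ω).toReal) i +
          (n - pathCount (fun m => τ m ω) (s i ω).toReal)) B) := by
    filter_upwards [ae_isFeasiblePath hτ hs] with ω hω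
    obtain ⟨hfin, hf, -⟩ := hω
    have ht0 := (hf.regular.pathTime_pos n).le
    have ha' := toReal_min_eq ht0 hT (hfin i) (hs' i ω hf.regular)
    have hb' := toReal_min_eq ht0 hT (hfin (i + 1)) (hs' (i + 1) ω hf.regular)
    refine ⟨hf, ?_, ha', hb', fun h1 h2 => ?_⟩
    · refine Finset.sum_congr rfl fun j hj => ?_
      simp [extendPast, past, Finset.mem_range.1 hj]
    · have heq : ∀ j ≤ i, (s' j (past τ n ω)).toReal = (s j ω).toReal := by
        intro j hj
        have h3 : (s j ω).toReal < pathTime (fun m => τ m ω) n := (hf.mono hj).trans_lt h1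
        have h4 : s j ω < ENNReal.ofReal (pathTime (fun m => τ m ω) n) := by
          rwa [ENNReal.lt_ofReal_iff_toReal_lt (hfin j)]
        have h5 := hs' j ω hf.regular
        rw [min_eq_left h4.le] at h5
        rcases min_choice (s' j (past τ n ω)) (ENNReal.ofReal (pathTime (fun m => τ m ω) n))
          with h6 | h6
        · rw [h5, h6]
        · rw [h6] at h5
          exact absurd h5 h4.ne
      have hae : a (past τ n ω) = (s i ω).toReal := by
        rw [min_eq_left h2.le, min_eq_left h1.le] at ha'
        rcases min_choice (a (past τ n ω)) (pathTime (fun m => τ m ω) n) with h6 | h6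
        · rw [← h6]; exact ha'
        · rw [h6] at ha'; linarith
      simp only [hk]
      rw [pastEnergy_past hf h1 heq, hae, pastCount_past hf.regular h1]
  have hgain : policyGain B H τ s T i n =ᵐ[P] fun ω => g (past τ n ω, τ n ω) := by
    filter_upwards [hdata] with ω hω
    obtain ⟨hf, h1, h2, h3, h4⟩ := hω
    simp only [policyGain, hg]
    rw [h1]
    exact hf.pathValue_sub_eq_stageGain H h2 h3 h4 (hbT _)
  obtain ⟨C, hC, hCH⟩ := hH.exists_abs_le T
  have hgb : ∀ q, ‖g q‖ ≤ 2 * C := fun q =>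
    abs_stageGain_le hC hCH ENNReal.toReal_nonneg (hbT _) (hkB _) _
  have : IsProbabilityMeasure (P.map (past τ n)) :=
    Measure.isProbabilityMeasure_map (hτ.measurable_past n).aemeasurable
  have hgi : Integrable g ((P.map (past τ n)).prod (expMeasure 1)) :=
    Integrable.of_bound hgm.aestronglyMeasurable _ (Eventually.of_forall hgb)
  have hint : ∫ ω, policyGain B H τ s T i n ω ∂P =
      ∫ p, ∫ u, g (p, u) ∂expMeasure 1 ∂(P.map (past τ n)) := by
    rw [integral_congr_ae hgain, ← integral_prod _ hgi, ← hτ.map_past_next n,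
      integral_map hpm.aemeasurable hgm.aestronglyMeasurable]
  refine ⟨?_, ?_, fun hth => ?_⟩
  · refine Integrable.congr ?_ hgain.symm
    exact Integrable.of_bound (hgm.comp hpm).aestronglyMeasurable _
      (Eventually.of_forall fun ω => hgb _)
  · rw [hint]
    exact integral_nonneg fun p => by
      simpa only [hg] using! hH.integral_stageGain_nonneg (hkB p)
  · rw [hint]
    refine integral_eq_zero_of_ae ?_
    have hle : ∀ᵐ q ∂((P.map (past τ n)).prod (expMeasure 1)),
        max (a q.1) (e q.1) < b q.1 → max (a q.1) (e q.1) < e q.1 + q.2 → k q.1 ≠ 0 →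
          min (b q.1) (e q.1 + q.2) - a q.1 ≤ θ (k q.1) := by
      rw [← hτ.map_past_next n]
      have hθk : Measurable fun p => θ (k p) := (measurable_of_countable θ).comp hkm
      have hset : MeasurableSet {q : (Fin n → ℝ) × ℝ | max (a q.1) (e q.1) < b q.1 →
          max (a q.1) (e q.1) < e q.1 + q.2 → k q.1 ≠ 0 →
            min (b q.1) (e q.1 + q.2) - a q.1 ≤ θ (k q.1)} := by
        refine MeasurableSet.imp ?_ (MeasurableSet.imp ?_ (MeasurableSet.imp ?_ ?_))
        · exact measurableSet_lt (by fun_prop) (by fun_prop)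
        · exact measurableSet_lt (by fun_prop) (by fun_prop)
        · exact (hkm.comp measurable_fst) (MeasurableSet.of_discrete (s := {0}ᶜ))
        · exact measurableSet_le (by fun_prop) (hθk.comp measurable_fst)
      rw [ae_map_iff hpm.aemeasurable hset]
      filter_upwards [hdata, hth] with ω hω hωθ
      obtain ⟨hf, h1, h2, h3, h4⟩ := hω
      simp only [h1]
      rw [← pathTime_eq_epoch_add]
      exact hωθ.stage_le hf h2 h3 h4 (hbT _)
    filter_upwards [Measure.ae_ae_of_ae_prod hle] with p hp
    simp only [hg, Pi.zero_apply]
    refine hH.integral_stageGain_eq_zero (hkB p) fun hab hk0 => ?_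
    have hpos : expMeasure 1 (Set.Ioi (max 0 (b p - e p))) ≠ 0 := by
      rw [expMeasure_one_Ioi (le_max_left _ _)]
      simp [Real.exp_pos]
    -- a late next arrival, which has positive probability, bounds the age at the next update
    obtain ⟨u, hu, hup⟩ := (frequently_ae_mem_iff.2 hpos).and_eventually hp |>.exists
    have hu' : b p < e p + u := by
      have := (le_max_right 0 (b p - e p)).trans_lt hu
      linarith
    have := hup hab (hab.trans hu') hk0
    rwa [min_eq_left hu'.le] at this

end Expectation

/-! ### The area under the age curve -/

/-- The part before time `T` of the time between the `i`-th update and the next one. -/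
noncomputable def cutLength (s : ℕ → ℝ) (T : ℝ) (i : ℕ) : ℝ := min (s (i + 1)) T - min (s i) T

/-- The area under the age curve up to time `T`, restricted to the first `N` updates. -/
noncomputable def cutArea (s : ℕ → ℝ) (T : ℝ) (N : ℕ) : ℝ :=
  ∑ i ∈ Finset.range N, cutLength s T i ^ 2 / 2

namespace IsFeasiblePath

variable {B : ℕ} {y s : ℕ → ℝ}

lemma cutLength_nonneg (h : IsFeasiblePath B y s) (T : ℝ) (i : ℕ) : 0 ≤ cutLength s T i :=
  sub_nonneg.2 (min_le_min_right _ (h.mono (Nat.le_add_right i 1)))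

lemma cutLength_mono (h : IsFeasiblePath B y s) {T T' : ℝ} (hT : T' ≤ T) (i : ℕ) :
    cutLength s T' i ≤ cutLength s T i := by
  have := h.mono (Nat.le_add_right i 1)
  simp only [cutLength, min_def]
  split_ifs <;> linarith

lemma cutArea_mono (h : IsFeasiblePath B y s) {T T' : ℝ} (hT : T' ≤ T) (N : ℕ) :
    cutArea s T' N ≤ cutArea s T N := by
  refine Finset.sum_le_sum fun i _ => ?_
  have := pow_le_pow_left₀ (h.cutLength_nonneg T' i) (h.cutLength_mono hT i) 2
  linarith

lemma sum_cutLength (h : IsFeasiblePath B y s) {T : ℝ} (hT : 0 ≤ T) (N : ℕ) :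
    ∑ i ∈ Finset.range N, cutLength s T i = min (s N) T := by
  simp only [cutLength]
  rw [Finset.sum_range_sub (fun i => min (s i) T), h.start, min_eq_left hT, sub_zero]

lemma cutArea_nonneg (s : ℕ → ℝ) (T : ℝ) (N : ℕ) : 0 ≤ cutArea s T N :=
  Finset.sum_nonneg fun _ _ => by positivity

lemma cutArea_le (h : IsFeasiblePath B y s) {T : ℝ} (hT : 0 ≤ T) (N : ℕ) :
    cutArea s T N ≤ T ^ 2 / 2 := by
  rw [cutArea, ← Finset.sum_div]
  have h1 := Finset.sum_sq_le_sq_sum_of_nonneg (s := Finset.range N) (f := cutLength s T)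
    fun i _ => h.cutLength_nonneg T i
  rw [h.sum_cutLength hT] at h1
  have h2 : min (s N) T ^ 2 ≤ T ^ 2 :=
    pow_le_pow_left₀ (le_min (h.nonneg N) hT) (min_le_right _ _) 2
  linarith

lemma exists_lt (h : IsFeasiblePath B y s) (T : ℝ) : ∃ i, T < s (i + 1) := by
  obtain ⟨n, hn⟩ := (h.regular.tendsto.eventually_gt_atTop T).exists
  exact ⟨n, hn.trans_le (h.pathTime_le n)⟩

/-- The number of the last update before `T`. -/
lemma exists_last (h : IsFeasiblePath B y s) {T : ℝ} (hT : 0 ≤ T) :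
    ∃ M, s M ≤ T ∧ T < s (M + 1) ∧ {i : ℕ | 1 ≤ i ∧ s i ≤ T} = Finset.Icc 1 M := by
  classical
  have hex := h.exists_lt T
  have h1 : s (Nat.find hex) ≤ T := by
    cases hM : Nat.find hex with
    | zero => rw [h.start]; exact hT
    | succ k =>
      have := Nat.find_min hex (m := k) (by omega)
      exact not_lt.1 this
  refine ⟨Nat.find hex, h1, Nat.find_spec hex, ?_⟩
  ext i
  simp only [Set.mem_ofPred_eq, Finset.coe_Icc, Set.mem_Icc]
  refine and_congr_right fun _ => ⟨fun hi => ?_, fun hi => (h.mono hi).trans h1⟩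
  by_contra! hlt
  exact absurd (Nat.find_spec hex) (not_lt.2 ((h.mono hlt).trans hi))

end IsFeasiblePath

/-- The area under the age curve is a sum over all the epochs, in which the unfinished epoch is not
distinguished. -/
lemma ageArea_eq {B : ℕ} {y : ℕ → ℝ} {s : ℕ → Ω → ℝ≥0∞} {ω : Ω} (hfin : ∀ i, s i ω ≠ ∞)
    (h : IsFeasiblePath B y fun i => (s i ω).toReal) (T : ℝ≥0) :
    ageArea s T ω =
      ∑' i, ENNReal.ofReal (cutLength (fun i => (s i ω).toReal) T i ^ 2 / 2) := by
  obtain ⟨M, h1, h2, h3⟩ := h.exists_last (T := (T : ℝ)) T.coe_nonneg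
  have hle : ∀ i, s i ω ≤ T ↔ (s i ω).toReal ≤ (T : ℝ) := fun i => by
    rw [← ENNReal.toReal_le_toReal (hfin i) ENNReal.coe_ne_top, ENNReal.coe_toReal]
  have hM : updateCount s T ω = M := by
    rw [updateCount]
    simp only [hle]
    change {i : ℕ | 1 ≤ i ∧ (s i ω).toReal ≤ (T : ℝ)} = _ at h3
    rw [h3, Set.ncard_coe_finset, Nat.card_Icc]
    rfl
  have hsT : ∀ i, M < i → (T : ℝ) ≤ (s i ω).toReal := fun i hi =>
    h2.le.trans (h.mono (Nat.succ_le_of_lt hi))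
  have hsT' : ∀ i, i ≤ M → (s i ω).toReal ≤ (T : ℝ) := fun i hi => (h.mono hi).trans h1
  rw [tsum_eq_sum (s := Finset.range (M + 1)), Finset.sum_range_succ, ageArea, hM]
  · congr 1
    · rw [ENNReal.div_eq_inv_mul, Finset.mul_sum]
      refine Finset.sum_congr rfl fun i hi => ?_
      have hi' := Finset.mem_range.1 hi
      have hc : cutLength (fun i => (s i ω).toReal) T i = (interUpdate s i ω).toReal := by
        rw [interUpdate, ENNReal.toReal_sub_of_le _ (hfin _), cutLength,
          min_eq_left (hsT' _ (by omega)), min_eq_left (hsT' _ hi'.le)]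
        rw [← ENNReal.toReal_le_toReal (hfin _) (hfin _)]
        exact h.mono (Nat.le_add_right i 1)
      have hit : interUpdate s i ω ≠ ∞ := ENNReal.sub_ne_top (hfin _)
      rw [hc, ENNReal.ofReal_div_of_pos two_pos, ENNReal.ofReal_pow ENNReal.toReal_nonneg,
        ENNReal.ofReal_toReal hit, ENNReal.div_eq_inv_mul]
      simp
    · have hc : cutLength (fun i => (s i ω).toReal) T M = ((T : ℝ≥0∞) - s M ω).toReal := by
        rw [ENNReal.toReal_sub_of_le ((hle M).2 h1) ENNReal.coe_ne_top, cutLength,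
          min_eq_right h2.le, min_eq_left h1, ENNReal.coe_toReal]
      have hit : (T : ℝ≥0∞) - s M ω ≠ ∞ := ENNReal.sub_ne_top ENNReal.coe_ne_top
      rw [hc, ENNReal.ofReal_div_of_pos two_pos, ENNReal.ofReal_pow ENNReal.toReal_nonneg,
        ENNReal.ofReal_toReal hit]
      simp
  · intro i hi
    have hi' : M < i := by simpa using hi
    rw [cutLength, min_eq_right (hsT i hi'), min_eq_right (hsT (i + 1) (by omega))]
    simp

/-! ### Telescoping the relative value -/

lemma epoch_tendsto {y : ℕ → ℝ} (hy : IsRegularPath y) : Tendsto (epoch y) atTop atTop :=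
  (tendsto_add_atTop_iff_nat 1).1 hy.tendsto

lemma IsRegularPath.epoch_nonneg {y : ℕ → ℝ} (hy : IsRegularPath y) (n : ℕ) : 0 ≤ epoch y n :=
  Finset.sum_nonneg fun i _ => (hy.pos i).le

/-- The relative value between two updates up to time `T`, without the cost of the age. -/
noncomputable def cutValue (B : ℕ) (lam : ℝ) (H : ℕ → ℝ → ℝ) (y s : ℕ → ℝ) (T : ℝ) (i : ℕ) : ℝ :=
  pathValue B H y s i (clampTime s T i T) -
    (cutLength s T i ^ 2 / 2 - lam * cutLength s T i) - H (pathEnergy B y s i) 0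

namespace IsFeasiblePath

variable {B : ℕ} {y s : ℕ → ℝ} {lam : ℝ} {θ : ℕ → ℝ} {H : ℕ → ℝ → ℝ}

lemma clampTime_sub (h : IsFeasiblePath B y s) {T : ℝ} (i : ℕ) :
    clampTime s T i T - s i = cutLength s T i := by
  have := h.mono (Nat.le_add_right i 1)
  rw [clampTime, cutLength, min_left_comm, min_self]
  rcases le_total (s i) T with h1 | h1
  · rw [min_eq_left h1, max_eq_right (le_min this h1)]
  · rw [max_eq_left ((min_le_right _ _).trans h1), min_eq_right h1, min_eq_right (h1.trans this)]
    ring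

/-- The gains of all the stages up to the `m`-th arrival telescope within each epoch; as there are
at most as many updates as arrivals, `m + 1` epochs suffice. -/
lemma sum_stages (h : IsFeasiblePath B y s) (H : ℕ → ℝ → ℝ) {T : ℝ} (hT : 0 ≤ T) (m : ℕ) :
    ∑ i ∈ Finset.range (m + 1), ∑ n ∈ Finset.range m,
      (pathValue B H y s i (clampTime s T i (epoch y (n + 1))) -
        pathValue B H y s i (clampTime s T i (epoch y n))) =
      cutArea s (min T (epoch y m)) (m + 1) - lam * min T (epoch y m) +
        ∑ i ∈ Finset.range (m + 1), cutValue B lam H y s (min T (epoch y m)) i := by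
  have hT' : 0 ≤ min T (epoch y m) := le_min hT (h.regular.epoch_nonneg m)
  have hlast : min T (epoch y m) ≤ s (m + 1) :=
    (min_le_right _ _).trans (le_trans (by rw [pathTime_eq_epoch_add]; linarith [h.regular.pos m])
      (h.pathTime_le m))
  have h1 := h.sum_cutLength hT' (m + 1)
  rw [min_eq_right hlast] at h1
  have key : ∀ i, ∑ n ∈ Finset.range m,
      (pathValue B H y s i (clampTime s T i (epoch y (n + 1))) -
        pathValue B H y s i (clampTime s T i (epoch y n))) =
      cutLength s (min T (epoch y m)) i ^ 2 / 2 - lam * cutLength s (min T (epoch y m)) i +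
        cutValue B lam H y s (min T (epoch y m)) i := ?_
  · rw [Finset.sum_congr rfl fun i _ => key i, Finset.sum_add_distrib, Finset.sum_sub_distrib,
      ← Finset.mul_sum, h1, cutArea]
  intro i
  rw [Finset.sum_range_sub (fun n => pathValue B H y s i (clampTime s T i (epoch y n)))]
  have e0 : clampTime s T i (epoch y 0) = s i := by
    have : epoch y 0 = 0 := by simp [epoch]
    rw [this, clampTime, max_eq_left ((min_le_left _ _).trans (h.nonneg i))]
  have e1 : clampTime s T i (epoch y m) =
      clampTime s (min T (epoch y m)) i (min T (epoch y m)) := by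
    simp only [clampTime]
    congr 1
    have : ∀ u v w : ℝ, min u (min v w) = min (min w u) (min v (min w u)) := by
      intro u v w
      simp only [min_def]
      split_ifs <;> linarith
    exact this _ _ _
  have e2 : pathValue B H y s i (s i) = H (pathEnergy B y s i) 0 := by
    rw [pathValue, pathLevel_self, sub_self]
  rw [e0, e1, e2, cutValue]
  ring

lemma cutValue_of_le (h : IsFeasiblePath B y s) {T : ℝ} {i : ℕ} (hT : s (i + 1) ≤ T) :
    cutLength s T i = s (i + 1) - s i ∧ clampTime s T i T = s (i + 1) := by
  have := h.mono (Nat.le_add_right i 1)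
  rw [cutLength, clampTime, min_eq_left hT, min_eq_left (this.trans hT), min_eq_right hT,
    max_eq_right this]
  exact ⟨rfl, rfl⟩

lemma cutValue_of_ge (h : IsFeasiblePath B y s) {T : ℝ} {i : ℕ} (hT : T ≤ s i) :
    cutValue B lam H y s T i = 0 := by
  have := h.mono (Nat.le_add_right i 1)
  have e1 : cutLength s T i = 0 := by
    rw [cutLength, min_eq_right hT, min_eq_right (hT.trans this), sub_self]
  have e2 : clampTime s T i T = s i := by
    rw [clampTime, max_eq_left ((min_le_left _ _).trans hT)]
  rw [cutValue, e1, e2, pathValue, pathLevel_self, sub_self]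
  ring

/-- An update costs at least the drop of the relative value that it brings, so the gains over the
epochs, without the costs, are at most the final value: that of the energy left, or, within an
epoch, one that is linear in the age `a`. -/
lemma sum_cutValue_le (h : IsFeasiblePath B y s) (hH : IsRelativeValue B lam θ H) {T C : ℝ}
    (hT : 0 ≤ T) (hC : ∀ k ≤ B, ∀ a, 0 ≤ a → H k a ≤ a ^ 2 / 2 - lam * a + C + a) (N : ℕ) :
    (s N ≤ T → ∑ i ∈ Finset.range N, cutValue B lam H y s T i ≤
      H (pathEnergy B y s N) 0 - H 0 0) ∧
    (T < s N → ∃ a, 0 ≤ a ∧ a ^ 2 / 2 ≤ cutArea s T N ∧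
      ∑ i ∈ Finset.range N, cutValue B lam H y s T i ≤ C + a - H 0 0) := by
  induction N with
  | zero =>
    refine ⟨fun _ => by simp [pathEnergy], fun hlt => ?_⟩
    rw [h.start] at hlt
    linarith
  | succ N ih =>
    rw [Finset.sum_range_succ]
    have hmono := h.mono (Nat.le_add_right N 1)
    have hcut : cutLength s T N ^ 2 / 2 ≤ cutArea s T (N + 1) := by
      rw [cutArea, Finset.sum_range_succ]
      have := cutArea_nonneg s T N
      rw [cutArea] at this
      linarith
    have hcut' : cutArea s T N ≤ cutArea s T (N + 1) := by
      rw [cutArea, cutArea, Finset.sum_range_succ]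
      have : 0 ≤ cutLength s T N ^ 2 / 2 := by positivity
      linarith
    constructor
    · intro hN
      obtain ⟨e1, e2⟩ := h.cutValue_of_le hN
      have h1 := ih.1 (hmono.trans hN)
      have h2 := h.feasible N
      obtain ⟨k, hk⟩ : ∃ k, pathLevel B y s N (s (N + 1)) = k + 1 :=
        ⟨_, (Nat.sub_add_cancel h2).symm⟩
      have hkB : k + 1 ≤ B := hk ▸ min_le_right _ _
      have h3 := hH.update_le k hkB (s (N + 1) - s N) (sub_nonneg.2 hmono)
      have h4 : pathEnergy B y s (N + 1) = k := by rw [pathEnergy_succ, hk]; rfl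
      rw [cutValue, e1, e2, pathValue, hk, h4]
      linarith
    · intro hN
      rcases le_or_gt (s N) T with hNT | hNT
      · refine ⟨cutLength s T N, h.cutLength_nonneg T N, hcut, ?_⟩
        have h1 := ih.1 hNT
        have h2 := hC (pathLevel B y s N (clampTime s T N T)) (min_le_right _ _)
          (cutLength s T N) (h.cutLength_nonneg T N)
        rw [cutValue, pathValue, h.clampTime_sub]
        linarith
      · obtain ⟨a, ha, ha2, h1⟩ := ih.2 hNT
        refine ⟨a, ha, ha2.trans hcut', ?_⟩
        rw [h.cutValue_of_ge hNT.le]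
        linarith

/-- At updates above the threshold the drop of the relative value equals the cost, which reverses
the estimate of `sum_cutValue_le`. -/
lemma le_sum_cutValue (h : IsFeasiblePath B y s) (hH : IsRelativeValue B lam θ H) {T C : ℝ}
    (hT : 0 ≤ T) (hC : ∀ k ≤ B, ∀ a, 0 ≤ a → a ^ 2 / 2 - lam * a - C ≤ H k a)
    (hupd : ∀ i, θ (pathLevel B y s i (s (i + 1))) ≤ s (i + 1) - s i) (N : ℕ) :
    (s N ≤ T → H (pathEnergy B y s N) 0 - H 0 0 ≤
      ∑ i ∈ Finset.range N, cutValue B lam H y s T i) ∧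
    (T < s N → -C - H 0 0 ≤ ∑ i ∈ Finset.range N, cutValue B lam H y s T i) := by
  induction N with
  | zero =>
    refine ⟨fun _ => by simp [pathEnergy], fun hlt => ?_⟩
    rw [h.start] at hlt
    linarith
  | succ N ih =>
    rw [Finset.sum_range_succ]
    have hmono := h.mono (Nat.le_add_right N 1)
    constructor
    · intro hN
      obtain ⟨e1, e2⟩ := h.cutValue_of_le hN
      have h1 := ih.1 (hmono.trans hN)
      have h2 := h.feasible N
      obtain ⟨k, hk⟩ : ∃ k, pathLevel B y s N (s (N + 1)) = k + 1 :=
        ⟨_, (Nat.sub_add_cancel h2).symm⟩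
      have hkB : k + 1 ≤ B := hk ▸ min_le_right _ _
      have h3 := hH.update_eq k hkB (s (N + 1) - s N) (sub_nonneg.2 hmono) (hk ▸ hupd N)
      have h4 : pathEnergy B y s (N + 1) = k := by rw [pathEnergy_succ, hk]; rfl
      rw [cutValue, e1, e2, pathValue, hk, h4]
      linarith
    · intro hN
      rcases le_or_gt (s N) T with hNT | hNT
      · have h1 := ih.1 hNT
        have h2 := hC (pathLevel B y s N (clampTime s T N T)) (min_le_right _ _)
          (cutLength s T N) (h.cutLength_nonneg T N)
        rw [cutValue, pathValue, h.clampTime_sub]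
        linarith
      · rw [h.cutValue_of_ge hNT.le]
        linarith [ih.2 hNT]

end IsFeasiblePath

/-! ### Bounds of the average age -/

section AverageAge

variable {Ω : Type*} [MeasurableSpace Ω] {P : Measure Ω} {B : ℕ}
  {τ : ℕ → Ω → ℝ} {lam : ℝ} {θ : ℕ → ℝ} {H : ℕ → ℝ → ℝ} {s : ℕ → Ω → ℝ≥0∞}

lemma IsOnlinePolicy.measurable {hτ : ∀ n, Measurable (τ n)} (hs : IsOnlinePolicy P B τ hτ s)
    (i : ℕ) : Measurable (s i) := (hs.causal i).measurable'

lemma measurable_cutArea (hs : ∀ i, Measurable (s i)) {f : Ω → ℝ} (hf : Measurable f) (N : ℕ) :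
    Measurable fun ω => cutArea (fun i => (s i ω).toReal) (f ω) N := by
  unfold cutArea cutLength
  have := fun i => (hs i).ennreal_toReal
  fun_prop

lemma measurable_epoch (hτ : IsPoissonRecharge P τ) (m : ℕ) :
    Measurable fun ω => epoch (fun n => τ n ω) m :=
  Finset.measurable_sum _ fun i _ => hτ.measurable i

lemma integrable_cutArea [IsProbabilityMeasure P] (hτ : IsPoissonRecharge P τ)
    (hs : IsOnlinePolicy P B τ hτ.measurable s) {T : ℝ} {f : Ω → ℝ}
    (hf : Measurable f) (h0 : ∀ᵐ ω ∂P, 0 ≤ f ω) (hfT : ∀ ω, f ω ≤ T) (N : ℕ) :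
    Integrable (fun ω => cutArea (fun i => (s i ω).toReal) (f ω) N) P := by
  refine Integrable.of_bound (measurable_cutArea hs.measurable hf N).aestronglyMeasurable
    (T ^ 2 / 2) ?_
  filter_upwards [ae_isFeasiblePath hτ hs, h0] with ω hω hω0
  rw [Real.norm_eq_abs, abs_of_nonneg (IsFeasiblePath.cutArea_nonneg _ _ _)]
  refine (hω.2.1.cutArea_le hω0 N).trans ?_
  have := pow_le_pow_left₀ hω0 (hfT ω) 2
  linarith

lemma integrable_min_epoch [IsProbabilityMeasure P] (hτ : IsPoissonRecharge P τ) {T : ℝ}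
    (hT : 0 ≤ T) (m : ℕ) : Integrable (fun ω => min T (epoch (fun n => τ n ω) m)) P := by
  refine Integrable.of_bound (measurable_const.min (measurable_epoch hτ m)).aestronglyMeasurable
    T ?_
  filter_upwards [hτ.ae_regular] with ω hω
  rw [Real.norm_eq_abs, abs_of_nonneg (le_min hT (hω.epoch_nonneg m))]
  exact min_le_left _ _

lemma tendsto_integral_min_epoch [IsProbabilityMeasure P] (hτ : IsPoissonRecharge P τ) {T : ℝ}
    (hT : 0 ≤ T) :
    Tendsto (fun m => ∫ ω, min T (epoch (fun n => τ n ω) m) ∂P) atTop (nhds T) := by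
  have h : Tendsto (fun m => ∫ ω, min T (epoch (fun n => τ n ω) m) ∂P) atTop
      (nhds (∫ _, T ∂P)) := by
    refine tendsto_integral_of_dominated_convergence (fun _ => T)
      (fun m => (integrable_min_epoch hτ hT m).aestronglyMeasurable) (integrable_const _)
      (fun m => ?_) ?_
    · filter_upwards [hτ.ae_regular] with ω hω
      rw [Real.norm_eq_abs, abs_of_nonneg (le_min hT (hω.epoch_nonneg m))]
      exact min_le_left _ _
    · filter_upwards [hτ.ae_regular] with ω hω
      refine tendsto_const_nhds.congr' ?_
      filter_upwards [(epoch_tendsto hω).eventually_ge_atTop T] with m hm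
      rw [min_eq_left hm]
  simpa using h

/-- The total gain of `H` over the first stages. -/
lemma sum_policyGain_ae (hτ : IsPoissonRecharge P τ)
    (hs : IsOnlinePolicy P B τ hτ.measurable s) (H : ℕ → ℝ → ℝ) (lam : ℝ) {T : ℝ}
    (hT : 0 ≤ T) (m : ℕ) : ∀ᵐ ω ∂P,
    ∑ i ∈ Finset.range (m + 1), ∑ n ∈ Finset.range m, policyGain B H τ s T i n ω =
      cutArea (fun i => (s i ω).toReal) (min T (epoch (fun n => τ n ω) m)) (m + 1) -
        lam * min T (epoch (fun n => τ n ω) m) +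
        ∑ i ∈ Finset.range (m + 1), cutValue B lam H (fun n => τ n ω) (fun i => (s i ω).toReal)
          (min T (epoch (fun n => τ n ω) m)) i := by
  filter_upwards [ae_isFeasiblePath hτ hs] with ω hω
  exact hω.2.1.sum_stages H hT m

lemma lintegral_ageArea_eq (hτ : IsPoissonRecharge P τ)
    (hs : IsOnlinePolicy P B τ hτ.measurable s) (T : ℝ≥0) :
    ∫⁻ ω, ageArea s T ω ∂P =
      ∫⁻ ω, ∑' i, ENNReal.ofReal (cutLength (fun i => (s i ω).toReal) T i ^ 2 / 2) ∂P := by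
  refine lintegral_congr_ae ?_
  filter_upwards [ae_isFeasiblePath hτ hs] with ω hω
  exact ageArea_eq hω.1 hω.2.1 T

variable [IsProbabilityMeasure P]

lemma integral_sum_policyGain (hτ : IsPoissonRecharge P τ)
    (hs : IsOnlinePolicy P B τ hτ.measurable s) (hH : IsRelativeValue B lam θ H) {T : ℝ}
    (hT : 0 ≤ T) (m : ℕ) :
    ∫ ω, ∑ i ∈ Finset.range (m + 1), ∑ n ∈ Finset.range m, policyGain B H τ s T i n ω ∂P =
      ∑ i ∈ Finset.range (m + 1), ∑ n ∈ Finset.range m, ∫ ω, policyGain B H τ s T i n ω ∂P := by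
  rw [integral_finsetSum _ fun i _ => integrable_finsetSum _ fun n _ =>
    (integral_policyGain hτ hs hH hT i n).1]
  refine Finset.sum_congr rfl fun i _ => ?_
  rw [integral_finsetSum _ fun n _ => (integral_policyGain hτ hs hH hT i n).1]

lemma integrable_sum_policyGain (hτ : IsPoissonRecharge P τ)
    (hs : IsOnlinePolicy P B τ hτ.measurable s) (hH : IsRelativeValue B lam θ H) {T : ℝ}
    (hT : 0 ≤ T) (m : ℕ) :
    Integrable (fun ω => ∑ i ∈ Finset.range (m + 1), ∑ n ∈ Finset.range m,
      policyGain B H τ s T i n ω) P :=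
  integrable_finsetSum _ fun i _ => integrable_finsetSum _ fun n _ =>
    (integral_policyGain hτ hs hH hT i n).1

lemma ofReal_cutArea (x : ℕ → ℝ) (T : ℝ) (N : ℕ) :
    ENNReal.ofReal (cutArea x T N) =
      ∑ i ∈ Finset.range N, ENNReal.ofReal (cutLength x T i ^ 2 / 2) :=
  ENNReal.ofReal_sum_of_nonneg fun _ _ => by positivity

/-- A lower bound of the area under the age curve of every policy: as half of the square of the
current age is part of the area, the linear term of the relative value is negligible. -/
lemma le_lintegral_ageArea (hτ : IsPoissonRecharge P τ) (hH : IsRelativeValue B lam θ H) {ε : ℝ}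
    (hε : 0 < ε) : ∃ C : ℝ, ∀ s : ℕ → Ω → ℝ≥0∞, IsOnlinePolicy P B τ hτ.measurable s →
      ∀ T : ℝ≥0, ENNReal.ofReal (lam * T - C) ≤
        ENNReal.ofReal (1 + ε) * ∫⁻ ω, ageArea s T ω ∂P := by
  obtain ⟨C, hC⟩ := hH.upper
  refine ⟨|C| + 1 / (2 * ε) - H 0 0, fun s hs T => ?_⟩
  set K := |C| + 1 / (2 * ε) - H 0 0 with hK
  have hT : (0 : ℝ) ≤ T := T.coe_nonneg
  by_cases htop : ∫⁻ ω, ageArea s T ω ∂P = ∞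
  · rw [htop, ENNReal.mul_top (by simp; linarith)]
    exact le_top
  set ρ := (∫⁻ ω, ageArea s T ω ∂P).toReal with hρ
  have hbound : ∀ m, lam * ∫ ω, min (T : ℝ) (epoch (fun n => τ n ω) m) ∂P ≤ (1 + ε) * ρ + K := by
    intro m
    have hT' : ∀ᵐ ω ∂P, 0 ≤ min (T : ℝ) (epoch (fun n => τ n ω) m) := by
      filter_upwards [hτ.ae_regular] with ω hω using le_min hT (hω.epoch_nonneg m)
    have hA := integrable_cutArea hτ hs measurable_const (ae_of_all _ fun _ => hT)
      (fun _ => le_rfl) (m + 1)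
    have hA2 : ∫ ω, cutArea (fun i => (s i ω).toReal) T (m + 1) ∂P ≤ ρ := by
      rw [integral_eq_lintegral_of_nonneg_ae
        (ae_of_all _ fun ω => IsFeasiblePath.cutArea_nonneg _ _ _) hA.aestronglyMeasurable]
      refine ENNReal.toReal_mono htop ?_
      rw [lintegral_ageArea_eq hτ hs]
      refine lintegral_mono fun ω => ?_
      rw [ofReal_cutArea]
      exact ENNReal.sum_le_tsum _
    have h0 : 0 ≤ ∫ ω, ∑ i ∈ Finset.range (m + 1), ∑ n ∈ Finset.range m,
        policyGain B H τ s T i n ω ∂P := by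
      rw [integral_sum_policyGain hτ hs hH hT]
      exact Finset.sum_nonneg fun i _ => Finset.sum_nonneg fun n _ =>
        (integral_policyGain hτ hs hH hT i n).2.1
    have hle : ∀ᵐ ω ∂P, ∑ i ∈ Finset.range (m + 1), ∑ n ∈ Finset.range m,
        policyGain B H τ s T i n ω ≤ (1 + ε) * cutArea (fun i => (s i ω).toReal) T (m + 1) + K -
          lam * min (T : ℝ) (epoch (fun n => τ n ω) m) := by
      filter_upwards [ae_isFeasiblePath hτ hs, sum_policyGain_ae hτ hs H lam hT m, hT']
        with ω hω hsum hω0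
      rw [hsum]
      set T' := min (T : ℝ) (epoch (fun n => τ n ω) m) with hT'def
      have h1 := hω.2.1.cutArea_mono (min_le_left (T : ℝ) (epoch (fun n => τ n ω) m)) (m + 1)
      rw [← hT'def] at h1
      have hnn := IsFeasiblePath.cutArea_nonneg (fun i => (s i ω).toReal) T' (m + 1)
      have hpos : 0 < 1 / (2 * ε) := by positivity
      have h2 := hω.2.1.sum_cutValue_le hH hω0 hC (m + 1)
      have h3 : ∑ i ∈ Finset.range (m + 1), cutValue B lam H (fun n => τ n ω)
          (fun i => (s i ω).toReal) T' i ≤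
          ε * cutArea (fun i => (s i ω).toReal) T' (m + 1) + K := by
        rcases le_or_gt (s (m + 1) ω).toReal T' with h4 | h4
        · have h5 := h2.1 h4
          have h6 := hC (pathEnergy B (fun n => τ n ω) (fun i => (s i ω).toReal) (m + 1))
            ((pathEnergy_le _ _ _ _).trans (Nat.sub_le _ _)) 0 le_rfl
          have h7 := le_abs_self C
          have h8 : 0 ≤ ε * cutArea (fun i => (s i ω).toReal) T' (m + 1) :=
            mul_nonneg hε.le hnn
          simp only [ne_eq, OfNat.ofNat_ne_zero, not_false_eq_true, zero_pow, zero_div,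
            mul_zero, sub_zero, zero_add, add_zero] at h6
          linarith
        · obtain ⟨a, ha, ha2, h5⟩ := h2.2 h4
          have h7 := le_abs_self C
          -- Young's inequality for the current age `a`
          have h8 : a ≤ ε * (a ^ 2 / 2) + 1 / (2 * ε) := by
            have h9 : ε * (a ^ 2 / 2) + 1 / (2 * ε) - a = (ε * a - 1) ^ 2 / (2 * ε) := by
              field_simp
              ring
            have : 0 ≤ (ε * a - 1) ^ 2 / (2 * ε) := by positivity
            linarith
          have h10 := mul_le_mul_of_nonneg_left ha2 hε.le
          linarith
      have h9 := mul_le_mul_of_nonneg_left h1 (show 0 ≤ 1 + ε by linarith)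
      linarith
    have hint := integral_mono_ae (integrable_sum_policyGain hτ hs hH hT m)
      (((hA.const_mul (1 + ε)).add (integrable_const K)).sub
        ((integrable_min_epoch hτ hT m).const_mul lam)) hle
    rw [integral_sub' ((hA.const_mul (1 + ε)).add (integrable_const K))
        ((integrable_min_epoch hτ hT m).const_mul lam),
      integral_add' (hA.const_mul (1 + ε)) (integrable_const K), integral_const_mul,
      integral_const_mul] at hint
    simp only [integral_const, probReal_univ, one_smul] at hint
    have := mul_le_mul_of_nonneg_left hA2 (show 0 ≤ 1 + ε by linarith)
    linarith
  have hlim := (tendsto_integral_min_epoch hτ hT).const_mul lam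
  have hfin := le_of_tendsto' hlim hbound
  rw [← ENNReal.ofReal_toReal htop, ← hρ, ← ENNReal.ofReal_mul (by linarith)]
  exact ENNReal.ofReal_le_ofReal (by linarith)

/-- No policy has an average age below the solution `lam` of the optimality equation. -/
theorem le_averageAge (hτ : IsPoissonRecharge P τ) (hH : IsRelativeValue B lam θ H)
    (hs : IsOnlinePolicy P B τ hτ.measurable s) : ENNReal.ofReal lam ≤ averageAge P s := by
  have key : ∀ ε : ℝ, 0 < ε → ENNReal.ofReal lam ≤ ENNReal.ofReal (1 + ε) * averageAge P s := by
    intro ε hε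
    obtain ⟨C, hC⟩ := le_lintegral_ageArea hτ hH hε
    have h1 : Tendsto (fun T : ℝ≥0 => ENNReal.ofReal (lam - C / T)) atTop
        (nhds (ENNReal.ofReal (lam - 0))) := by
      refine (ENNReal.continuous_ofReal.tendsto _).comp (tendsto_const_nhds.sub ?_)
      exact tendsto_const_nhds.div_atTop (NNReal.tendsto_coe_atTop.2 tendsto_id)
    rw [sub_zero] at h1
    rw [averageAge, ← ENNReal.limsup_const_mul_of_ne_top ENNReal.ofReal_ne_top, ← h1.limsup_eq]
    refine limsup_le_limsup ?_
    filter_upwards [eventually_gt_atTop 0] with T hT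
    have hT' : (0 : ℝ) < T := hT
    have h2 := ENNReal.div_le_div_right (hC s hs T) T
    have h3 : ENNReal.ofReal (lam - C / T) = ENNReal.ofReal (lam * T - C) / (T : ℝ≥0∞) := by
      rw [← ENNReal.ofReal_coe_nnreal, ← ENNReal.ofReal_div_of_pos hT']
      congr 1
      field_simp
    rw [h3, ← mul_div_assoc]
    exact h2
  have hlim : Tendsto (fun ε : ℝ => ENNReal.ofReal (1 + ε) * averageAge P s)
      (nhdsWithin 0 (Set.Ioi 0)) (nhds (ENNReal.ofReal (1 + 0) * averageAge P s)) := by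
    refine ENNReal.Tendsto.mul_const ?_ (Or.inl (by simp))
    refine (ENNReal.continuous_ofReal.tendsto _).comp ?_
    have : Continuous fun ε : ℝ => 1 + ε := by fun_prop
    exact (this.tendsto 0).mono_left nhdsWithin_le_nhds
  have := ge_of_tendsto hlim (by filter_upwards [self_mem_nhdsWithin] with ε hε using key ε hε)
  simpa using this

/-- A policy that uses the thresholds of the optimality equation attains the lower bound. -/
theorem averageAge_le (hτ : IsPoissonRecharge P τ) (hH : IsRelativeValue B lam θ H)
    (hs : IsOnlinePolicy P B τ hτ.measurable s)
    (hth : ∀ᵐ ω ∂P, IsThresholdPath B θ (fun m => τ m ω) fun j => (s j ω).toReal)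
    (hupd : ∀ᵐ ω ∂P, ∀ i, θ (pathLevel B (fun m => τ m ω) (fun j => (s j ω).toReal) i
      (s (i + 1) ω).toReal) ≤ (s (i + 1) ω).toReal - (s i ω).toReal) :
    averageAge P s ≤ ENNReal.ofReal lam := by
  obtain ⟨C, hC⟩ := hH.lower
  set K := |C| + H 0 0 with hK
  have hbound : ∀ (T : ℝ≥0), ∫⁻ ω, ageArea s T ω ∂P ≤ ENNReal.ofReal (lam * T + K) := by
    intro T
    have hT : (0 : ℝ) ≤ T := T.coe_nonneg
    have hm : ∀ m, ∫⁻ ω, ENNReal.ofReal (cutArea (fun i => (s i ω).toReal)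
        (min T (epoch (fun n => τ n ω) m)) (m + 1)) ∂P ≤ ENNReal.ofReal (lam * T + K) := by
      intro m
      have hT' : ∀ᵐ ω ∂P, 0 ≤ min (T : ℝ) (epoch (fun n => τ n ω) m) := by
        filter_upwards [hτ.ae_regular] with ω hω using le_min hT (hω.epoch_nonneg m)
      have hA := integrable_cutArea hτ hs
        ((measurable_const (a := (T : ℝ))).min (measurable_epoch hτ m)) hT'
        (fun _ => min_le_left _ _) (m + 1)
      rw [← ofReal_integral_eq_lintegral_ofReal hA
        (ae_of_all _ fun ω => IsFeasiblePath.cutArea_nonneg _ _ _)]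
      refine ENNReal.ofReal_le_ofReal ?_
      have h0 : ∫ ω, ∑ i ∈ Finset.range (m + 1), ∑ n ∈ Finset.range m,
          policyGain B H τ s T i n ω ∂P = 0 := by
        rw [integral_sum_policyGain hτ hs hH hT]
        exact Finset.sum_eq_zero fun i _ => Finset.sum_eq_zero fun n _ =>
          (integral_policyGain hτ hs hH hT i n).2.2 hth
      have hle : ∀ᵐ ω ∂P, cutArea (fun i => (s i ω).toReal)
          (min (T : ℝ) (epoch (fun n => τ n ω) m)) (m + 1) - (lam * T + K) ≤
            ∑ i ∈ Finset.range (m + 1), ∑ n ∈ Finset.range m, policyGain B H τ s T i n ω := by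
        filter_upwards [ae_isFeasiblePath hτ hs, sum_policyGain_ae hτ hs H lam hT m, hT', hupd]
          with ω hω hsum hω0 hωu
        rw [hsum]
        have h2 := hω.2.1.le_sum_cutValue hH hω0 hC hωu (m + 1)
        have h3 := le_abs_self C
        have h4 := mul_le_mul_of_nonneg_left
          (min_le_left (T : ℝ) (epoch (fun n => τ n ω) m)) hH.lam_pos.le
        have h5 : -|C| - H 0 0 ≤ ∑ i ∈ Finset.range (m + 1), cutValue B lam H (fun n => τ n ω)
            (fun i => (s i ω).toReal) (min (T : ℝ) (epoch (fun n => τ n ω) m)) i := by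
          rcases le_or_gt (s (m + 1) ω).toReal (min (T : ℝ) (epoch (fun n => τ n ω) m))
            with h6 | h6
          · have h7 := h2.1 h6
            have h8 := hC (pathEnergy B (fun n => τ n ω) (fun i => (s i ω).toReal) (m + 1))
              ((pathEnergy_le _ _ _ _).trans (Nat.sub_le _ _)) 0 le_rfl
            simp only [ne_eq, OfNat.ofNat_ne_zero, not_false_eq_true, zero_pow, zero_div,
              mul_zero, sub_zero, zero_sub] at h8
            linarith
          · have h7 := h2.2 h6
            linarith
        linarith
      have hint := integral_mono_ae (hA.sub (integrable_const (lam * T + K)))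
        (integrable_sum_policyGain hτ hs hH hT m) hle
      rw [h0, integral_sub' hA (integrable_const _)] at hint
      simp only [integral_const, probReal_univ, one_smul] at hint
      linarith
    rw [lintegral_ageArea_eq hτ hs]
    have hfatou := lintegral_liminf_le (μ := P) (u := atTop) (f := fun m ω => ENNReal.ofReal
      (cutArea (fun i => (s i ω).toReal) (min T (epoch (fun n => τ n ω) m)) (m + 1)))
      fun m => (measurable_cutArea hs.measurable
        ((measurable_const (a := (T : ℝ))).min (measurable_epoch hτ m)) (m + 1)).ennreal_ofReal
    refine le_trans (le_trans (lintegral_mono_ae ?_) hfatou) ?_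
    · filter_upwards [hτ.ae_regular] with ω hω
      refine le_of_eq (Tendsto.liminf_eq ?_).symm
      have h1 := (tendsto_add_atTop_iff_nat 1).2 (ENNReal.tendsto_nat_tsum fun i =>
        ENNReal.ofReal (cutLength (fun i => (s i ω).toReal) T i ^ 2 / 2))
      refine h1.congr' ?_
      filter_upwards [(epoch_tendsto hω).eventually_ge_atTop (T : ℝ)] with m hm'
      rw [min_eq_left hm', ofReal_cutArea]
    · refine (liminf_le_liminf (Eventually.of_forall hm)).trans ?_
      simp
  have h1 : Tendsto (fun T : ℝ≥0 => ENNReal.ofReal (lam + K / T)) atTop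
      (nhds (ENNReal.ofReal (lam + 0))) := by
    refine (ENNReal.continuous_ofReal.tendsto _).comp (tendsto_const_nhds.add ?_)
    exact tendsto_const_nhds.div_atTop (NNReal.tendsto_coe_atTop.2 tendsto_id)
  rw [add_zero] at h1
  rw [averageAge, ← h1.limsup_eq]
  refine limsup_le_limsup ?_
  filter_upwards [eventually_gt_atTop 0] with T hT
  have hT' : (0 : ℝ) < T := hT
  refine (ENNReal.div_le_div_right (hbound T) T).trans ?_
  rw [← ENNReal.ofReal_coe_nnreal, ← ENNReal.ofReal_div_of_pos hT']
  refine ENNReal.ofReal_le_ofReal (le_of_eq ?_)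
  field_simp

end AverageAge

/-! ### Restarted arrival paths -/

/-- The inter-arrival times after time `c`, the first one being counted from `c` on. -/
noncomputable def restart (y : ℕ → ℝ) (c : ℝ) (m : ℕ) : ℝ :=
  if m = 0 then pathTime y (pathCount y c) - c else y (pathCount y c + m)

lemma pathTime_restart (y : ℕ → ℝ) (c : ℝ) (m : ℕ) :
    pathTime (restart y c) m = pathTime y (pathCount y c + m) - c := by
  induction m with
  | zero => simp [pathTime_zero, restart]
  | succ m ih =>
    rw [pathTime_succ, ih, ← add_assoc, pathTime_succ, restart, if_neg (Nat.succ_ne_zero m)]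
    rw [add_assoc]
    ring

namespace IsRegularPath

variable {y : ℕ → ℝ}

lemma restart (hy : IsRegularPath y) (c : ℝ) : IsRegularPath (restart y c) := by
  refine ⟨fun n => ?_, ?_⟩
  · unfold BatteryAge.restart
    split_ifs with h
    · exact sub_pos.2 (hy.pathCount_le_iff.1 le_rfl)
    · exact hy.pos _
  · have h : BatteryAge.pathTime (BatteryAge.restart y c) =
        fun m => pathTime y (m + pathCount y c) - c := by
      funext m
      rw [pathTime_restart, add_comm]
    rw [h]
    exact tendsto_atTop_add_const_right _ _
      ((tendsto_add_atTop_iff_nat (pathCount y c)).2 hy.tendsto)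

lemma pathCount_restart (hy : IsRegularPath y) {a b : ℝ} (hb : 0 ≤ b) :
    pathCount y a + pathCount (BatteryAge.restart y a) b = pathCount y (a + b) := by
  refine eq_of_forall_ge_iff fun n => ?_
  rw [hy.pathCount_le_iff]
  constructor
  · intro h
    obtain ⟨m, rfl⟩ := Nat.exists_eq_add_of_le (le_of_add_le_left h)
    have := (hy.restart a).pathCount_le_iff.1 (Nat.le_of_add_le_add_left h)
    rw [pathTime_restart] at this
    linarith
  · intro h
    have h1 : pathCount y a ≤ n := hy.pathCount_le_iff.2 (by linarith)
    obtain ⟨m, rfl⟩ := Nat.exists_eq_add_of_le h1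
    refine Nat.add_le_add_left ((hy.restart a).pathCount_le_iff.2 ?_) _
    rw [pathTime_restart]
    linarith

lemma restart_restart (hy : IsRegularPath y) {a b : ℝ} (hb : 0 ≤ b) :
    BatteryAge.restart (BatteryAge.restart y a) b = BatteryAge.restart y (a + b) := by
  funext m
  have h := hy.pathCount_restart (a := a) hb
  cases m with
  | zero =>
    simp only [BatteryAge.restart, if_true]
    rw [pathTime_restart]
    change pathTime y (pathCount y a + pathCount (BatteryAge.restart y a) b) - a - b = _
    rw [h]
    ring
  | succ m =>
    have e1 : BatteryAge.restart (BatteryAge.restart y a) b (m + 1) =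
        BatteryAge.restart y a (pathCount (BatteryAge.restart y a) b + (m + 1)) := by
      rw [BatteryAge.restart, if_neg (Nat.succ_ne_zero m)]
    have e2 : BatteryAge.restart y a (pathCount (BatteryAge.restart y a) b + (m + 1)) =
        y (pathCount y a + (pathCount (BatteryAge.restart y a) b + (m + 1))) := by
      rw [BatteryAge.restart, if_neg (by omega)]
    rw [e1, e2, ← add_assoc, h, BatteryAge.restart, if_neg (Nat.succ_ne_zero m)]

lemma restart_zero (hy : IsRegularPath y) : BatteryAge.restart y 0 = y := by
  funext m
  simp [BatteryAge.restart, hy.pathCount_zero, pathTime_zero]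
  rintro rfl
  rfl

end IsRegularPath

/-! ### The threshold policy -/

/-- The waiting time of the threshold policy for the next update, when `e` units of energy are
left and the `m`-th of the next arrivals occurs after the time `g m`. -/
noncomputable def waitTime (B : ℕ) (θ : ℕ → ℝ) (g : ℕ → ℝ≥0∞) (e : ℕ) : ℝ≥0∞ :=
  (Finset.Icc 1 B).inf fun k => max (ENNReal.ofReal (θ k)) (if k ≤ e then 0 else g (k - e - 1))

/-- The latest of the first `n + 1` arrivals; it equals the last of them almost surely, and it is
monotone in `n` everywhere. -/
noncomputable def arrivalSup {Ω : Type*} (τ : ℕ → Ω → ℝ) (n : ℕ) (ω : Ω) : ℝ≥0∞ :=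
  (Finset.range (n + 1)).sup fun j => ENNReal.ofReal (arrivalTime τ j ω)

/-- The time of the `i`-th update of the threshold policy, the number of arrivals up to then, and
the energy left. The definition through `arrivalSup` makes the update times stopping times, and not
just almost surely equal to stopping times. -/
noncomputable def thresholdState {Ω : Type*} (B : ℕ) (θ : ℕ → ℝ) (τ : ℕ → Ω → ℝ) :
    ℕ → Ω → ℝ≥0∞ × ℕ × ℕ
  | 0, _ => (0, 0, 0)
  | i + 1, ω =>
    let q := thresholdState B θ τ i ω
    let s' := q.1 + waitTime B θ (fun m => arrivalSup τ (q.2.1 + m) ω - q.1) q.2.2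
    let n' := sInf {n | s' < arrivalSup τ n ω}
    (s', n', min (q.2.2 + (n' - q.2.1)) B - 1)

/-- The policy that updates as soon as the age reaches the threshold of the energy level. -/
noncomputable def thresholdPolicy {Ω : Type*} (B : ℕ) (θ : ℕ → ℝ) (τ : ℕ → Ω → ℝ) (i : ℕ) (ω : Ω) :
    ℝ≥0∞ := (thresholdState B θ τ i ω).1

lemma waitTime_le_iff {B : ℕ} (hB : 1 ≤ B) (θ : ℕ → ℝ) (g : ℕ → ℝ≥0∞) (e : ℕ) (s t : ℝ≥0∞) :
    s + waitTime B θ g e ≤ t ↔ ∃ k ∈ Finset.Icc 1 B, s + ENNReal.ofReal (θ k) ≤ t ∧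
      s + (if k ≤ e then 0 else g (k - e - 1)) ≤ t := by
  have hadd : ∀ a b, s + max a b ≤ t ↔ s + a ≤ t ∧ s + b ≤ t := by
    intro a b
    rw [← max_le_iff, max_add_add_left]
  constructor
  · intro h
    obtain ⟨k, hk, he⟩ := Finset.exists_mem_eq_inf (Finset.Icc 1 B) ⟨1, by simp [hB]⟩
      fun k => max (ENNReal.ofReal (θ k)) (if k ≤ e then 0 else g (k - e - 1))
    refine ⟨k, hk, (hadd _ _).1 ?_⟩
    rw [← he]
    exact h
  · rintro ⟨k, hk, h⟩
    exact le_trans (add_le_add_right (Finset.inf_le hk) _) ((hadd _ _).2 h)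

lemma measurable_sInf_nat {α : Type*} [MeasurableSpace α] {p : ℕ → α → Prop}
    (hp : ∀ n, MeasurableSet {a | p n a}) : Measurable fun a => sInf {n | p n a} := by
  refine measurable_to_countable' fun m => ?_
  have hset : (fun a => sInf {n | p n a}) ⁻¹' {m} =
      ({a | p m a} ∩ ⋂ j ∈ Finset.range m, {a | p j a}ᶜ) ∪
        ({_a | m = 0} ∩ ⋂ j, {a | p j a}ᶜ) := by
    ext a
    simp only [Set.mem_preimage, Set.mem_singleton_iff, Set.mem_union, Set.mem_inter_iff,
      Set.mem_compl_iff, Set.mem_ofPred_eq, Set.mem_iInter, Finset.mem_range]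
    constructor
    · rintro rfl
      by_cases hne : {n | p n a}.Nonempty
      · exact Or.inl ⟨Nat.sInf_mem hne, fun j hj => Nat.notMem_of_lt_sInf hj⟩
      · rw [Set.not_nonempty_iff_eq_empty] at hne
        exact Or.inr ⟨by rw [hne, Nat.sInf_empty], fun j hj => (Set.ext_iff.1 hne j).1 hj⟩
    · rintro (⟨h2, h3⟩ | ⟨rfl, h3⟩)
      · refine le_antisymm (Nat.sInf_le h2) (le_csInf ⟨m, h2⟩ fun j hj => ?_)
        by_contra! hjm
        exact h3 j hjm hj
      · rw [Set.eq_empty_of_forall_notMem (s := {n | p n a}) h3, Nat.sInf_empty]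
  rw [hset]
  exact ((hp m).inter (Finset.measurableSet_biInter _ fun j _ => (hp j).compl)).union
    ((MeasurableSet.const _).inter (MeasurableSet.iInter fun j => (hp j).compl))

section Causality

variable {Ω : Type*} [MeasurableSpace Ω] {B : ℕ} {θ : ℕ → ℝ} {τ : ℕ → Ω → ℝ}

lemma isStoppingTime_arrivalSup (hτ : ∀ n, Measurable (τ n)) (n : ℕ) :
    IsStoppingTime (arrivalFiltration τ hτ) (arrivalSup τ n) := by
  intro t
  have : {ω | arrivalSup τ n ω ≤ (t : ℝ≥0∞)} =
      ⋂ j ∈ Finset.range (n + 1), {ω | arrivalTime τ j ω ≤ t} := by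
    ext ω
    simp [arrivalSup, Finset.sup_le_iff]
  change MeasurableSet[arrivalFiltration τ hτ t] {ω | arrivalSup τ n ω ≤ (t : ℝ≥0∞)}
  rw [this]
  refine Finset.measurableSet_biInter _ fun j _ => ?_
  exact MeasurableSpace.measurableSet_generateFrom ⟨j, t, le_rfl, rfl⟩

lemma isStoppingTime_add_const {f : Filtration ℝ≥0 ‹MeasurableSpace Ω›} {s : Ω → ℝ≥0∞}
    (hs : IsStoppingTime f s) (c : ℝ≥0) :
    IsStoppingTime f fun ω => (s ω + (c : ℝ≥0∞) : ℝ≥0∞) := by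
  intro t
  change MeasurableSet[f t] {ω | s ω + c ≤ (t : ℝ≥0∞)}
  by_cases h : c ≤ t
  · have : {ω | s ω + c ≤ (t : ℝ≥0∞)} = {ω | s ω ≤ ((t - c : ℝ≥0) : ℝ≥0∞)} := by
      ext ω
      simp only [Set.mem_ofPred_eq, ENNReal.coe_sub]
      exact (ENNReal.cancel_coe.le_tsub_iff_right (by exact_mod_cast h)).symm
    rw [this]
    exact f.mono tsub_le_self _ (hs.measurableSet_le (t - c))
  · have : {ω | s ω + c ≤ (t : ℝ≥0∞)} = ∅ := by
      ext ω
      simp only [Set.mem_ofPred_eq, Set.mem_empty_iff_false, iff_false, not_le]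
      exact lt_of_lt_of_le (by exact_mod_cast not_le.1 h) le_add_self
    rw [this]
    exact @MeasurableSet.empty _ (f t)

/-- The threshold policy is causal, and so are its count of the arrivals and its energy. -/
lemma isStoppingTime_thresholdPolicy (hB : 1 ≤ B) (hτ : ∀ n, Measurable (τ n)) (i : ℕ) :
    ∃ h : IsStoppingTime (arrivalFiltration τ hτ) (thresholdPolicy B θ τ i),
      Measurable[h.measurableSpace] fun ω => (thresholdState B θ τ i ω).2 := by
  induction i with
  | zero =>
    refine ⟨isStoppingTime_const _ 0, ?_⟩
    exact measurable_const
  | succ i ih =>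
    obtain ⟨hs, hm⟩ := ih
    have hs' : IsStoppingTime (arrivalFiltration τ hτ) (thresholdPolicy B θ τ (i + 1)) := by
      intro t
      have hset : {ω | thresholdPolicy B θ τ (i + 1) ω ≤ (t : ℝ≥0∞)} =
          ⋃ q : ℕ × ℕ, ⋃ k ∈ Finset.Icc 1 B,
            ((fun ω => (thresholdState B θ τ i ω).2) ⁻¹' {q} ∩
              {ω | thresholdPolicy B θ τ i ω ≤ (t : ℝ≥0∞)}) ∩
            {ω | thresholdPolicy B θ τ i ω + ENNReal.ofReal (θ k) ≤ (t : ℝ≥0∞)} ∩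
            {ω | thresholdPolicy B θ τ i ω + (if k ≤ q.2 then 0 else
              arrivalSup τ (q.1 + (k - q.2 - 1)) ω - thresholdPolicy B θ τ i ω) ≤
                (t : ℝ≥0∞)} := by
        ext ω
        have h1 : thresholdPolicy B θ τ (i + 1) ω = thresholdPolicy B θ τ i ω +
          waitTime B θ (fun m => arrivalSup τ ((thresholdState B θ τ i ω).2.1 + m) ω -
            thresholdPolicy B θ τ i ω) (thresholdState B θ τ i ω).2.2 := rfl
        simp only [Set.mem_ofPred_eq, h1, waitTime_le_iff hB, Set.mem_iUnion, Set.mem_inter_iff,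
          Set.mem_preimage, Set.mem_singleton_iff, exists_prop]
        constructor
        · rintro ⟨k, hk, h2, h3⟩
          exact ⟨_, k, hk, ⟨⟨rfl, le_trans le_self_add h2⟩, h2⟩, h3⟩
        · rintro ⟨q, k, hk, ⟨⟨rfl, -⟩, h2⟩, h3⟩
          exact ⟨k, hk, h2, h3⟩
      change MeasurableSet[arrivalFiltration τ hτ t]
        {ω | thresholdPolicy B θ τ (i + 1) ω ≤ (t : ℝ≥0∞)}
      rw [hset]
      refine MeasurableSet.iUnion fun q => Finset.measurableSet_biUnion _ fun k _ => ?_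
      refine (MeasurableSet.inter ?_ ?_).inter ?_
      · exact (hm (measurableSet_singleton q)).2 t
      · exact isStoppingTime_add_const hs (θ k).toNNReal t
      · split_ifs
        · simp only [add_zero]
          exact hs t
        · simp only [add_tsub_eq_max]
          exact (hs.max (isStoppingTime_arrivalSup hτ _)) t
    refine ⟨hs', ?_⟩
    have hle : hs.measurableSpace ≤ hs'.measurableSpace :=
      hs.measurableSpace_mono hs' fun ω =>
        (le_self_add : thresholdPolicy B θ τ i ω ≤ thresholdPolicy B θ τ i ω + _)
    have hlt : ∀ n, MeasurableSet[hs'.measurableSpace]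
        {ω | arrivalSup τ n ω ≤ thresholdPolicy B θ τ (i + 1) ω} := fun n =>
      (isStoppingTime_arrivalSup hτ n).measurableSet_stopping_time_le hs'
    have hn : Measurable[hs'.measurableSpace] fun ω => (thresholdState B θ τ (i + 1) ω).2.1 := by
      refine @measurable_sInf_nat _ (_) _ fun n => ?_
      have h := (hlt n).compl
      simp only [Set.compl_ofPred, not_le] at h
      exact h
    have hq := hm.mono hle le_rfl
    have hall : Measurable[hs'.measurableSpace] fun ω =>
        ((thresholdState B θ τ (i + 1) ω).2.1, (thresholdState B θ τ i ω).2) :=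
      @Measurable.prodMk _ _ _ _ _ (_) _ _ hn hq
    exact (measurable_of_countable fun r : ℕ × ℕ × ℕ =>
      (r.1, min (r.2.2 + (r.1 - r.2.1)) B - 1)).comp hall

end Causality

/-! ### The threshold policy along a path -/

/-- The age at the next update of the threshold policy, in terms of the energy left and the
inter-arrival times from now on. -/
noncomputable def wait (B : ℕ) (θ : ℕ → ℝ) (q : ℕ × (ℕ → ℝ)) : ℝ :=
  (waitTime B θ (fun m => ENNReal.ofReal (pathTime q.2 m)) q.1).toReal

/-- The passage from one update of the threshold policy to the next one: the energy left, and the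
inter-arrival times from now on. -/
noncomputable def step (B : ℕ) (θ : ℕ → ℝ) (q : ℕ × (ℕ → ℝ)) : ℕ × (ℕ → ℝ) :=
  (min (q.1 + pathCount q.2 (wait B θ q)) B - 1, restart q.2 (wait B θ q))

/-- The time of the `i`-th update of the threshold policy. -/
noncomputable def stepTime (B : ℕ) (θ : ℕ → ℝ) (q : ℕ × (ℕ → ℝ)) (i : ℕ) : ℝ :=
  ∑ j ∈ Finset.range i, wait B θ ((step B θ)^[j] q)

section Wait

variable {B : ℕ} {θ : ℕ → ℝ} {e : ℕ} {z : ℕ → ℝ}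

lemma waitTime_ofReal (B : ℕ) (θ : ℕ → ℝ) (e : ℕ) (z : ℕ → ℝ) :
    waitTime B θ (fun m => ENNReal.ofReal (pathTime z m)) e = (Finset.Icc 1 B).inf fun k =>
      ENNReal.ofReal (max (θ k) (if k ≤ e then 0 else pathTime z (k - e - 1))) := by
  refine Finset.inf_congr rfl fun k _ => ?_
  rw [ENNReal.ofReal_max]
  congr 1
  split_ifs <;> simp

lemma waitTime_ne_top (hB : 1 ≤ B) (θ : ℕ → ℝ) (e : ℕ) (z : ℕ → ℝ) :
    waitTime B θ (fun m => ENNReal.ofReal (pathTime z m)) e ≠ ∞ := by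
  rw [waitTime_ofReal]
  exact ((Finset.inf_le (Finset.mem_Icc.2 ⟨le_rfl, hB⟩)).trans_lt ENNReal.ofReal_lt_top).ne

lemma exists_wait_eq (hB : 1 ≤ B) (hθ : ∀ k, 1 ≤ k → k ≤ B → 0 ≤ θ k) (e : ℕ) (z : ℕ → ℝ) :
    ∃ k, 1 ≤ k ∧ k ≤ B ∧
      wait B θ (e, z) = max (θ k) (if k ≤ e then 0 else pathTime z (k - e - 1)) := by
  obtain ⟨k, hk, he⟩ := Finset.exists_mem_eq_inf (Finset.Icc 1 B) ⟨1, by simp [hB]⟩ fun k =>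
    ENNReal.ofReal (max (θ k) (if k ≤ e then 0 else pathTime z (k - e - 1)))
  obtain ⟨h1, h2⟩ := Finset.mem_Icc.1 hk
  refine ⟨k, h1, h2, ?_⟩
  rw [wait, waitTime_ofReal, he, ENNReal.toReal_ofReal]
  exact le_max_of_le_left (hθ k h1 h2)

lemma wait_le (hθ : ∀ k, 1 ≤ k → k ≤ B → 0 ≤ θ k) {k : ℕ} (h1 : 1 ≤ k) (h2 : k ≤ B) (e : ℕ)
    (z : ℕ → ℝ) :
    wait B θ (e, z) ≤ max (θ k) (if k ≤ e then 0 else pathTime z (k - e - 1)) := by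
  rw [wait, waitTime_ofReal]
  exact ENNReal.toReal_le_of_le_ofReal (le_max_of_le_left (hθ k h1 h2))
    (Finset.inf_le (Finset.mem_Icc.2 ⟨h1, h2⟩))

lemma le_wait (hB : 1 ≤ B) {lam : ℝ} (hlam : 0 ≤ lam) (hθ : ∀ k, 1 ≤ k → k ≤ B → lam ≤ θ k)
    (q : ℕ × (ℕ → ℝ)) : lam ≤ wait B θ q := by
  obtain ⟨k, h1, h2, h⟩ := exists_wait_eq hB (fun k h1 h2 => hlam.trans (hθ k h1 h2)) q.1 q.2
  exact (hθ k h1 h2).trans (h ▸ le_max_left _ _)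

/-- The first threshold bounds the waiting time as soon as a unit of energy is available. -/
lemma wait_le_max (hB : 1 ≤ B) (hθ : ∀ k, 1 ≤ k → k ≤ B → 0 ≤ θ k) (hz : IsRegularPath z) (e : ℕ) :
    wait B θ (e, z) ≤ max (θ 1) (z 0) := by
  refine (wait_le hθ le_rfl hB e z).trans (max_le_max le_rfl ?_)
  split_ifs with h
  · exact (hz.pos 0).le
  · rw [show 1 - e - 1 = 0 by omega, pathTime_zero]

/-- At the update, the energy has a level whose threshold has been reached. -/
lemma threshold_le_wait (hB : 1 ≤ B) (hθ : ∀ k, 1 ≤ k → k ≤ B → 0 ≤ θ k)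
    (hanti : ∀ k l, 1 ≤ k → k ≤ l → l ≤ B → θ l ≤ θ k) (hz : IsRegularPath z) (e : ℕ) :
    1 ≤ min (e + pathCount z (wait B θ (e, z))) B ∧
      θ (min (e + pathCount z (wait B θ (e, z))) B) ≤ wait B θ (e, z) := by
  obtain ⟨k, h1, h2, h⟩ := exists_wait_eq hB hθ e z
  have hk : k ≤ e + pathCount z (wait B θ (e, z)) := by
    by_cases hke : k ≤ e
    · omega
    · rw [if_neg hke] at h
      have := hz.lt_pathCount_iff.2 (h ▸ le_max_right _ _ : pathTime z (k - e - 1) ≤ _)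
      omega
  exact ⟨h1.trans (le_min hk h2), (hanti k _ h1 (le_min hk h2) (min_le_right _ _)).trans
    (h ▸ le_max_left _ _)⟩

/-- Before the update, the age is below the threshold of the energy level. -/
lemma le_threshold_of_lt_wait (hθ : ∀ k, 1 ≤ k → k ≤ B → 0 ≤ θ k) (hz : IsRegularPath z) {e : ℕ}
    {c : ℝ} (hc0 : 0 ≤ c) (hc : c < wait B θ (e, z)) (hl : min (e + pathCount z c) B ≠ 0) :
    c ≤ θ (min (e + pathCount z c) B) := by
  set k := min (e + pathCount z c) B with hk
  have h := wait_le hθ (k := k) (by omega) (by omega) e z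
  by_contra! hlt
  refine absurd (hc.trans_le h) (not_lt.2 (max_le hlt.le ?_))
  split_ifs with hke
  · exact hc0
  · exact hz.lt_pathCount_iff.1 (by omega)

end Wait

section Path

variable {B : ℕ} {θ : ℕ → ℝ} {y : ℕ → ℝ}

lemma stepTime_zero (q : ℕ × (ℕ → ℝ)) : stepTime B θ q 0 = 0 := by simp [stepTime]

lemma stepTime_succ (q : ℕ × (ℕ → ℝ)) (i : ℕ) :
    stepTime B θ q (i + 1) = stepTime B θ q i + wait B θ ((step B θ)^[i] q) :=
  Finset.sum_range_succ _ _

lemma stepTime_add (q : ℕ × (ℕ → ℝ)) (i j : ℕ) :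
    stepTime B θ q (i + j) = stepTime B θ q i + stepTime B θ ((step B θ)^[i] q) j := by
  rw [stepTime, Finset.sum_range_add]
  congr 1
  refine Finset.sum_congr rfl fun m _ => ?_
  rw [add_comm, Function.iterate_add_apply]

lemma wait_nonneg (q : ℕ × (ℕ → ℝ)) : 0 ≤ wait B θ q := ENNReal.toReal_nonneg

lemma stepTime_mono (q : ℕ × (ℕ → ℝ)) : Monotone (stepTime B θ q) :=
  monotone_nat_of_le_succ fun i => by
    rw [stepTime_succ]
    exact le_add_of_nonneg_right (wait_nonneg _)

lemma stepTime_nonneg (q : ℕ × (ℕ → ℝ)) (i : ℕ) : 0 ≤ stepTime B θ q i :=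
  Finset.sum_nonneg fun _ _ => wait_nonneg _

lemma iterate_step_snd (hy : IsRegularPath y) (e i : ℕ) :
    ((step B θ)^[i] (e, y)).2 = restart y (stepTime B θ (e, y) i) := by
  induction i with
  | zero => simp [stepTime_zero, hy.restart_zero]
  | succ i ih =>
    rw [Function.iterate_succ_apply', step, stepTime_succ]
    simp only
    rw [ih, hy.restart_restart (wait_nonneg _)]

lemma iterate_step_fst (hy : IsRegularPath y) (i : ℕ) :
    ((step B θ)^[i] (0, y)).1 = pathEnergy B y (stepTime B θ (0, y)) i := by
  induction i with
  | zero => rfl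
  | succ i ih =>
    have h := hy.pathCount_restart (a := stepTime B θ (0, y) i)
      (wait_nonneg (B := B) (θ := θ) ((step B θ)^[i] (0, y)))
    rw [Function.iterate_succ_apply', step, pathEnergy]
    simp only
    rw [iterate_step_snd hy, ih, stepTime_succ, ← h, Nat.add_sub_cancel_left]

lemma pathLevel_stepTime (hy : IsRegularPath y) (i : ℕ) {c : ℝ} (hc : 0 ≤ c) :
    pathLevel B y (stepTime B θ (0, y)) i (stepTime B θ (0, y) i + c) =
      min (((step B θ)^[i] (0, y)).1 + pathCount ((step B θ)^[i] (0, y)).2 c) B := by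
  rw [pathLevel, iterate_step_fst hy, iterate_step_snd hy, ← hy.pathCount_restart hc,
    Nat.add_sub_cancel_left]

lemma isRegularPath_iterate_step (hy : IsRegularPath y) (e i : ℕ) :
    IsRegularPath ((step B θ)^[i] (e, y)).2 := by
  rw [iterate_step_snd hy]
  exact hy.restart _

lemma arrivalSup_eq {Ω : Type*} {τ : ℕ → Ω → ℝ} {ω : Ω} (hy : IsRegularPath fun m => τ m ω)
    (n : ℕ) : arrivalSup τ n ω = ENNReal.ofReal (pathTime (fun m => τ m ω) n) := by
  refine le_antisymm (Finset.sup_le fun j hj => ENNReal.ofReal_le_ofReal ?_) ?_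
  · exact hy.strictMono.monotone (Nat.lt_succ_iff.1 (Finset.mem_range.1 hj))
  · exact Finset.le_sup (f := fun j => ENNReal.ofReal (arrivalTime τ j ω))
      (Finset.self_mem_range_succ n)

lemma thresholdState_eq (hB : 1 ≤ B) {Ω : Type*} {τ : ℕ → Ω → ℝ} {ω : Ω}
    (hy : IsRegularPath fun m => τ m ω) (i : ℕ) :
    thresholdState B θ τ i ω = (ENNReal.ofReal (stepTime B θ (0, fun m => τ m ω) i),
      pathCount (fun m => τ m ω) (stepTime B θ (0, fun m => τ m ω) i),
      ((step B θ)^[i] (0, fun m => τ m ω)).1) := by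
  induction i with
  | zero => simp [thresholdState, stepTime_zero, hy.pathCount_zero]
  | succ i ih =>
    set y : ℕ → ℝ := fun m => τ m ω with hydef
    set S := stepTime B θ (0, y) with hS
    have hS0 := stepTime_nonneg (B := B) (θ := θ) (0, y)
    have hw : (fun m => arrivalSup τ ((pathCount y (S i)) + m) ω - ENNReal.ofReal (S i)) =
        fun m => ENNReal.ofReal (pathTime ((step B θ)^[i] (0, y)).2 m) := by
      funext m
      rw [arrivalSup_eq hy, iterate_step_snd hy, pathTime_restart, ENNReal.ofReal_sub _ (hS0 i)]
    have hnext : ENNReal.ofReal (S i) + waitTime B θ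
        (fun m => arrivalSup τ ((pathCount y (S i)) + m) ω - ENNReal.ofReal (S i))
          ((step B θ)^[i] (0, y)).1 = ENNReal.ofReal (S (i + 1)) := by
      rw [hw, hS, stepTime_succ, ENNReal.ofReal_add (hS0 i) (wait_nonneg _), wait,
        ENNReal.ofReal_toReal (waitTime_ne_top hB _ _ _)]
    have hcount : sInf {n | ENNReal.ofReal (S (i + 1)) < arrivalSup τ n ω} =
        pathCount y (S (i + 1)) := by
      have : {n | ENNReal.ofReal (S (i + 1)) < arrivalSup τ n ω} =
          Set.Ici (pathCount y (S (i + 1))) := by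
        ext n
        rw [Set.mem_ofPred_eq, arrivalSup_eq hy, Set.mem_Ici, hy.pathCount_le_iff,
          ENNReal.ofReal_lt_ofReal_iff (hy.pathTime_pos n)]
      rw [this, csInf_Ici]
    have h := hy.pathCount_restart (a := S i)
      (wait_nonneg (B := B) (θ := θ) ((step B θ)^[i] (0, y)))
    simp only [thresholdState, ih]
    rw [hnext, hcount, Function.iterate_succ_apply', step]
    simp only
    rw [iterate_step_snd hy, hS, stepTime_succ, ← h, Nat.add_sub_cancel_left]

lemma thresholdPolicy_eq (hB : 1 ≤ B) {Ω : Type*} {τ : ℕ → Ω → ℝ} {ω : Ω}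
    (hy : IsRegularPath fun m => τ m ω) (i : ℕ) :
    thresholdPolicy B θ τ i ω = ENNReal.ofReal (stepTime B θ (0, fun m => τ m ω) i) := by
  rw [thresholdPolicy, thresholdState_eq hB hy]

lemma toReal_thresholdPolicy (hB : 1 ≤ B) {Ω : Type*} {τ : ℕ → Ω → ℝ} {ω : Ω}
    (hy : IsRegularPath fun m => τ m ω) (i : ℕ) :
    (thresholdPolicy B θ τ i ω).toReal = stepTime B θ (0, fun m => τ m ω) i := by
  rw [thresholdPolicy_eq hB hy, ENNReal.toReal_ofReal (stepTime_nonneg _ _)]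

lemma energyAfter_thresholdPolicy (hB : 1 ≤ B) {Ω : Type*} {τ : ℕ → Ω → ℝ} {ω : Ω}
    (hy : IsRegularPath fun m => τ m ω) (i : ℕ) :
    energyAfter B τ (thresholdPolicy B θ τ) i ω =
      ((step B θ)^[i] (0, fun m => τ m ω)).1 := by
  rw [iterate_step_fst hy]
  induction i with
  | zero => rfl
  | succ i ih =>
    have hf : ∀ i, thresholdPolicy B θ τ i ω ≠ ∞ := fun i => by
      rw [thresholdPolicy_eq hB hy]; exact ENNReal.ofReal_ne_top
    simp only [energyAfter, pathEnergy, ih, harvested_eq hy (hf _) (hf _),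
      toReal_thresholdPolicy hB hy]

end Path

section Policy

variable {Ω : Type*} [MeasurableSpace Ω] {P : Measure Ω} {B : ℕ}
  {τ : ℕ → Ω → ℝ} {lam : ℝ} {θ : ℕ → ℝ}

lemma isOnlinePolicy_thresholdPolicy (hB : 1 ≤ B) (hτ : IsPoissonRecharge P τ)
    (hθ : ∀ k, 1 ≤ k → k ≤ B → 0 ≤ θ k) (hanti : ∀ k l, 1 ≤ k → k ≤ l → l ≤ B → θ l ≤ θ k) :
    IsOnlinePolicy P B τ hτ.measurable (thresholdPolicy B θ τ) where
  start _ := rfl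
  causal i := (isStoppingTime_thresholdPolicy hB hτ.measurable i).1
  finite := by
    filter_upwards [hτ.ae_regular] with ω hy i
    rw [thresholdPolicy_eq hB hy]
    exact ENNReal.ofReal_lt_top
  ordered := by
    filter_upwards [hτ.ae_regular] with ω hy i
    rw [thresholdPolicy_eq hB hy, thresholdPolicy_eq hB hy]
    exact ENNReal.ofReal_le_ofReal (stepTime_mono _ (Nat.le_add_right i 1))
  energy_causality := by
    filter_upwards [hτ.ae_regular] with ω hy i
    have hf : ∀ i, thresholdPolicy B θ τ i ω ≠ ∞ := fun i => by
      rw [thresholdPolicy_eq hB hy]; exact ENNReal.ofReal_ne_top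
    have h := hy.pathCount_restart (a := stepTime B θ (0, fun m => τ m ω) i)
      (wait_nonneg (B := B) (θ := θ) ((step B θ)^[i] (0, fun m => τ m ω)))
    have h2 := (threshold_le_wait hB hθ hanti
      (isRegularPath_iterate_step (B := B) (θ := θ) hy 0 i)
      ((step B θ)^[i] (0, fun m => τ m ω)).1).1
    rw [energyBefore, energyAfter_thresholdPolicy hB hy, harvested_eq hy (hf _) (hf _),
      toReal_thresholdPolicy hB hy, toReal_thresholdPolicy hB hy, stepTime_succ, ← h,
      Nat.add_sub_cancel_left, ← iterate_step_snd hy]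
    exact h2

/-- The threshold policy of a relative value function attains the optimal average age. -/
lemma averageAge_thresholdPolicy_le [IsProbabilityMeasure P] (hB : 1 ≤ B)
    (hτ : IsPoissonRecharge P τ) {H : ℕ → ℝ → ℝ}
    (hH : IsRelativeValue B lam θ H) :
    averageAge P (thresholdPolicy B θ τ) ≤ ENNReal.ofReal lam := by
  have hθ : ∀ k, 1 ≤ k → k ≤ B → 0 ≤ θ k := fun k h1 h2 => hH.lam_pos.le.trans (hH.lam_le k h1 h2)
  refine averageAge_le hτ hH (isOnlinePolicy_thresholdPolicy hB hτ hθ hH.anti) ?_ ?_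
  · filter_upwards [hτ.ae_regular] with ω hy i c h1 h2 h3
    simp only [toReal_thresholdPolicy hB hy] at h1 h2 h3 ⊢
    obtain ⟨d, hd, rfl⟩ : ∃ d, 0 ≤ d ∧ c = stepTime B θ (0, fun m => τ m ω) i + d :=
      ⟨c - _, sub_nonneg.2 h1, by ring⟩
    rw [stepTime_succ] at h2
    rw [pathLevel_stepTime hy i hd] at h3 ⊢
    rw [add_sub_cancel_left]
    exact le_threshold_of_lt_wait hθ (isRegularPath_iterate_step hy 0 i) hd (by linarith) h3
  · filter_upwards [hτ.ae_regular] with ω hy i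
    simp only [toReal_thresholdPolicy hB hy]
    rw [stepTime_succ, pathLevel_stepTime hy i (wait_nonneg _), add_sub_cancel_left]
    exact (threshold_le_wait hB hθ hH.anti (isRegularPath_iterate_step hy 0 i) _).2

end Policy

/-! ### Measurability of restarts -/

lemma measurable_ncard_nat {α : Type*} [MeasurableSpace α] {p : ℕ → α → Prop}
    (hp : ∀ n, MeasurableSet {a | p n a}) : Measurable fun a => {n | p n a}.ncard := by
  have h : ∀ a, {n | p n a}.ncard = ⌊(∑' n, {a | p n a}.indicator (1 : α → ℝ≥0∞) a).toReal⌋₊ := by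
    intro a
    have h1 : ∑' n, {a | p n a}.indicator (1 : α → ℝ≥0∞) a = ({n | p n a}.encard : ℝ≥0∞) := by
      rw [← Measure.count_apply MeasurableSet.of_discrete, Measure.count,
        Measure.sum_apply _ MeasurableSet.of_discrete]
      refine tsum_congr fun n => ?_
      rw [Measure.dirac_apply' _ MeasurableSet.of_discrete]
      rfl
    rw [h1, Set.ncard]
    induction {n | p n a}.encard using ENat.recTopCoe with
    | top => simp
    | coe m => simp
  simp_rw [h]
  refine Nat.measurable_floor.comp (Measurable.ennreal_toReal ?_)
  exact Measurable.tsum fun n => measurable_one.indicator (hp n)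

lemma measurable_pathCount {α : Type*} [MeasurableSpace α] {f : α → ℕ → ℝ} {g : α → ℝ}
    (hf : Measurable f) (hg : Measurable g) : Measurable fun a => pathCount (f a) (g a) :=
  measurable_ncard_nat fun n => measurableSet_le ((measurable_pathTime n).comp hf) hg

lemma measurable_restart {α : Type*} [MeasurableSpace α] {f : α → ℕ → ℝ} {g : α → ℝ}
    (hf : Measurable f) (hg : Measurable g) : Measurable fun a => restart (f a) (g a) := by
  refine measurable_pi_lambda _ fun m => ?_
  have h1 : Measurable fun q : ℕ × (ℕ → ℝ) => pathTime q.2 q.1 :=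
    measurable_from_prod_countable_right fun n => measurable_pathTime n
  have h2 : Measurable fun q : ℕ × (ℕ → ℝ) => q.2 (q.1 + m) :=
    measurable_from_prod_countable_right fun n => measurable_pi_apply (n + m)
  have h3 := (measurable_pathCount hf hg).prodMk hf
  unfold restart
  split_ifs
  · exact (h1.comp h3).sub hg
  · exact h2.comp h3

/-! ### The strong Markov property -/

/-- The update times and the energy levels, stopped at the `i`-th update. -/
noncomputable def history (B : ℕ) (τ : ℕ → Ω → ℝ) (s : ℕ → Ω → ℝ≥0∞) (i : ℕ) (ω : Ω) (j : ℕ) :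
    ℝ × ℕ :=
  ((s (min j i) ω).toReal, energyAfter B τ s (min j i) ω)

lemma restart_eq_update {y : ℕ → ℝ} {n : ℕ} {c : ℝ}
    (h : pathCount y c = n) :
    restart y c = Function.update (fun m => y (n + m)) 0 (y n - (c - epoch y n)) := by
  funext m
  cases m with
  | zero =>
    rw [Function.update_self, restart, if_pos rfl, h, pathTime_eq_epoch_add]
    ring
  | succ m =>
    rw [Function.update_of_ne (Nat.succ_ne_zero m), restart, if_neg (Nat.succ_ne_zero m), h]

lemma IsRegularPath.pathCount_eq_iff_epoch {y : ℕ → ℝ} (hy : IsRegularPath y) {n : ℕ} {c : ℝ}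
    (hc : 0 ≤ c) : pathCount y c = n ↔ epoch y n ≤ c ∧ c < pathTime y n := by
  rw [← hy.pathCount_le_iff]
  cases n with
  | zero => simp [epoch, hc]
  | succ n =>
    rw [epoch_succ, ← hy.lt_pathCount_iff]
    omega

/-- The arrivals after an update are independent of the updates and of the energy levels up to
then, and they have the same law as the arrivals after the time `0`. This is obtained by summing
over the number `n` of the arrivals up to the update: when there are `n` of them, the history is a
function of the first `n` inter-arrival times, and the next one is memoryless. -/
theorem IsOnlinePolicy.strong_markov [MeasurableSpace Ω] {P : Measure Ω} [IsProbabilityMeasure P]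
    {B : ℕ} {τ : ℕ → Ω → ℝ} (hτ : IsPoissonRecharge P τ) {s : ℕ → Ω → ℝ≥0∞}
    (hs : IsOnlinePolicy P B τ hτ.measurable s) (i : ℕ) {C : Set (ℕ → ℝ × ℕ)}
    (hC : MeasurableSet C) {H : Set (ℕ → ℝ)} (hH : MeasurableSet H) :
    P {ω | history B τ s i ω ∈ C ∧ restart (fun m => τ m ω) (s i ω).toReal ∈ H} =
      P {ω | history B τ s i ω ∈ C} * arrivalLaw H := by
  choose s' hsm hs' using fun j n => exists_past_of_isStoppingTime (hs.causal j) n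
  -- the history, the time of the last arrival and the time since then, in terms of the first `n`
  -- inter-arrival times
  set h' : (n : ℕ) → (Fin n → ℝ) → ℕ → ℝ × ℕ := fun n p j =>
    ((s' (min j i) n p).toReal, pastEnergy B (fun j p => (s' j n p).toReal) p (min j i)) with hh'
  have hmh : ∀ n, Measurable (h' n) := fun n => measurable_pi_lambda _ fun j =>
    (hsm (min j i) n).ennreal_toReal.prodMk
      (measurable_pastEnergy B (fun j => (hsm j n).ennreal_toReal) _)
  set e : (n : ℕ) → (Fin n → ℝ) → ℝ := fun n p => epoch (extendPast p) n with he
  have hme : ∀ n, Measurable (e n) := fun n => by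
    have : Measurable fun y : ℕ → ℝ => epoch y n := by unfold epoch; fun_prop
    exact this.comp measurable_extendPast
  set c : (n : ℕ) → (Fin n → ℝ) → ℝ := fun n p => (s' i n p).toReal - e n p with hcdef
  have hmc : ∀ n, Measurable (c n) := fun n => (hsm i n).ennreal_toReal.sub (hme n)
  set Γ : (n : ℕ) → Set (Fin n → ℝ) := fun n => {p | h' n p ∈ C ∧ s' i n p ≠ ∞ ∧ 0 ≤ c n p} with hΓ
  have hmΓ : ∀ n, MeasurableSet (Γ n) := fun n =>
    (hmh n hC).inter (((hsm i n) (measurableSet_singleton ∞).compl).inter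
      (measurableSet_le measurable_const (hmc n)))
  set K : (n : ℕ) → Set (ℕ → ℝ) → Set ((Fin n → ℝ) × (ℕ → ℝ)) := fun n H =>
    {q | q.1 ∈ Γ n ∧ c n q.1 < q.2 0 ∧ Function.update q.2 0 (q.2 0 - c n q.1) ∈ H} with hK
  have hmu : ∀ n, Measurable fun q : (Fin n → ℝ) × (ℕ → ℝ) =>
      Function.update q.2 0 (q.2 0 - c n q.1) := fun n => by
    have := hmc n
    refine measurable_pi_lambda _ fun m => ?_
    rcases eq_or_ne m 0 with rfl | hm
    · simp only [Function.update_self]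
      fun_prop
    · simp only [Function.update_of_ne hm]
      fun_prop
  have hmK : ∀ n {H}, MeasurableSet H → MeasurableSet (K n H) := fun n H hH =>
    (measurable_fst (hmΓ n)).inter ((measurableSet_lt ((hmc n).comp measurable_fst)
      (by fun_prop)).inter (hmu n hH))
  have hmq : ∀ n, Measurable fun ω => (past τ n ω, future τ n ω) := fun n =>
    (hτ.measurable_past n).prodMk (hτ.measurable_future n)
  -- the event, on a regular path, when there are `n` arrivals up to the update
  have hkey : ∀ H, ∀ᵐ ω ∂P, ∀ n, (past τ n ω, future τ n ω) ∈ K n H ↔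
      (history B τ s i ω ∈ C ∧ restart (fun m => τ m ω) (s i ω).toReal ∈ H) ∧
        pathCount (fun m => τ m ω) (s i ω).toReal = n := by
    intro H
    filter_upwards [ae_isFeasiblePath hτ hs] with ω hω n
    obtain ⟨hfin, hf, hen⟩ := hω
    set y : ℕ → ℝ := fun m => τ m ω with hy
    have hep : e n (past τ n ω) = epoch y n := by
      refine Finset.sum_congr rfl fun j hj => ?_
      simp [extendPast, past, Finset.mem_range.1 hj, hy]
    have hfut : future τ n ω = fun m => y (n + m) := rfl
    have hlt : s i ω < ENNReal.ofReal (pathTime y n) →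
        ∀ j ≤ i, s' j n (past τ n ω) = s j ω := by
      intro h j hj
      have h4 : s j ω < ENNReal.ofReal (pathTime y n) :=
        ((ENNReal.toReal_le_toReal (hfin j) (hfin i)).1 (hf.mono hj)).trans_lt h
      have h5 := hs' j n ω hf.regular
      rw [min_eq_left h4.le] at h5
      rcases min_choice (s' j n (past τ n ω)) (ENNReal.ofReal (pathTime y n)) with h6 | h6
      · rw [h5, h6]
      · rw [h6] at h5
        exact absurd h5 h4.ne
    have hhist : s i ω < ENNReal.ofReal (pathTime y n) →
        h' n (past τ n ω) = history B τ s i ω := by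
      intro h
      have h1 := hlt h
      funext j
      simp only [hh', history]
      rw [h1 _ (min_le_right j i), hen]
      congr 1
      refine pastEnergy_past hf ?_ fun m hm => by rw [h1 m (hm.trans (min_le_right _ _))]
      exact (hf.mono (min_le_right j i)).trans_lt ((ENNReal.lt_ofReal_iff_toReal_lt (hfin i)).1 h)
    rw [hf.regular.pathCount_eq_iff_epoch (hf.nonneg i)]
    constructor
    · rintro ⟨⟨hz, hne, hc0⟩, hc1, hu⟩
      have h1 : s' i n (past τ n ω) < ENNReal.ofReal (pathTime y n) := by
        rw [ENNReal.lt_ofReal_iff_toReal_lt hne, pathTime_eq_epoch_add, ← hep]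
        simp only [hcdef, hfut, add_zero] at hc1
        linarith
      have h2 : s i ω < ENNReal.ofReal (pathTime y n) := by
        have := hs' i n ω hf.regular
        rw [min_eq_left h1.le] at this
        by_contra! h3
        rw [min_eq_right h3] at this
        exact absurd this h1.ne'
      have h3 := hlt h2 i le_rfl
      simp only [hcdef] at hc0 hu
      rw [h3, hep] at hc0 hu
      have hpc : epoch y n ≤ (s i ω).toReal ∧ (s i ω).toReal < pathTime y n :=
        ⟨sub_nonneg.1 hc0, (ENNReal.lt_ofReal_iff_toReal_lt (hfin i)).1 h2⟩
      refine ⟨⟨hhist h2 ▸ hz, ?_⟩, hpc⟩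
      rw [restart_eq_update
        ((hf.regular.pathCount_eq_iff_epoch (hf.nonneg i)).2 hpc)]
      exact hu
    · rintro ⟨⟨hz, hu⟩, hpc⟩
      have h2 : s i ω < ENNReal.ofReal (pathTime y n) :=
        (ENNReal.lt_ofReal_iff_toReal_lt (hfin i)).2 hpc.2
      have h3 := hlt h2 i le_rfl
      rw [restart_eq_update
        ((hf.regular.pathCount_eq_iff_epoch (hf.nonneg i)).2 hpc)] at hu
      have hcn : c n (past τ n ω) = (s i ω).toReal - epoch y n := by
        simp only [hcdef]
        rw [h3, hep]
      refine ⟨⟨(hhist h2).symm ▸ hz, h3.symm ▸ hfin i, ?_⟩, ?_, ?_⟩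
      · rw [hcn]
        exact sub_nonneg.2 hpc.1
      · have := hpc.2
        rw [pathTime_eq_epoch_add] at this
        simp only [hcn, hfut, add_zero]
        linarith
      · simp only [hcn, hfut, add_zero]
        exact hu
  have hprob : ∀ n {H}, MeasurableSet H → P ((fun ω => (past τ n ω, future τ n ω)) ⁻¹' K n H) =
      (∫⁻ p in Γ n, ENNReal.ofReal (Real.exp (-c n p)) ∂(P.map (past τ n))) * arrivalLaw H := by
    intro n H hH
    rw [← Measure.map_apply (hmq n) (hmK n hH), hτ.map_past_future,
      Measure.prod_apply (hmK n hH), ← lintegral_mul_const _ (by have := hmc n; fun_prop),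
      ← lintegral_indicator (hmΓ n)]
    refine lintegral_congr fun p => ?_
    by_cases hp : p ∈ Γ n
    · have hm0 : Measurable fun y : ℕ → ℝ => Function.update y 0 (y 0 - c n p) :=
        (hmu n).comp measurable_prodMk_left
      have h1 := congrArg (fun μ : Measure (ℕ → ℝ) => μ H)
        (map_update_restrict_arrivalLaw (c := c n p) hp.2.2)
      simp only [Measure.map_apply hm0 hH, Measure.restrict_apply (hm0 hH), Measure.smul_apply,
        smul_eq_mul] at h1
      rw [Set.indicator_of_mem hp, ← h1]
      congr 1
      ext y
      simp only [hK, Set.mem_preimage, Set.mem_ofPred_eq, Set.mem_inter_iff, hp, true_and]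
      exact and_comm
    · rw [Set.indicator_of_notMem hp]
      have : Prod.mk p ⁻¹' K n H = ∅ :=
        Set.eq_empty_of_forall_notMem fun y hy => hp hy.1
      rw [this, measure_empty]
  have hsum : ∀ {H}, MeasurableSet H →
      P {ω | history B τ s i ω ∈ C ∧ restart (fun m => τ m ω) (s i ω).toReal ∈ H} =
        (∑' n, ∫⁻ p in Γ n, ENNReal.ofReal (Real.exp (-c n p)) ∂(P.map (past τ n))) *
          arrivalLaw H := by
    intro H hH
    rw [← ENNReal.tsum_mul_right]
    simp_rw [← hprob _ hH]
    rw [← measure_iUnion₀ ?_ fun n => (hmq n (hmK n hH)).nullMeasurableSet]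
    · refine measure_congr ?_
      filter_upwards [hkey H] with ω hω
      refine propext ?_
      change _ ↔ ω ∈ ⋃ n, _
      simp only [Set.mem_iUnion, Set.mem_preimage, hω]
      exact ⟨fun h => ⟨_, h, rfl⟩, fun ⟨n, h, _⟩ => h⟩
    · intro n m hnm
      refine measure_mono_null (t := {ω | ¬ ∀ n, (past τ n ω, future τ n ω) ∈ K n H ↔
        (history B τ s i ω ∈ C ∧ restart (fun m => τ m ω) (s i ω).toReal ∈ H) ∧
          pathCount (fun m => τ m ω) (s i ω).toReal = n}) ?_ (hkey H)
      rintro ω ⟨h1, h2⟩ hω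
      exact hnm (((hω n).1 h1).2.symm.trans ((hω m).1 h2).2)
  have huniv := hsum MeasurableSet.univ
  simp only [Set.mem_univ, and_true, measure_univ, mul_one] at huniv
  rw [hsum hH, huniv]

/-! ### Regeneration at the visits -/

/-- The time of the `n`-th visit to the energy level `k`, for a sequence of update times and
energy levels. -/
noncomputable def hitTime (k n : ℕ) (ζ : ℕ → ℝ × ℕ) : ℝ := (ζ (Nat.nth (fun j => (ζ j).2 = k) n)).1

lemma measurable_nth {α : Type*} [MeasurableSpace α] {p : ℕ → α → Prop}
    (hp : ∀ n, MeasurableSet {a | p n a}) (n : ℕ) :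
    Measurable fun a => Nat.nth (fun j => p j a) n := by
  induction n using Nat.strong_induction_on with
  | _ n ih =>
    simp_rw [Nat.nth_eq_sInf _ n]
    have h : ∀ x, MeasurableSet {a | ∀ m < n, Nat.nth (fun j => p j a) m < x} := fun x => by
      simp only [Set.ofPred_forall]
      exact MeasurableSet.iInter fun m => MeasurableSet.iInter fun hm =>
        measurableSet_lt (ih m hm) measurable_const
    exact measurable_sInf_nat fun x => (hp x).inter (h x)

lemma measurableSet_level (k j : ℕ) : MeasurableSet {ζ : ℕ → ℝ × ℕ | (ζ j).2 = k} :=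
  (measurable_snd.comp (measurable_pi_apply (X := fun _ : ℕ => ℝ × ℕ) j))
    (measurableSet_singleton k)

lemma measurable_hitTime (k n : ℕ) : Measurable (hitTime k n) := by
  have h1 : Measurable fun q : ℕ × (ℕ → ℝ × ℕ) => (q.2 q.1).1 :=
    measurable_from_prod_countable_right fun j => by fun_prop
  exact h1.comp ((measurable_nth (measurableSet_level k) n).prodMk measurable_id)

lemma measurable_gap {α : Type*} [MeasurableSpace α] {l : ℕ → α → ℝ} (hl : ∀ n, Measurable (l n))
    (n : ℕ) : Measurable (gap l n) := by
  cases n with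
  | zero => exact hl 0
  | succ n => exact (hl (n + 1)).sub (hl n)

/-- The first indices at which a predicate holds depend only on its values up to them. -/
lemma nth_eq_of_agree {p p' : ℕ → Prop} (hp : (Set.ofPred p).Infinite) {i n : ℕ}
    (h : ∀ j ≤ i, p j ↔ p' j) (hn : Nat.nth p n = i) {m : ℕ} (hm : m ≤ n) :
    Nat.nth p' m = Nat.nth p m := by
  classical
  have hle : Nat.nth p m ≤ i := hn ▸ Nat.nth_monotone hp hm
  have hc : Nat.count p' (Nat.nth p m) = m := by
    have h1 : Nat.count p' (Nat.nth p m) = Nat.count p (Nat.nth p m) := by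
      rw [Nat.count_eq_card_filter_range, Nat.count_eq_card_filter_range]
      congr 1
      refine Finset.filter_congr fun j hj => (h j ?_).symm
      exact (Finset.mem_range.1 hj).le.trans hle
    rw [h1, Nat.count_nth_of_infinite hp]
  have := Nat.nth_count (p := p') ((h _ hle).1 (Nat.nth_mem_of_infinite hp m))
  rwa [hc] at this

section Path

variable {Ω : Type*} {B : ℕ} {τ : ℕ → Ω → ℝ} {s : ℕ → Ω → ℝ≥0∞}

/-- The history stopped at the `n`-th visit determines the first `n` visits. -/
lemma gap_hitTime_history {k n i m : ℕ} {ω : Ω} (hinf : (visits B τ s k ω).Infinite)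
    (hn : Nat.nth (fun j => j ∈ visits B τ s k ω) n = i) (hm : m ≤ n) :
    gap (hitTime k) m (history B τ s i ω) = gap (visitTime B τ s k) m ω := by
  have h : ∀ m ≤ n, hitTime k m (history B τ s i ω) = visitTime B τ s k m ω := by
    intro m hm
    have h1 : Nat.nth (fun j => (history B τ s i ω j).2 = k) m =
        Nat.nth (fun j => j ∈ visits B τ s k ω) m := by
      refine nth_eq_of_agree hinf (fun j hj => ?_) hn hm
      simp only [history, min_eq_left hj]
    have h2 : Nat.nth (fun j => j ∈ visits B τ s k ω) m ≤ i := hn ▸ Nat.nth_monotone hinf hm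
    rw [hitTime, h1, history, min_eq_left h2, visitTime]
  cases m with
  | zero => exact h 0 hm
  | succ m =>
    simp only [gap]
    rw [h _ hm, h m (by omega)]

lemma nth_history_iff {k n i : ℕ} {ω : Ω} (hinf : (visits B τ s k ω).Infinite) :
    Nat.nth (fun j => j ∈ visits B τ s k ω) n = i ↔
      Nat.nth (fun j => (history B τ s i ω j).2 = k) n = i ∧ (history B τ s i ω i).2 = k := by
  have hagree : ∀ j ≤ i, (history B τ s i ω j).2 = k ↔ j ∈ visits B τ s k ω := by
    intro j hj
    simp only [history, min_eq_left hj]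
    rfl
  constructor
  · intro h
    refine ⟨?_, (hagree i le_rfl).2 (h ▸ Nat.nth_mem_of_infinite hinf n)⟩
    exact (nth_eq_of_agree hinf (fun j hj => (hagree j hj).symm) h le_rfl).trans h
  · rintro ⟨h1, h2⟩
    have hinf' : (Set.ofPred fun j => (history B τ s i ω j).2 = k).Infinite := by
      refine Set.infinite_of_forall_exists_gt fun a => ⟨max i (a + 1), ?_, by omega⟩
      change (history B τ s i ω (max i (a + 1))).2 = k
      rw [← h2]
      simp only [history, min_self]
      rw [min_eq_right (le_max_left i _)]
    exact (nth_eq_of_agree hinf' hagree h1 le_rfl).trans h1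

end Path

section Renewal

variable {Ω : Type*} [MeasurableSpace Ω] {P : Measure Ω} {B : ℕ} {τ : ℕ → Ω → ℝ}
  {s : ℕ → Ω → ℝ≥0∞}

lemma measurable_energyAfter (hτ : ∀ n, Measurable (τ n)) (hs : ∀ i, Measurable (s i)) (i : ℕ) :
    Measurable (energyAfter B τ s i) := by
  induction i with
  | zero => exact measurable_const
  | succ i ih =>
    have h : Measurable fun ω => harvested τ (s i ω) (s (i + 1) ω) ω :=
      measurable_ncard_nat fun n =>
        (measurableSet_lt (hs i) (measurable_arrivalTime hτ n).ennreal_ofReal).inter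
          (measurableSet_le (measurable_arrivalTime hτ n).ennreal_ofReal (hs (i + 1)))
    exact (measurable_of_countable fun q : ℕ × ℕ => min (q.1 + q.2) B - 1).comp (ih.prodMk h)

lemma measurable_record (hτ : ∀ n, Measurable (τ n)) (hs : ∀ i, Measurable (s i)) :
    Measurable fun ω j => ((s j ω).toReal, energyAfter B τ s j ω) :=
  measurable_pi_lambda _ fun j => (hs j).ennreal_toReal.prodMk (measurable_energyAfter hτ hs j)

lemma measurable_visitTime (hτ : ∀ n, Measurable (τ n)) (hs : ∀ i, Measurable (s i)) (k n : ℕ) :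
    Measurable (visitTime B τ s k n) :=
  (measurable_hitTime k n).comp (measurable_record hτ hs)

variable [IsProbabilityMeasure P]

/-- If the time until the next visit is a functional `R` of the arrivals after a visit, it is
independent of the visits so far, and its law is the law of `R`. -/
lemma measure_gap_succ (hτ : IsPoissonRecharge P τ)
    (hs : IsOnlinePolicy P B τ hτ.measurable s) {k : ℕ}
    (hinf : ∀ᵐ ω ∂P, (visits B τ s k ω).Infinite) {R : (ℕ → ℝ) → ℝ} (hR : Measurable R)
    (hgap : ∀ᵐ ω ∂P, ∀ n, gap (visitTime B τ s k) (n + 1) ω =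
      R (restart (fun m => τ m ω) (visitTime B τ s k n ω)))
    (n : ℕ) {C : ℕ → Set ℝ} (hC : ∀ m, MeasurableSet (C m)) {D : Set ℝ} (hD : MeasurableSet D) :
    P ((⋂ m ∈ Finset.range (n + 1), gap (visitTime B τ s k) m ⁻¹' C m) ∩
      gap (visitTime B τ s k) (n + 1) ⁻¹' D) =
      P (⋂ m ∈ Finset.range (n + 1), gap (visitTime B τ s k) m ⁻¹' C m) * arrivalLaw (R ⁻¹' D) := by
  set F : ℕ → Set (ℕ → ℝ × ℕ) := fun i => {ζ | (Nat.nth (fun j => (ζ j).2 = k) n = i ∧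
    (ζ i).2 = k) ∧ ∀ m ∈ Finset.range (n + 1), gap (hitTime k) m ζ ∈ C m} with hF
  have hmF : ∀ i, MeasurableSet (F i) := fun i => by
    have h : {ζ | ∀ m ∈ Finset.range (n + 1), gap (hitTime k) m ζ ∈ C m} =
        ⋂ m ∈ Finset.range (n + 1), gap (hitTime k) m ⁻¹' C m := by ext; simp
    have hm := h.symm ▸ Finset.measurableSet_biInter (Finset.range (n + 1))
      fun m _ => measurable_gap (measurable_hitTime k) m (hC m)
    exact (MeasurableSet.inter (measurable_nth (measurableSet_level k) n
      (measurableSet_singleton i)) (measurableSet_level k i)).inter hm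
  have hsm : ∀ i, Measurable (s i) := hs.measurable
  have hmV := measurable_visitTime (B := B) (k := k) hτ.measurable hsm
  have hmA : MeasurableSet (⋂ m ∈ Finset.range (n + 1), gap (visitTime B τ s k) m ⁻¹' C m) :=
    Finset.measurableSet_biInter _ fun m _ => measurable_gap hmV m (hC m)
  have hmI : ∀ i, MeasurableSet {ω | Nat.nth (fun j => j ∈ visits B τ s k ω) n = i} := fun i =>
    measurable_nth (fun j => measurable_energyAfter (B := B) hτ.measurable hsm j
      (measurableSet_singleton k)) n (measurableSet_singleton i)
  have hsplit : ∀ {A : Set Ω}, MeasurableSet A →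
      P A = ∑' i, P (A ∩ {ω | Nat.nth (fun j => j ∈ visits B τ s k ω) n = i}) := by
    intro A hA
    rw [← measure_iUnion ?_ fun i => hA.inter (hmI i)]
    · congr 1
      ext ω
      simp
    · intro i j hij
      refine Set.disjoint_left.2 ?_
      rintro ω ⟨-, h1⟩ ⟨-, h2⟩
      exact hij (h1.symm.trans h2)
  have hA : ∀ i, P ((⋂ m ∈ Finset.range (n + 1), gap (visitTime B τ s k) m ⁻¹' C m) ∩
      {ω | Nat.nth (fun j => j ∈ visits B τ s k ω) n = i}) =
        P {ω | history B τ s i ω ∈ F i} := by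
    intro i
    refine measure_congr (eventuallyEq_set.2 ?_)
    filter_upwards [hinf] with ω hω
    simp only [hF, Set.mem_inter_iff, Set.mem_iInter, Set.mem_ofPred_eq, ← nth_history_iff hω,
      Set.mem_preimage]
    rw [and_comm]
    refine and_congr_right fun h => forall₂_congr fun m hm => ?_
    rw [gap_hitTime_history hω h (Nat.lt_succ_iff.1 (Finset.mem_range.1 hm))]
  rw [hsplit (hmA.inter (measurable_gap hmV (n + 1) hD)), hsplit hmA, ← ENNReal.tsum_mul_right]
  refine tsum_congr fun i => ?_
  rw [hA, ← hs.strong_markov hτ i (hmF i) (hR hD)]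
  refine measure_congr (eventuallyEq_set.2 ?_)
  filter_upwards [hinf, hgap] with ω hω hg
  simp only [hF, Set.mem_inter_iff, Set.mem_iInter, Set.mem_ofPred_eq, ← nth_history_iff hω,
    Set.mem_preimage, hg n]
  have hv : Nat.nth (fun j => j ∈ visits B τ s k ω) n = i →
      visitTime B τ s k n ω = (s i ω).toReal := by
    rintro rfl
    rfl
  constructor
  · rintro ⟨⟨h1, h2⟩, h3⟩
    refine ⟨⟨h3, fun m hm => ?_⟩, hv h3 ▸ h2⟩
    rw [gap_hitTime_history hω h3 (Nat.lt_succ_iff.1 (Finset.mem_range.1 hm))]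
    exact h1 m hm
  · rintro ⟨⟨h3, h1⟩, h2⟩
    refine ⟨⟨fun m hm => ?_, (hv h3).symm ▸ h2⟩, h3⟩
    rw [← gap_hitTime_history hω h3 (Nat.lt_succ_iff.1 (Finset.mem_range.1 hm))]
    exact h1 m hm

/-- The successive visits form a delayed renewal process, if there are infinitely many of them and
the time until the next one is a functional of the arrivals after a visit. -/
theorem isRenewalProcess_visitTime (hτ : IsPoissonRecharge P τ)
    (hs : IsOnlinePolicy P B τ hτ.measurable s) {k : ℕ}
    (hinf : ∀ᵐ ω ∂P, (visits B τ s k ω).Infinite) {R : (ℕ → ℝ) → ℝ} (hR : Measurable R)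
    (hgap : ∀ᵐ ω ∂P, ∀ n, gap (visitTime B τ s k) (n + 1) ω =
      R (restart (fun m => τ m ω) (visitTime B τ s k n ω)))
    (hpos : ∀ᵐ ω ∂P, ∀ n, 0 < gap (visitTime B τ s k) (n + 1) ω) :
    IsRenewalProcess P (visitTime B τ s k) := by
  have hmV := measurable_visitTime (B := B) (k := k) hτ.measurable hs.measurable
  have hmG := measurable_gap hmV
  have hlaw : ∀ n {D : Set ℝ}, MeasurableSet D →
      P (gap (visitTime B τ s k) (n + 1) ⁻¹' D) = arrivalLaw (R ⁻¹' D) := by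
    intro n D hD
    have := measure_gap_succ hτ hs hinf hR hgap n (C := fun _ => Set.univ)
      (fun _ => MeasurableSet.univ) hD
    simpa using this
  refine ⟨fun n => (hmV n).aemeasurable, fun n => ?_, ?_, fun n => ?_, fun h => ?_⟩
  · cases n with
    | zero => exact ae_of_all _ fun ω => ENNReal.toReal_nonneg
    | succ n =>
      filter_upwards [hpos] with ω hω
      exact (hω n).le
  · have hprod : ∀ n {C : ℕ → Set ℝ}, (∀ m, MeasurableSet (C m)) →
        P (⋂ m ∈ Finset.range (n + 1), gap (visitTime B τ s k) m ⁻¹' C m) =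
          ∏ m ∈ Finset.range (n + 1), P (gap (visitTime B τ s k) m ⁻¹' C m) := by
      intro n C hC
      induction n with
      | zero => simp
      | succ n ih =>
        rw [Finset.prod_range_succ, ← ih, hlaw n (hC _), ← measure_gap_succ hτ hs hinf hR hgap n hC
          (hC (n + 1)), Finset.range_add_one (n := n + 1), Finset.set_biInter_insert,
          Set.inter_comm]
    rw [iIndepFun_iff_measure_inter_preimage_eq_mul]
    intro S C hC
    classical
    have h1 := hprod (S.sup id) (C := fun m => if m ∈ S then C m else Set.univ) fun m => by
      split_ifs with hm
      · exact hC m hm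
      · exact MeasurableSet.univ
    have hsub : ∀ m ∈ S, m ∈ Finset.range (S.sup id + 1) := fun m hm =>
      Finset.mem_range.2 (Nat.lt_succ_of_le (Finset.le_sup (f := id) hm))
    have h2 : (⋂ m ∈ Finset.range (S.sup id + 1), gap (visitTime B τ s k) m ⁻¹'
        (if m ∈ S then C m else Set.univ)) = ⋂ m ∈ S, gap (visitTime B τ s k) m ⁻¹' C m := by
      ext ω
      simp only [Set.mem_iInter, Set.mem_preimage]
      constructor
      · intro h m hm
        simpa [hm] using h m (hsub m hm)
      · intro h m _
        split_ifs with hm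
        · exact h m hm
        · exact Set.mem_univ _
    rw [h2] at h1
    rw [h1, ← Finset.prod_subset hsub fun m _ hm => by simp [hm]]
    exact Finset.prod_congr rfl fun m hm => by simp [hm]
  · refine ⟨(hmG _).aemeasurable, (hmG _).aemeasurable, Measure.ext fun D hD => ?_⟩
    rw [Measure.map_apply (hmG _) hD, Measure.map_apply (hmG _) hD, hlaw n hD, hlaw 0 hD]
  · have : ∀ᵐ _ω ∂P, False := by
      filter_upwards [h, hpos] with ω h1 h2
      exact (h2 0).ne' h1
    exact IsProbabilityMeasure.ne_zero P (by simpa using this)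

/-- If the arrivals after an update make sure, with positive probability and whatever the history,
that the level `k` occurs within a bounded number of updates, it occurs infinitely often. -/
theorem infinite_visits (hτ : IsPoissonRecharge P τ)
    (hs : IsOnlinePolicy P B τ hτ.measurable s) {k J : ℕ} {D : Set (ℕ → ℝ)} (hD : MeasurableSet D)
    (hpos : arrivalLaw D ≠ 0)
    (hJ : ∀ᵐ ω ∂P, ∀ i, restart (fun m => τ m ω) (s i ω).toReal ∈ D →
      energyAfter B τ s (i + J) ω = k) :
    ∀ᵐ ω ∂P, (visits B τ s k ω).Infinite := by
  have hbound : ∀ a r, P {ω | ∀ j, a ≤ j → j ≤ a + r * J → energyAfter B τ s j ω ≠ k} ≤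
      arrivalLaw Dᶜ ^ r := by
    intro a r
    induction r with
    | zero => simpa using prob_le_one
    | succ r ih =>
      set i := a + r * J with hi
      set F : Set (ℕ → ℝ × ℕ) := {ζ | ∀ j, a ≤ j → j ≤ i → (ζ j).2 ≠ k} with hF
      have hmF : MeasurableSet F := by
        simp only [hF, Set.ofPred_forall]
        exact MeasurableSet.iInter fun j => MeasurableSet.iInter fun _ =>
          MeasurableSet.iInter fun _ => (measurableSet_level k j).compl
      have hFeq : {ω | history B τ s i ω ∈ F} =
          {ω | ∀ j, a ≤ j → j ≤ i → energyAfter B τ s j ω ≠ k} := by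
        ext ω
        simp only [hF, Set.mem_ofPred_eq, history]
        refine forall₃_congr fun j _ hj => ?_
        rw [min_eq_left hj]
      have hmk := hs.strong_markov hτ i hmF hD.compl
      rw [hFeq] at hmk
      rw [pow_succ]
      refine le_trans ?_ (mul_le_mul_left ih _)
      rw [← hmk]
      refine measure_mono_ae ?_
      filter_upwards [hJ] with ω hω h
      have hle : i ≤ a + (r + 1) * J := by
        rw [hi, add_mul]
        omega
      refine ⟨?_, fun hmem => ?_⟩
      · change ω ∈ {ω | history B τ s i ω ∈ F}
        rw [hFeq]
        exact fun j h1 h2 => h j h1 (h2.trans hle)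
      · refine h (i + J) (by omega) ?_ (hω i hmem)
        rw [hi, add_mul]
        omega
  have hlt : arrivalLaw Dᶜ < 1 := by
    rw [prob_compl_eq_one_sub hD]
    exact ENNReal.sub_lt_self ENNReal.one_ne_top one_ne_zero hpos
  have hall : ∀ᵐ ω ∂P, ∀ a, ∃ j, a ≤ j ∧ energyAfter B τ s j ω = k := by
    refine ae_all_iff.2 fun a => ?_
    have h0 : P {ω | ∀ j, a ≤ j → energyAfter B τ s j ω ≠ k} = 0 := by
      refine le_antisymm (ge_of_tendsto' (ENNReal.tendsto_pow_atTop_nhds_zero_of_lt_one hlt)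
        fun r => le_trans (measure_mono ?_) (hbound a r)) zero_le
      intro ω h j h1 _
      exact h j h1
    rw [ae_iff]
    simp only [not_exists, not_and]
    exact h0
  filter_upwards [hall] with ω hω
  refine Set.infinite_of_forall_exists_gt fun a => ?_
  obtain ⟨j, h1, h2⟩ := hω (a + 1)
  exact ⟨j, h2, h1⟩

end Renewal

/-! ### Returns of the threshold policy -/

section Return

variable {B : ℕ} {θ : ℕ → ℝ}

lemma measurable_wait (B : ℕ) (θ : ℕ → ℝ) : Measurable (wait B θ) := by
  refine measurable_from_prod_countable_right fun e => ?_
  change Measurable fun z => (waitTime B θ (fun m => ENNReal.ofReal (pathTime z m)) e).toReal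
  simp only [waitTime_ofReal]
  refine Measurable.ennreal_toReal ?_
  induction Finset.Icc 1 B using Finset.induction_on with
  | empty => simp
  | insert k S _ ih =>
    simp only [Finset.inf_insert]
    refine Measurable.inf (Measurable.ennreal_ofReal (measurable_const.max ?_)) ih
    split_ifs
    · exact measurable_const
    · exact measurable_pathTime _

lemma measurable_step (B : ℕ) (θ : ℕ → ℝ) : Measurable (step B θ) := by
  have h1 : Measurable fun q : ℕ × (ℕ → ℝ) => pathCount q.2 (wait B θ q) :=
    measurable_pathCount measurable_snd (measurable_wait B θ)
  have h2 : Measurable fun q : ℕ × (ℕ → ℝ) => restart q.2 (wait B θ q) :=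
    measurable_restart measurable_snd (measurable_wait B θ)
  have h3 : Measurable fun q : ℕ × ℕ => min (q.1 + q.2) B - 1 := measurable_of_countable _
  have h4 : Measurable fun q : ℕ × (ℕ → ℝ) => min (q.1 + pathCount q.2 (wait B θ q)) B - 1 :=
    h3.comp (measurable_fst.prodMk h1)
  exact h4.prodMk h2

lemma measurable_stepTime (B : ℕ) (θ : ℕ → ℝ) (i : ℕ) : Measurable fun q => stepTime B θ q i :=
  Finset.measurable_sum _ fun j _ => (measurable_wait B θ).comp ((measurable_step B θ).iterate j)

/-- The number of updates until the energy level `k` is left again, starting from it; meaningful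
when this happens. -/
noncomputable def returnCount (B : ℕ) (θ : ℕ → ℝ) (k : ℕ) (z : ℕ → ℝ) : ℕ :=
  sInf {m | 1 ≤ m ∧ ((step B θ)^[m] (k, z)).1 = k}

/-- The time until the energy level `k` is left again by an update, starting from it. -/
noncomputable def returnTime (B : ℕ) (θ : ℕ → ℝ) (k : ℕ) (z : ℕ → ℝ) : ℝ :=
  stepTime B θ (k, z) (returnCount B θ k z)

lemma measurable_returnTime (B : ℕ) (θ : ℕ → ℝ) (k : ℕ) : Measurable (returnTime B θ k) := by
  have h1 : Measurable (returnCount B θ k) := by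
    refine measurable_sInf_nat fun m => (MeasurableSet.const _).inter ?_
    exact (measurable_fst.comp (((measurable_step B θ).iterate m).comp measurable_prodMk_left))
      (measurableSet_singleton k)
  have h2 : Measurable fun q : ℕ × (ℕ → ℝ) => stepTime B θ (k, q.2) q.1 :=
    measurable_from_prod_countable_right fun i =>
      (measurable_stepTime B θ i).comp measurable_prodMk_left
  have := h2.comp (h1.prodMk measurable_id)
  exact this

lemma nth_succ_eq_add_sInf {p : ℕ → Prop} (hp : (Set.ofPred p).Infinite) (n : ℕ) :
    Nat.nth p (n + 1) = Nat.nth p n + sInf {m | 1 ≤ m ∧ p (Nat.nth p n + m)} := by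
  have hlt : Nat.nth p n < Nat.nth p (n + 1) := Nat.nth_strictMono hp (Nat.lt_succ_self n)
  have hmem : Nat.nth p (n + 1) - Nat.nth p n ∈ {m | 1 ≤ m ∧ p (Nat.nth p n + m)} := by
    refine ⟨by omega, ?_⟩
    rw [Nat.add_sub_cancel' hlt.le]
    exact Nat.nth_mem_of_infinite hp _
  have h1 := Nat.sInf_le hmem
  have h2 := Nat.sInf_mem ⟨_, hmem⟩
  refine le_antisymm ?_ (by omega)
  rw [Nat.nth_eq_sInf p (n + 1)]
  refine Nat.sInf_le ⟨h2.2, fun m hm => ?_⟩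
  have := Nat.nth_monotone hp (Nat.lt_succ_iff.1 hm)
  have := h2.1
  omega

variable {Ω : Type*} {τ : ℕ → Ω → ℝ} {ω : Ω} {k : ℕ}

/-- The time until the next visit to a level is a functional of the arrivals after the visit. -/
lemma gap_visitTime_succ (hB : 1 ≤ B) (hy : IsRegularPath fun m => τ m ω)
    (hinf : (visits B τ (thresholdPolicy B θ τ) k ω).Infinite) (n : ℕ) :
    gap (visitTime B τ (thresholdPolicy B θ τ) k) (n + 1) ω =
      returnTime B θ k
        (restart (fun m => τ m ω) (visitTime B τ (thresholdPolicy B θ τ) k n ω)) := by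
  set y : ℕ → ℝ := fun m => τ m ω with hydef
  have hmem : ∀ j, j ∈ visits B τ (thresholdPolicy B θ τ) k ω ↔
      ((step B θ)^[j] (0, y)).1 = k := fun j => by
    rw [visits, Set.mem_ofPred_eq, energyAfter_thresholdPolicy hB hy]
  have hn := Nat.nth_mem_of_infinite (p := fun j => j ∈ visits B τ (thresholdPolicy B θ τ) k ω)
    hinf n
  have hs := nth_succ_eq_add_sInf (p := fun j => j ∈ visits B τ (thresholdPolicy B θ τ) k ω)
    hinf n
  simp only [gap, visitTime]
  rw [hs]
  set i := Nat.nth (fun j => j ∈ visits B τ (thresholdPolicy B θ τ) k ω) n with hi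
  have hstep : (step B θ)^[i] (0, y) = (k, restart y (stepTime B θ (0, y) i)) :=
    Prod.ext ((hmem i).1 hn) (iterate_step_snd hy 0 i)
  have hcount : sInf {m | 1 ≤ m ∧ i + m ∈ visits B τ (thresholdPolicy B θ τ) k ω} =
      returnCount B θ k (restart y (stepTime B θ (0, y) i)) := by
    rw [returnCount]
    congr 1
    ext m
    simp only [Set.mem_ofPred_eq, hmem]
    rw [add_comm i m, Function.iterate_add_apply, hstep]
  rw [hcount, toReal_thresholdPolicy hB hy, toReal_thresholdPolicy hB hy, stepTime_add, hstep,
    add_sub_cancel_left, returnTime]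

lemma gap_visitTime_pos (hB : 1 ≤ B) {lam : ℝ} (hlam : 0 < lam)
    (hθ : ∀ k, 1 ≤ k → k ≤ B → lam ≤ θ k) (hy : IsRegularPath fun m => τ m ω)
    (hinf : (visits B τ (thresholdPolicy B θ τ) k ω).Infinite) (n : ℕ) :
    0 < gap (visitTime B τ (thresholdPolicy B θ τ) k) (n + 1) ω := by
  have hlt := Nat.nth_strictMono (p := fun j => j ∈ visits B τ (thresholdPolicy B θ τ) k ω) hinf
    (Nat.lt_succ_self n)
  simp only [gap, visitTime]
  rw [toReal_thresholdPolicy hB hy, toReal_thresholdPolicy hB hy, sub_pos]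
  refine lt_of_lt_of_le ?_ (stepTime_mono _ (Nat.succ_le_of_lt hlt))
  rw [Nat.succ_eq_add_one, stepTime_succ]
  exact lt_add_of_pos_right _ (hlam.trans_le (le_wait hB hlam.le hθ _))

end Return

/-! ### Recurrence of the threshold policy -/

/-- The arrivals that fill the battery before the age reaches `lam`, and are followed by a pause
longer than `c`. -/
def refillPaths (B : ℕ) (lam c : ℝ) : Set (ℕ → ℝ) :=
  {z | (∀ m < B, z m ≤ lam / B) ∧ c < z B}

lemma measurableSet_refillPaths (B : ℕ) (lam c : ℝ) : MeasurableSet (refillPaths B lam c) := by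
  have h : MeasurableSet {z : ℕ → ℝ | ∀ m < B, z m ≤ lam / B} := by
    simp only [Set.ofPred_forall]
    exact MeasurableSet.iInter fun m => MeasurableSet.iInter fun _ =>
      measurableSet_le (measurable_pi_apply m) measurable_const
  exact h.inter (measurableSet_lt measurable_const (measurable_pi_apply B))

lemma arrivalLaw_refillPaths_ne_zero {B : ℕ} (hB : 1 ≤ B) {lam c : ℝ} (hlam : 0 < lam)
    (hc : 0 ≤ c) : arrivalLaw (refillPaths B lam c) ≠ 0 := by
  have hB' : (0 : ℝ) < B := by exact_mod_cast hB
  have hset : refillPaths B lam c = Set.pi (Finset.range (B + 1) : Finset ℕ)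
      fun m => if m = B then Set.Ioi c else Set.Iic (lam / B) := by
    ext z
    simp only [refillPaths, Set.mem_ofPred_eq, Set.mem_pi, Finset.coe_range, Set.mem_Iio]
    constructor
    · rintro ⟨h1, h2⟩ m hm
      split_ifs with h
      · exact h ▸ h2
      · exact h1 m (by omega)
    · intro h
      refine ⟨fun m hm => ?_, ?_⟩
      · have := h m (by omega)
        rwa [if_neg hm.ne] at this
      · have := h B (by omega)
        rwa [if_pos rfl] at this
  rw [hset, Measure.infinitePi_pi _ fun m _ => by
    split_ifs
    · exact measurableSet_Ioi
    · exact measurableSet_Iic, Finset.prod_ne_zero_iff]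
  intro m _
  split_ifs
  · rw [expMeasure_one_Ioi hc]
    simp [Real.exp_pos]
  · have h1 : expMeasure 1 (Set.Ioi (lam / B)) < 1 := by
      rw [expMeasure_one_Ioi (by positivity), ENNReal.ofReal_lt_one, Real.exp_lt_one_iff]
      exact neg_lt_zero.2 (by positivity)
    rw [← Set.compl_Ioi, prob_compl_eq_one_sub measurableSet_Ioi]
    exact (tsub_pos_of_lt h1).ne'

section Recurrence

variable {B : ℕ} {θ : ℕ → ℝ} {z : ℕ → ℝ}

/-- During a long pause of the arrivals, each update takes one unit of energy. -/
lemma iterate_step_of_pause (hB : 1 ≤ B) (hθ : ∀ k, 1 ≤ k → k ≤ B → 0 ≤ θ k)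
    (hz : IsRegularPath z) {e i : ℕ} (he : e < B) (hie : i ≤ e) (hp : i * θ 1 < z 0) :
    ((step B θ)^[i] (e, z)).1 = e - i := by
  induction i generalizing e z with
  | zero => simp
  | succ i ih =>
    have h1 : wait B θ (e, z) ≤ θ 1 := by
      refine (wait_le hθ le_rfl hB e z).trans ?_
      rw [if_pos (by omega), max_eq_left (hθ 1 le_rfl hB)]
    have h01 := hθ 1 le_rfl hB
    push_cast at hp
    have hi0 : 0 ≤ (i : ℝ) * θ 1 := by positivity
    have hcount : pathCount z (wait B θ (e, z)) = 0 := by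
      refine Nat.le_zero.1 (hz.pathCount_le_iff.2 ?_)
      rw [pathTime_zero]
      linarith
    have hstep : step B θ (e, z) = (e - 1, restart z (wait B θ (e, z))) := by
      rw [step]
      simp only [hcount, add_zero]
      rw [min_eq_left he.le]
    rw [Function.iterate_succ_apply, hstep, ih (hz.restart _) (by omega) (by omega)]
    · omega
    · simp only [restart, if_true, hcount, pathTime_zero]
      linarith

/-- After a refill, every energy level occurs, whatever the energy was before. -/
lemma iterate_step_of_mem_refillPaths (hB : 1 ≤ B) {lam : ℝ} (hlam : 0 < lam)
    (hθ : ∀ k, 1 ≤ k → k ≤ B → lam ≤ θ k) (hz : IsRegularPath z)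
    (hD : z ∈ refillPaths B lam ((B + 1) * θ 1)) (e : ℕ) {k : ℕ} (hk : k ≤ B - 1) :
    ((step B θ)^[B - k] (e, z)).1 = k := by
  have hB' : (0 : ℝ) < B := by exact_mod_cast hB
  have hθ0 : ∀ k, 1 ≤ k → k ≤ B → 0 ≤ θ k := fun k h1 h2 => hlam.le.trans (hθ k h1 h2)
  obtain ⟨hD1, hD2⟩ := hD
  have hfill : pathTime z (B - 1) ≤ lam := by
    calc pathTime z (B - 1) ≤ ∑ _m ∈ Finset.range (B - 1 + 1), lam / B :=
          Finset.sum_le_sum fun m hm => hD1 m (by have := Finset.mem_range.1 hm; omega)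
      _ = lam := by
          rw [Finset.sum_const, Finset.card_range, Nat.sub_add_cancel hB, nsmul_eq_mul]
          field_simp
  have hw1 : lam ≤ wait B θ (e, z) := le_wait hB hlam.le hθ _
  have hw2 : wait B θ (e, z) ≤ θ 1 := by
    refine (wait_le_max hB hθ0 hz e).trans (max_le le_rfl ?_)
    rw [← pathTime_zero z]
    exact ((hz.strictMono.monotone (Nat.zero_le (B - 1))).trans hfill).trans (hθ 1 le_rfl hB)
  have h01 := hθ0 1 le_rfl hB
  have hcount : pathCount z (wait B θ (e, z)) = B := by
    refine hz.pathCount_eq_iff.2 ⟨fun m hm => ?_, ?_⟩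
    · exact ((hz.strictMono.monotone (by omega : m ≤ B - 1)).trans hfill).trans hw1
    · obtain ⟨b, rfl⟩ : ∃ b, B = b + 1 := ⟨B - 1, by omega⟩
      rw [pathTime_succ]
      have h1 := hz.pathTime_pos b
      have h2 : θ 1 ≤ (((b + 1 : ℕ) : ℝ) + 1) * θ 1 := by nlinarith
      linarith
  have hstep : step B θ (e, z) = (B - 1, restart z (wait B θ (e, z))) := by
    rw [step]
    simp only [hcount]
    rw [min_eq_right (by omega)]
  obtain ⟨i, hi⟩ : ∃ i, B - k = i + 1 := ⟨B - k - 1, by omega⟩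
  rw [hi, Function.iterate_succ_apply, hstep,
    iterate_step_of_pause hB hθ0 (hz.restart _) (by omega) (by omega : i ≤ B - 1)]
  · omega
  · simp only [restart, if_true, hcount]
    obtain ⟨b, rfl⟩ : ∃ b, B = b + 1 := ⟨B - 1, by omega⟩
    rw [pathTime_succ]
    have h1 := hz.pathTime_pos b
    have h2 : (i : ℝ) ≤ ((b + 1 : ℕ) : ℝ) := by exact_mod_cast (by omega : i ≤ b + 1)
    have h3 : (i : ℝ) * θ 1 ≤ ((b + 1 : ℕ) : ℝ) * θ 1 := mul_le_mul_of_nonneg_right h2 h01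
    linarith

end Recurrence

section Policy

variable {Ω : Type*} [MeasurableSpace Ω] {P : Measure Ω} [IsProbabilityMeasure P] {B : ℕ}
  {τ : ℕ → Ω → ℝ} {lam : ℝ} {θ : ℕ → ℝ}

lemma infinite_visits_thresholdPolicy (hB : 1 ≤ B) (hτ : IsPoissonRecharge P τ) (hlam : 0 < lam)
    (hθ : ∀ k, 1 ≤ k → k ≤ B → lam ≤ θ k)
    (hs : IsOnlinePolicy P B τ hτ.measurable (thresholdPolicy B θ τ)) {k : ℕ} (hk : k ≤ B - 1) :
    ∀ᵐ ω ∂P, (visits B τ (thresholdPolicy B θ τ) k ω).Infinite := by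
  have h01 : 0 ≤ θ 1 := hlam.le.trans (hθ 1 le_rfl hB)
  refine infinite_visits hτ hs (J := B - k) (measurableSet_refillPaths B lam ((B + 1) * θ 1))
    (arrivalLaw_refillPaths_ne_zero hB hlam (by positivity)) ?_
  filter_upwards [hτ.ae_regular] with ω hy i hi
  rw [toReal_thresholdPolicy hB hy] at hi
  rw [energyAfter_thresholdPolicy hB hy, add_comm, Function.iterate_add_apply]
  have := iterate_step_of_mem_refillPaths hB hlam hθ (hy.restart _) hi
    ((step B θ)^[i] (0, fun m => τ m ω)).1 hk
  rwa [← iterate_step_snd hy] at this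

/-- An epoch is at most `max (θ 1) u`, where `u`, the time until the next arrival, is
exponential. -/
lemma isUniformlyBounded_thresholdPolicy (hB : 1 ≤ B) (hτ : IsPoissonRecharge P τ)
    (hθ : ∀ k, 1 ≤ k → k ≤ B → 0 ≤ θ k)
    (hs : IsOnlinePolicy P B τ hτ.measurable (thresholdPolicy B θ τ)) :
    IsUniformlyBounded P (thresholdPolicy B θ τ) := by
  set f : ℝ → ℝ≥0∞ := fun u => ENNReal.ofReal (θ 1 ^ 2 + u ^ 2) with hf
  have hfm : Measurable f := by fun_prop
  have hfin : ∫⁻ u, f u ∂expMeasure 1 ≠ ∞ := by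
    have : Integrable (fun u => θ 1 ^ 2 + u ^ 2) (expMeasure 1) :=
      (integrable_const _).add integrable_sq_expMeasure_one
    exact this.lintegral_lt_top.ne
  refine ⟨(∫⁻ u, f u ∂expMeasure 1).toNNReal, fun i => ?_⟩
  rw [ENNReal.coe_toNNReal hfin]
  have hmr : Measurable fun ω => restart (fun m => τ m ω) (thresholdPolicy B θ τ i ω).toReal :=
    measurable_restart (measurable_pi_lambda _ fun m => hτ.measurable m)
      (hs.measurable i).ennreal_toReal
  have hlaw : P.map (fun ω => restart (fun m => τ m ω) (thresholdPolicy B θ τ i ω).toReal) =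
      arrivalLaw := by
    refine Measure.ext fun H hH => ?_
    have := hs.strong_markov hτ i MeasurableSet.univ hH
    simp only [Set.mem_univ, true_and, Set.ofPred_true, measure_univ, one_mul] at this
    rw [Measure.map_apply hmr hH, ← this]
    rfl
  have hmap : arrivalLaw.map (fun z => z 0) = expMeasure 1 :=
    (measurePreserving_eval_infinitePi (fun _ : ℕ => expMeasure 1) 0).map_eq
  rw [← hmap, lintegral_map hfm (measurable_pi_apply 0), ← hlaw,
    lintegral_map (f := fun z : ℕ → ℝ => f (z 0)) (hfm.comp (measurable_pi_apply 0)) hmr]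
  refine lintegral_mono_ae ?_
  filter_upwards [hτ.ae_regular] with ω hy
  rw [toReal_thresholdPolicy hB hy, interUpdate, thresholdPolicy_eq hB hy,
    thresholdPolicy_eq hB hy, ← ENNReal.ofReal_sub _ (stepTime_nonneg _ _), stepTime_succ,
    add_sub_cancel_left, ← ENNReal.ofReal_pow (wait_nonneg _)]
  refine ENNReal.ofReal_le_ofReal ?_
  set z := restart (fun m => τ m ω) (stepTime B θ (0, fun m => τ m ω) i) with hz
  have hw := wait_le_max hB hθ (hy.restart (stepTime B θ (0, fun m => τ m ω) i))
    ((step B θ)^[i] (0, fun m => τ m ω)).1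
  rw [← iterate_step_snd hy] at hw
  rw [hz, ← iterate_step_snd hy (B := B) (θ := θ)]
  refine (pow_le_pow_left₀ (wait_nonneg _) hw 2).trans ?_
  rcases max_choice (θ 1) (((step B θ)^[i] (0, fun m => τ m ω)).2 0) with h | h <;> rw [h]
  · exact le_add_of_nonneg_right (sq_nonneg _)
  · exact le_add_of_nonneg_left (sq_nonneg _)

end Policy

end BatteryAge

theorem theorem1 {Ω : Type*} [MeasurableSpace Ω] (P : Measure Ω) [IsProbabilityMeasure P]
    (B : ℕ) (hB : 1 ≤ B) (τ : ℕ → Ω → ℝ) (hτ : BatteryAge.IsPoissonRecharge P τ) :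
    ∃ s : ℕ → Ω → ℝ≥0∞,
      BatteryAge.IsOptimalPolicy P B τ hτ.measurable s ∧
      ∀ k : ℕ, k ≤ B - 1 →
        (∀ᵐ ω ∂P, (BatteryAge.visits B τ s k ω).Infinite) ∧
        BatteryAge.IsRenewalProcess P (BatteryAge.visitTime B τ s k) := by
  obtain ⟨lam, θ, H, hH⟩ := BatteryAge.exists_isRelativeValue hB
  have hθ : ∀ k, 1 ≤ k → k ≤ B → 0 ≤ θ k := fun k h1 h2 => hH.lam_pos.le.trans (hH.lam_le k h1 h2)
  have hs := BatteryAge.isOnlinePolicy_thresholdPolicy hB hτ hθ hH.anti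
  refine ⟨BatteryAge.thresholdPolicy B θ τ,
    ⟨hs, BatteryAge.isUniformlyBounded_thresholdPolicy hB hτ hθ hs, fun s' hs' _ => ?_⟩,
    fun k hk => ?_⟩
  · exact (BatteryAge.averageAge_thresholdPolicy_le hB hτ hH).trans
      (BatteryAge.le_averageAge hτ hH hs')
  · have hinf := BatteryAge.infinite_visits_thresholdPolicy hB hτ hH.lam_pos hH.lam_le hs hk
    refine ⟨hinf, BatteryAge.isRenewalProcess_visitTime hτ hs hinf
      (BatteryAge.measurable_returnTime B θ k) ?_ ?_⟩
    · filter_upwards [hinf, hτ.ae_regular] with ω h hy n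
      exact BatteryAge.gap_visitTime_succ hB hy h n
    · filter_upwards [hinf, hτ.ae_regular] with ω h hy n
      exact BatteryAge.gap_visitTime_pos hB hH.lam_pos hH.lam_le hy h n
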